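/- Let $R=\mathbb Z[X]/(X^2)$, graded as an abelian group by placing $1$ in degree $1$ and $X$ in degree $-1$, and regard $R$–$R$ bimodules as $R\otimes_{\mathbb Z}R$-modules; all bimodules are $\mathbb Z$-graded (with the two actions of $X$ of degree $-2$), all bimodule maps and homotopies preserve the grading, and $M\{k\}$ denotes $M$ with all degrees raised by $k$. Let $E^*$ be the complex of graded $R$–$R$ bimodules with $E^0=R\otimes R$, $E^1=R\{1\}$, zero in all other degrees, whose coboundary $E^0\to E^1$ is the multiplication $\mu(a\otimes b)=ab$. For $n\ge 2$ let $L_n$ be the two-component link that is the closure of the positive braid word $(\sigma_1\cdots\sigma_n)^{n+1}\sigma_1\cdots\sigma_{n-1}$ on $n+1$ strands; one component is the torus knot $T(n,n+1)$, the other, formed by strand $n+1$, is an unknot. Its integral Khovanov complex $C^*_{\mathrm{Kh}}(L_n)$ (of this diagram, with $n(n+2)-1$ positive crossings, the generator of $C^0_{\mathrm{Kh}}$ in which all circles are labelled $1$ having quantum degree equal to the number of circles plus the number of crossings) is a complex of graded $R$–$R$ bimodules: $X$ acts from the left by multiplication by $X$ on the circle through a basepoint on the closing arc of strand $n$ (on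 the $T(n,n+1)$ component), and from the right on the circle through a basepoint on the closing arc of strand $n+1$ (on the unknot component). Then for every $n\ge 2$ there exists a complex $G^*$ of finitely generated graded $R$–$R$ bimodules, with $G^i=0$ unless $2\le i\le n(n+2)-1$, such that $$C^*_{\mathrm{Kh}}(L_n)\;\simeq\;E^*\{n(n+1)\}\oplus G^*$$ (chain homotopy equivalence of complexes of graded $R$–$R$ bimodules). -/

import Mathlib

open CategoryTheory CategoryTheory.Limits
open scoped TensorProduct

noncomputable section

namespace Khovanov

/-! ### Graded bimodules -/

/-- The ring `R = ℤ[X]/(X²)`; the class of `X` is `DualNumber.eps`. -/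
abbrev R : Type := DualNumber ℤ

/-- `R-R` bimodules are modules over `R ⊗ R`. -/
abbrev RR : Type := R ⊗[ℤ] R

/-- `X ⊗ 1`, the left action of `X`. -/
def XL : RR := (DualNumber.eps : R) ⊗ₜ[ℤ] (1 : R)

/-- `1 ⊗ X`, the right action of `X`. -/
def XR : RR := (1 : R) ⊗ₜ[ℤ] (DualNumber.eps : R)

section Internal

variable {M : Type} [AddCommGroup M]

theorem exists_proj {gr : ℤ → Submodule ℤ M} (h : DirectSum.IsInternal gr) :
    ∃ π : ℤ → M →+ M, (∀ q, ∀ x ∈ gr q, π q x = x) ∧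
      ∀ q q', ∀ x ∈ gr q, q ≠ q' → π q' x = 0 := by
  classical
  let _ := h.chooseDecomposition
  refine ⟨fun q => ((gr q).subtype.toAddMonoidHom.comp
    (DFinsupp.evalAddMonoidHom q : (DirectSum ℤ fun i => gr i) →+ _)).comp
      (DirectSum.decomposeAddEquiv gr).toAddMonoidHom, ?_, ?_⟩
  · intro q x hx
    exact DirectSum.decompose_of_mem_same gr hx
  · intro q q' x hx hq
    exact DirectSum.decompose_of_mem_ne gr hx hq

theorem isInternal_of_proj {gr : ℤ → Submodule ℤ M} (htop : ⨆ q, gr q = ⊤)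
    (π : ℤ → M →+ M) (h1 : ∀ q, ∀ x ∈ gr q, π q x = x)
    (h2 : ∀ q q', ∀ x ∈ gr q, q ≠ q' → π q' x = 0) : DirectSum.IsInternal gr := by
  rw [DirectSum.isInternal_submodule_iff_iSupIndep_and_iSup_eq_top]
  refine ⟨?_, htop⟩
  intro q
  rw [Submodule.disjoint_def]
  intro x hx hx'
  rw [← h1 q x hx]
  have hle : (⨆ (j : ℤ) (_ : j ≠ q), gr j) ≤ LinearMap.ker (π q).toIntLinearMap :=
    iSup₂_le fun j hj y hy => h2 j q y hy hj
  exact hle hx'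

theorem map_mem_of_mem_span {N : Type} [AddCommGroup N] (f : M →+ N) {s : Set M}
    {T : Submodule ℤ N} (h : ∀ x ∈ s, f x ∈ T) {x : M} (hx : x ∈ Submodule.span ℤ s) :
    f x ∈ T := by
  have : Submodule.span ℤ s ≤ T.comap f.toIntLinearMap := Submodule.span_le.2 h
  exact this hx

end Internal

/-- A `ℤ`-graded `R-R` bimodule, in which the two actions of `X` have degree `-2`. -/
structure GrBimod where
  carrier : Type
  [addCommGroup : AddCommGroup carrier]
  [module : Module RR carrier]
  /-- the homogeneous elements of a given quantum degree -/
  gr : ℤ → Submodule ℤ carrier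
  internal : DirectSum.IsInternal gr
  left_mem : ∀ q, ∀ x ∈ gr q, XL • x ∈ gr (q - 2)
  right_mem : ∀ q, ∀ x ∈ gr q, XR • x ∈ gr (q - 2)

namespace GrBimod

attribute [instance] GrBimod.addCommGroup GrBimod.module

instance : CoeSort GrBimod Type := ⟨GrBimod.carrier⟩

/-- Bimodule homomorphisms that preserve the grading. -/
def homs (M N : GrBimod) : AddSubgroup (M →ₗ[RR] N) where
  carrier := {f | ∀ q, ∀ x ∈ M.gr q, f x ∈ N.gr q}
  add_mem' hf hg q x hx := (N.gr q).add_mem (hf q x hx) (hg q x hx)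
  zero_mem' q _ _ := (N.gr q).zero_mem
  neg_mem' hf q x hx := (N.gr q).neg_mem (hf q x hx)

instance : Category GrBimod where
  Hom M N := homs M N
  id M := ⟨LinearMap.id, fun _ _ hx => hx⟩
  comp f g := ⟨g.1.comp f.1, fun q _ hx => g.2 q _ (f.2 q _ hx)⟩

/-- The bimodule map underlying a morphism. -/
def toLin {M N : GrBimod} (f : M ⟶ N) : M →ₗ[RR] N := f.1

/-- A grading preserving bimodule map as a morphism. -/
def ofLin {M N : GrBimod} (f : M →ₗ[RR] N) (hf : ∀ q, ∀ x ∈ M.gr q, f x ∈ N.gr q) : M ⟶ N :=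
  ⟨f, hf⟩

theorem hom_ext {M N : GrBimod} {f g : M ⟶ N} (h : ∀ x, toLin f x = toLin g x) : f = g :=
  Subtype.ext (LinearMap.ext h)

instance : Preadditive GrBimod where
  homGroup M N := inferInstanceAs (AddCommGroup (homs M N))
  add_comp _ _ _ f f' g := hom_ext fun x => map_add g.1 (f.1 x) (f'.1 x)
  comp_add _ _ _ _ _ _ := hom_ext fun _ => rfl

/-- The direct sum of two graded bimodules. -/
def prod (M N : GrBimod) : GrBimod where
  carrier := M × N
  gr q := (M.gr q).prod (N.gr q)
  internal := by
    obtain ⟨π, h1, h2⟩ := exists_proj M.internal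
    obtain ⟨ρ, k1, k2⟩ := exists_proj N.internal
    refine isInternal_of_proj ?_ (fun q => (π q).prodMap (ρ q)) ?_ ?_
    · rw [eq_top_iff]
      rintro ⟨x, y⟩ -
      have hx : x ∈ ⨆ q, M.gr q := by rw [M.internal.submodule_iSup_eq_top]; trivial
      have hy : y ∈ ⨆ q, N.gr q := by rw [N.internal.submodule_iSup_eq_top]; trivial
      have hx' := Submodule.mem_map_of_mem (f := LinearMap.inl ℤ M N) hx
      have hy' := Submodule.mem_map_of_mem (f := LinearMap.inr ℤ M N) hy
      rw [Submodule.map_iSup] at hx' hy'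
      have e : ((x, y) : M × N) = LinearMap.inl ℤ M N x + LinearMap.inr ℤ M N y := by simp
      rw [e]
      refine Submodule.add_mem _ (SetLike.le_def.1 (iSup_mono fun q => ?_) hx')
        (SetLike.le_def.1 (iSup_mono fun q => ?_) hy')
      · rintro _ ⟨z, hz, rfl⟩
        exact ⟨hz, (N.gr q).zero_mem⟩
      · rintro _ ⟨z, hz, rfl⟩
        exact ⟨(M.gr q).zero_mem, hz⟩
    · rintro q ⟨x, y⟩ ⟨hx, hy⟩
      exact Prod.ext (h1 q x hx) (k1 q y hy)
    · rintro q q' ⟨x, y⟩ ⟨hx, hy⟩ hq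
      exact Prod.ext (h2 q q' x hx hq) (k2 q q' y hy hq)
  left_mem q x hx := ⟨M.left_mem q _ hx.1, N.left_mem q _ hx.2⟩
  right_mem q x hx := ⟨M.right_mem q _ hx.1, N.right_mem q _ hx.2⟩

instance : HasBinaryBiproducts GrBimod where
  has_binary_biproduct M N := hasBinaryBiproduct_of_total
    { pt := prod M N
      fst := ofLin (LinearMap.fst RR M N) fun _ _ hx => hx.1
      snd := ofLin (LinearMap.snd RR M N) fun _ _ hx => hx.2
      inl := ofLin (LinearMap.inl RR M N) fun q _ hx => ⟨hx, (N.gr q).zero_mem⟩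
      inr := ofLin (LinearMap.inr RR M N) fun q _ hx => ⟨(M.gr q).zero_mem, hx⟩
      inl_fst := hom_ext fun _ => rfl
      inl_snd := hom_ext fun _ => rfl
      inr_fst := hom_ext fun _ => rfl
      inr_snd := hom_ext fun _ => rfl }
    (hom_ext fun x => Prod.ext (add_zero x.1) (zero_add x.2))

/-- The direct sum of a finite family of graded bimodules. -/
def pi {ι : Type} [Finite ι] (M : ι → GrBimod) : GrBimod where
  carrier := ∀ i, M i
  gr q := Submodule.pi Set.univ fun i => (M i).gr q
  internal := by
    classical
    have := Fintype.ofFinite ι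
    choose π h1 h2 using fun i => exists_proj (M i).internal
    refine isInternal_of_proj ?_ (fun q => AddMonoidHom.mk' (fun x i => π i q (x i)) ?_) ?_ ?_
    · rw [eq_top_iff]
      rintro x -
      rw [← Finset.univ_sum_single x]
      refine Submodule.sum_mem _ fun i _ => ?_
      have hx : x i ∈ ⨆ q, (M i).gr q := by
        rw [(M i).internal.submodule_iSup_eq_top]; trivial
      have hx' := Submodule.mem_map_of_mem (f := LinearMap.single ℤ (fun i => M i) i) hx
      rw [Submodule.map_iSup] at hx'
      refine SetLike.le_def.1 (iSup_mono fun q => ?_) hx'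
      rintro _ ⟨z, hz, rfl⟩ j -
      by_cases hj : j = i
      · subst hj
        simpa using hz
      · simp [hj]
    · intro x y
      funext i
      exact map_add _ _ _
    · intro q x hx
      funext i
      exact h1 i q _ (hx i trivial)
    · intro q q' x hx hq
      funext i
      exact h2 i q q' _ (hx i trivial) hq
  left_mem q x hx i hi := (M i).left_mem q _ (hx i hi)
  right_mem q x hx i hi := (M i).right_mem q _ (hx i hi)

/-- The grading shift `M{k}`: an element of degree `q` in `M` has degree `q + k` in `M{k}`. -/
def twist (k : ℤ) (M : GrBimod) : GrBimod where
  carrier := M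
  gr q := M.gr (q - k)
  internal := by
    obtain ⟨π, h1, h2⟩ := exists_proj M.internal
    refine isInternal_of_proj ?_ (fun q => π (q - k)) (fun q x hx => h1 _ x hx)
      (fun q q' x hx hq => h2 _ _ x hx fun h => hq (by linarith))
    rw [← M.internal.submodule_iSup_eq_top]
    exact (Equiv.subRight k).iSup_comp (g := M.gr)
  left_mem q x hx := by
    rw [sub_right_comm]
    exact M.left_mem _ x hx
  right_mem q x hx := by
    rw [sub_right_comm]
    exact M.right_mem _ x hx

/-- The grading shift as a functor. -/
def twistFunctor (k : ℤ) : GrBimod ⥤ GrBimod where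
  obj M := twist k M
  map {M N} f := ofLin (M := twist k M) (N := twist k N) (toLin (M := M) (N := N) f)
    fun q x hx => f.2 (q - k) x hx

instance (k : ℤ) : (twistFunctor k).Additive where
  map_add {_ _ _ _} := rfl

/-- A grading in which each element of a `ℤ`-basis is homogeneous. -/
theorem basis_isInternal {M ι : Type} [AddCommGroup M] [Finite ι] (b : Module.Basis ι ℤ M)
    (deg : ι → ℤ) :
    DirectSum.IsInternal fun q : ℤ => Submodule.span ℤ (b '' {i | deg i = q}) := by
  classical
  let π : ℤ → M →ₗ[ℤ] M := fun q => b.constr ℤ fun i => if deg i = q then b i else 0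
  refine isInternal_of_proj ?_ (fun q => (π q).toAddMonoidHom) ?_ ?_
  · rw [eq_top_iff, ← b.span_eq, Submodule.span_le]
    rintro _ ⟨i, rfl⟩
    exact Submodule.mem_iSup_of_mem (deg i) (Submodule.subset_span ⟨i, rfl, rfl⟩)
  · intro q x hx
    have : Submodule.span ℤ (b '' {i | deg i = q}) ≤ LinearMap.eqLocus (π q) LinearMap.id := by
      rw [Submodule.span_le]
      rintro _ ⟨i, hi, rfl⟩
      simp only [Set.mem_ofPred_eq] at hi
      simp [π, Module.Basis.constr_basis, hi]
    exact this hx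
  · intro q q' x hx hq
    have : Submodule.span ℤ (b '' {i | deg i = q}) ≤ LinearMap.ker (π q') := by
      rw [Submodule.span_le]
      rintro _ ⟨i, hi, rfl⟩
      simp only [Set.mem_ofPred_eq] at hi
      simp [π, Module.Basis.constr_basis, hi, hq]
    exact this hx

end GrBimod

/-! ### The complex `E` -/

/-- The `ℤ`-basis `1, X` of `R`. -/
def basisR : Module.Basis (Fin 2) ℤ R :=
  Module.Basis.ofEquivFun
    { toFun := fun x => ![TrivSqZeroExt.fst x, TrivSqZeroExt.snd x]
      invFun := fun v => TrivSqZeroExt.inl (v 0) + TrivSqZeroExt.inr (v 1)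
      map_add' := fun x y => by simp
      map_smul' := fun r x => by simp
      left_inv := fun x => TrivSqZeroExt.inl_fst_add_inr_snd_eq x
      right_inv := fun v => by ext i; fin_cases i <;> simp }

theorem basisR_zero : basisR 0 = 1 := by
  ext <;> simp [basisR]

theorem basisR_one : basisR 1 = DualNumber.eps := by
  ext <;> simp [basisR]

/-- The degrees of `1` and `X` in `R` are `1` and `-1`. -/
def degR : Fin 2 → ℤ := ![1, -1]

/-- The `R-R` bimodule structure of `R`: `(a ⊗ b) • c = a * b * c`. -/
instance : Module RR R := Module.compHom R (Algebra.TensorProduct.lmul' ℤ (S := R)).toRingHom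

theorem smul_R_def (s : RR) (c : R) : s • c = Algebra.TensorProduct.lmul' ℤ (S := R) s * c := rfl

/-- `R` as a graded bimodule, `1` in degree `1` and `X` in degree `-1`. -/
def grR : GrBimod where
  carrier := R
  gr q := Submodule.span ℤ (basisR '' {i | degR i = q})
  internal := GrBimod.basis_isInternal basisR degR
  left_mem q _ hx := by
    refine map_mem_of_mem_span (DistribSMul.toAddMonoidHom _ XL) (fun x h => ?_) hx
    obtain ⟨i, hi, rfl⟩ := h
    fin_cases i
    · refine Submodule.subset_span ⟨1, ?_, ?_⟩
      · simp [degR] at hi ⊢; omega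
      · simp [smul_R_def, XL, basisR_zero, basisR_one]
    · simp [smul_R_def, XL, basisR_one]
  right_mem q _ hx := by
    refine map_mem_of_mem_span (DistribSMul.toAddMonoidHom _ XR) (fun x h => ?_) hx
    obtain ⟨i, hi, rfl⟩ := h
    fin_cases i
    · refine Submodule.subset_span ⟨1, ?_, ?_⟩
      · simp [degR] at hi ⊢; omega
      · simp [smul_R_def, XR, basisR_zero, basisR_one]
    · simp [smul_R_def, XR, basisR_one]

/-- `R ⊗ R` as a graded bimodule; the degree of `a ⊗ b` is the sum of the degrees. -/
def grRR : GrBimod where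
  carrier := RR
  gr q := Submodule.span ℤ ((basisR.tensorProduct basisR) '' {i | degR i.1 + degR i.2 = q})
  internal := GrBimod.basis_isInternal (basisR.tensorProduct basisR) fun i => degR i.1 + degR i.2
  left_mem q _ hx := by
    refine map_mem_of_mem_span (DistribSMul.toAddMonoidHom _ XL) (fun x h => ?_) hx
    obtain ⟨⟨i, j⟩, hi, rfl⟩ := h
    fin_cases i
    · refine Submodule.subset_span ⟨(1, j), ?_, ?_⟩
      · simp [degR] at hi ⊢; omega
      · simp [XL, basisR_zero, basisR_one]
    · simp [XL, basisR_one]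
  right_mem q _ hx := by
    refine map_mem_of_mem_span (DistribSMul.toAddMonoidHom _ XR) (fun x h => ?_) hx
    obtain ⟨⟨i, j⟩, hi, rfl⟩ := h
    fin_cases j
    · refine Submodule.subset_span ⟨(i, 1), ?_, ?_⟩
      · simp [degR] at hi ⊢; omega
      · simp [XR, basisR_zero, basisR_one]
    · simp [XR, basisR_one]

/-- The multiplication `R ⊗ R → R` as a bimodule map. -/
def mulLin : RR →ₗ[RR] R where
  toFun := Algebra.TensorProduct.lmul' ℤ (S := R)
  map_add' := map_add _
  map_smul' s x := map_mul _ s x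

/-- The multiplication as a graded map `μ : R ⊗ R → R{1}`. -/
def mu : grRR ⟶ GrBimod.twist 1 grR :=
  GrBimod.ofLin (M := grRR) (N := GrBimod.twist 1 grR) mulLin fun q _ hx => by
    refine map_mem_of_mem_span (T := (GrBimod.twist 1 grR).gr q) mulLin.toAddMonoidHom
      (fun x h => ?_) hx
    obtain ⟨⟨i, j⟩, hi, rfl⟩ := h
    change mulLin _ ∈ Submodule.span ℤ (basisR '' {i | degR i = q - 1})
    fin_cases i <;> fin_cases j
    · refine Submodule.subset_span ⟨0, ?_, ?_⟩
      · simp [degR] at hi ⊢; omega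
      · simp [mulLin, basisR_zero]
    · refine Submodule.subset_span ⟨1, ?_, ?_⟩
      · simp [degR] at hi ⊢; omega
      · simp [mulLin, basisR_zero]
    · refine Submodule.subset_span ⟨1, ?_, ?_⟩
      · simp [degR] at hi ⊢; omega
      · simp [mulLin, basisR_zero]
    · simp [mulLin, basisR_one]

/-- The zero bimodule. -/
def grZero : GrBimod := GrBimod.pi (ι := Empty) fun i => i.elim

/-- The terms of the complex `E`. -/
def EX : ℕ → GrBimod
  | 0 => grRR
  | 1 => GrBimod.twist 1 grR
  | _ + 2 => grZero

/-- The coboundaries of the complex `E`. -/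
def Ed : ∀ i, EX i ⟶ EX (i + 1)
  | 0 => mu
  | _ + 1 => 0

/-- The complex `E`: `R ⊗ R` in degree `0`, `R{1}` in degree `1`, zero elsewhere, with
coboundary the multiplication. -/
def E : CochainComplex GrBimod ℕ := CochainComplex.of EX Ed fun _ => comp_zero

/-- The grading shift `C{k}` of a complex of graded bimodules. -/
def shift (k : ℤ) (C : CochainComplex GrBimod ℕ) : CochainComplex GrBimod ℕ :=
  ((GrBimod.twistFunctor k).mapHomologicalComplex (ComplexShape.up ℕ)).obj C

section Cycles

variable {α : Type} [Finite α]

theorem sameCycle_mul_swap_of_not [DecidableEq α] {π : Equiv.Perm α} {x y : α}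
    (h : ¬ π.SameCycle x y) : (π * Equiv.swap x y).SameCycle x y := by
  have hxy : x ≠ y := fun e => h (e ▸ Equiv.Perm.SameCycle.refl _ _)
  have hex : ∃ n, 0 < n ∧ (π ^ n) y = y :=
    ⟨orderOf π, (isOfFinOrder_of_finite π).orderOf_pos, by rw [pow_orderOf_eq_one]; rfl⟩
  classical
  obtain ⟨hn, hny⟩ := Nat.find_spec hex
  have hmin := fun m => Nat.find_min hex (m := m)
  set n := Nat.find hex
  have key : ∀ j, 1 ≤ j → j ≤ n → ((π * Equiv.swap x y) ^ j) x = (π ^ j) y := by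
    intro j hj
    induction j, hj using Nat.le_induction with
    | base => intro _; simp
    | succ j hj ih =>
      intro hjn
      have h1 : (π ^ j) y ≠ y := fun e => hmin j (by omega) ⟨by omega, e⟩
      have h2 : (π ^ j) y ≠ x := fun e =>
        h (Equiv.Perm.SameCycle.symm ⟨j, by simpa using e⟩)
      rw [pow_succ', Equiv.Perm.mul_apply, ih (by omega), Equiv.Perm.mul_apply,
        Equiv.swap_apply_of_ne_of_ne h2 h1, pow_succ', Equiv.Perm.mul_apply]
  exact ⟨n, by simpa using (key n hn le_rfl).trans hny⟩

theorem not_sameCycle_mul_swap [DecidableEq α] {π : Equiv.Perm α} {x y : α} (hxy : x ≠ y)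
    (h : π.SameCycle x y) : ¬ (π * Equiv.swap x y).SameCycle x y := by
  have hex : ∃ n : ℕ, (π ^ n) x = y := by
    obtain ⟨n, hn⟩ := h.exists_nat_pow_eq
    exact ⟨n, hn⟩
  classical
  have hny := Nat.find_spec hex
  have hmin := fun m => Nat.find_min hex (m := m)
  set n := Nat.find hex
  have hn : 0 < n := by
    rcases Nat.eq_zero_or_pos n with h0 | h0
    · rw [h0] at hny; exact absurd hny hxy
    · exact h0
  have hx : ∀ j, 1 ≤ j → j < n → (π ^ j) x ≠ x := by
    intro j hj hjn e
    refine hmin (n - j) (by omega) ?_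
    rw [← hny]
    conv_rhs => rw [show n = (n - j) + j by omega, pow_add, Equiv.Perm.mul_apply, e]
  have key : ∀ j, 1 ≤ j → j ≤ n → ((π * Equiv.swap x y) ^ j) y = (π ^ j) x := by
    intro j hj
    induction j, hj using Nat.le_induction with
    | base => intro _; simp
    | succ j hj ih =>
      intro hjn
      rw [pow_succ', Equiv.Perm.mul_apply, ih (by omega), Equiv.Perm.mul_apply,
        Equiv.swap_apply_of_ne_of_ne (hx j hj (by omega)) (hmin j (by omega)), pow_succ',
        Equiv.Perm.mul_apply]
  have hper : ((π * Equiv.swap x y) ^ n) y = y := (key n hn le_rfl).trans hny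
  intro hc
  obtain ⟨r, hr⟩ := hc.symm.exists_nat_pow_eq
  have hq : ∀ q : ℕ, ((π * Equiv.swap x y) ^ (n * q)) y = y := by
    intro q
    rw [pow_mul]
    exact Function.IsFixedPt.iterate (f := ((π * Equiv.swap x y) ^ n)) hper q |> fun e => by
      rw [← Equiv.Perm.coe_pow] at e; exact e
  rw [← Nat.mod_add_div r n, pow_add, Equiv.Perm.mul_apply, hq] at hr
  have hlt := Nat.mod_lt r hn
  rcases Nat.eq_zero_or_pos (r % n) with h0 | h0
  · rw [h0] at hr; exact hxy hr.symm
  · rw [key _ h0 hlt.le] at hr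
    exact hx _ h0 hlt hr

theorem card_quotient_of_merge (r₁ r₂ : Setoid α) {x y : α} (hxy : ¬ r₁ x y)
    (h : ∀ p q, r₂ p q ↔ r₁ p q ∨ ((r₁ p x ∨ r₁ p y) ∧ (r₁ q x ∨ r₁ q y))) :
    Nat.card (Quotient r₁) = Nat.card (Quotient r₂) + 1 := by
  classical
  have hle : ∀ p q, r₁ p q → r₂ p q := fun p q hp => (h p q).2 (Or.inl hp)
  let f : {c : Quotient r₁ // c ≠ Quotient.mk r₁ y} → Quotient r₂ :=
    fun c => Quotient.map' (s₁ := r₁) (s₂ := r₂) id hle c.1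
  have hf : Function.Bijective f := by
    constructor
    · rintro ⟨c, hc⟩ ⟨d, hd⟩ e
      induction c using Quotient.inductionOn with | _ p
      induction d using Quotient.inductionOn with | _ q
      have hp : ¬ r₁ p y := fun e => hc (Quotient.sound e)
      have hq : ¬ r₁ q y := fun e => hd (Quotient.sound e)
      have e' : r₂ p q := Quotient.exact e
      rcases (h p q).1 e' with e' | ⟨e1, e2⟩
      · exact Subtype.ext (Quotient.sound e')
      · exact Subtype.ext (Quotient.sound
          (r₁.trans (e1.resolve_right hp) (r₁.symm (e2.resolve_right hq))))
    · intro c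
      induction c using Quotient.inductionOn with | _ p
      by_cases hp : r₁ p y
      · refine ⟨⟨Quotient.mk r₁ x, fun e => hxy (Quotient.exact e)⟩, Quotient.sound ?_⟩
        exact (h x p).2 (Or.inr ⟨Or.inl (r₁.refl x), Or.inr hp⟩)
      · exact ⟨⟨Quotient.mk r₁ p, fun e => hp (Quotient.exact e)⟩, rfl⟩
  rw [← Nat.card_congr (Equiv.optionSubtypeNe (Quotient.mk r₁ y)), Finite.card_option,
    Nat.card_congr (Equiv.ofBijective f hf)]

end Cycles

/-! ### Closures of positive braid words and their smoothings -/

section Braid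

variable {m : ℕ} (w : List (Fin m))

/-- Points on the closure of a braid with `m + 1` strands and braid word `w`: the point `(t, j)`
lies on the vertical line number `j` and at height `t`; the letter number `t` of `w` is the
crossing between the heights `t` and `t + 1`. -/
abbrev Pt : Type := Fin (w.length + 1) × Fin (m + 1)

/-- The crossings of the braid closure. -/
abbrev Crossing : Type := Fin w.length

variable {w} in
/-- The point below the crossing `t` on the left. -/
def botL (t : Crossing w) : Pt w := (t.castSucc, (w.get t).castSucc)

variable {w} in
/-- The point below the crossing `t` on the right. -/
def botR (t : Crossing w) : Pt w := (t.castSucc, (w.get t).succ)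

variable {w} in
/-- The point above the crossing `t` on the left. -/
def topL (t : Crossing w) : Pt w := (t.succ, (w.get t).castSucc)

variable {w} in
/-- The point above the crossing `t` on the right. -/
def topR (t : Crossing w) : Pt w := (t.succ, (w.get t).succ)

/-- The arcs of the smoothing of the braid closure in which the crossings in `s` get the
`1`-smoothing and all other crossings the `0`-smoothing. All crossings are positive, so that
the `0`-smoothing is the oriented one (two vertical arcs) and the `1`-smoothing consists of two
horizontal arcs. -/
inductive Arc (s : Finset (Crossing w)) : Pt w → Pt w → Prop
  /-- the closing arc, outside of the braid -/
  | close (j : Fin (m + 1)) : Arc s (Fin.last _, j) (0, j)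
  /-- vertical arcs away from the crossing -/
  | strand (t : Crossing w) (j : Fin (m + 1)) (hl : j ≠ (w.get t).castSucc)
      (hr : j ≠ (w.get t).succ) : Arc s (t.castSucc, j) (t.succ, j)
  /-- the `0`-smoothing -/
  | left (t : Crossing w) (h : t ∉ s) : Arc s (botL t) (topL t)
  | right (t : Crossing w) (h : t ∉ s) : Arc s (botR t) (topR t)
  /-- the `1`-smoothing -/
  | bot (t : Crossing w) (h : t ∈ s) : Arc s (botL t) (botR t)
  | top (t : Crossing w) (h : t ∈ s) : Arc s (topL t) (topR t)

/-- Two points are equivalent if they lie on the same circle of the smoothing. -/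
def sameCircle (s : Finset (Crossing w)) : Setoid (Pt w) := Relation.EqvGen.setoid (Arc w s)

/-- The number of circles of a smoothing. -/
def numCircles (s : Finset (Crossing w)) : ℕ := Nat.card (Quotient (sameCircle w s))

variable {w}

theorem Arc.same {s : Finset (Crossing w)} {p q : Pt w} (h : Arc w s p q) : sameCircle w s p q :=
  Relation.EqvGen.rel _ _ h

theorem sameCircle_le {s : Finset (Crossing w)} {r : Setoid (Pt w)}
    (h : ∀ p q, Arc w s p q → r p q) {p q : Pt w} (hpq : sameCircle w s p q) : r p q := by
  induction hpq with
  | rel _ _ h' => exact h _ _ h'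
  | refl _ => exact r.refl _
  | symm _ _ _ ih => exact r.symm ih
  | trans _ _ _ _ _ ih ih' => exact r.trans ih ih'

/-! Every smoothing is oriented by letting the vertical lines alternately run up and down. -/

/-- The next point on the circle, in the alternating orientation. -/
def next (s : Finset (Crossing w)) (p : Pt w) : Pt w :=
  if Even (p.2 : ℕ) then
    Fin.lastCases (motive := fun _ => Pt w) (0, p.2)
      (fun t => if t ∈ s ∧ p.2 = (w.get t).castSucc then botR t
        else if t ∈ s ∧ p.2 = (w.get t).succ then botL t else (t.succ, p.2)) p.1
  else
    Fin.cases (motive := fun _ => Pt w) (Fin.last _, p.2)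
      (fun t => if t ∈ s ∧ p.2 = (w.get t).castSucc then topR t
        else if t ∈ s ∧ p.2 = (w.get t).succ then topL t else (t.castSucc, p.2)) p.1

/-- The point at a crossing on the line that runs up, below the crossing. -/
def inU (t : Crossing w) : Pt w := if Even (w.get t : ℕ) then botL t else botR t

/-- The point at a crossing on the line that runs down, above the crossing. -/
def inD (t : Crossing w) : Pt w := if Even (w.get t : ℕ) then topR t else topL t

theorem inU_ne_inD (t : Crossing w) : inU t ≠ inD t := by
  intro h
  have h1 : (inU t).1 = t.castSucc := by unfold inU botL botR; split_ifs <;> rfl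
  have h2 : (inD t).1 = t.succ := by unfold inD topL topR; split_ifs <;> rfl
  have := congrArg (fun p => (p.1 : ℕ)) h
  simp [h1, h2] at this

theorem next_last {s : Finset (Crossing w)} {j : Fin (m + 1)} (hj : Even (j : ℕ)) :
    next s (Fin.last _, j) = (0, j) := by
  simp [next, hj]

theorem next_castSucc {s : Finset (Crossing w)} {j : Fin (m + 1)} (hj : Even (j : ℕ))
    (t : Crossing w) : next s (t.castSucc, j) =
      if t ∈ s ∧ j = (w.get t).castSucc then botR t
        else if t ∈ s ∧ j = (w.get t).succ then botL t else (t.succ, j) := by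
  simp only [next, hj, if_true, Fin.lastCases_castSucc]

theorem next_zero {s : Finset (Crossing w)} {j : Fin (m + 1)} (hj : ¬ Even (j : ℕ)) :
    next s (0, j) = (Fin.last _, j) := by
  simp [next, hj]

theorem next_succ {s : Finset (Crossing w)} {j : Fin (m + 1)} (hj : ¬ Even (j : ℕ))
    (t : Crossing w) : next s (t.succ, j) =
      if t ∈ s ∧ j = (w.get t).castSucc then topR t
        else if t ∈ s ∧ j = (w.get t).succ then topL t else (t.castSucc, j) := by
  simp only [next, hj, if_false, Fin.cases_succ]

theorem even_inU (t : Crossing w) : Even ((inU t).2 : ℕ) := by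
  unfold inU botL botR
  split_ifs with h <;> simp [h, Nat.even_add_one, -List.get_eq_getElem]

theorem not_even_inD (t : Crossing w) : ¬ Even ((inD t).2 : ℕ) := by
  unfold inD topL topR
  split_ifs with h <;> simp [h, Nat.even_add_one, -List.get_eq_getElem]

theorem inU_fst (t : Crossing w) : (inU t).1 = t.castSucc := by
  unfold inU botL botR; split_ifs <;> rfl

theorem inD_fst (t : Crossing w) : (inD t).1 = t.succ := by
  unfold inD topL topR; split_ifs <;> rfl

theorem next_inU {s : Finset (Crossing w)} (t : Crossing w) :
    next s (inU t) = if t ∈ s then (t.castSucc, (inD t).2) else (t.succ, (inU t).2) := by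
  have h := next_castSucc (s := s) (even_inU t) t
  rw [← inU_fst] at h
  rw [h]
  by_cases e : Even (w.get t : ℕ) <;> by_cases ht : t ∈ s <;>
    simp [inU, inD, e, ht, botL, botR, topL, topR, Fin.ext_iff, -List.get_eq_getElem]

theorem next_inD {s : Finset (Crossing w)} (t : Crossing w) :
    next s (inD t) = if t ∈ s then (t.succ, (inU t).2) else (t.castSucc, (inD t).2) := by
  have h := next_succ (s := s) (not_even_inD t) t
  rw [← inD_fst] at h
  rw [h]
  by_cases e : Even (w.get t : ℕ) <;> by_cases ht : t ∈ s <;>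
    simp [inU, inD, e, ht, botL, botR, topL, topR, Fin.ext_iff, -List.get_eq_getElem]

theorem next_insert {s : Finset (Crossing w)} {k : Crossing w} (hk : k ∉ s) (p : Pt w) :
    next (insert k s) p = next s (Equiv.swap (inU k) (inD k) p) := by
  by_cases hU : p = inU k
  · rw [hU, Equiv.swap_apply_left, next_inU, next_inD]
    simp [hk]
  by_cases hD : p = inD k
  · rw [hD, Equiv.swap_apply_right, next_inU, next_inD]
    simp [hk]
  rw [Equiv.swap_apply_of_ne_of_ne hU hD]
  obtain ⟨t, j⟩ := p
  by_cases hj : Even (j : ℕ)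
  · induction t using Fin.lastCases with
    | last => rw [next_last hj, next_last hj]
    | cast t =>
      rw [next_castSucc hj, next_castSucc hj]
      by_cases ht : t = k
      · subst ht
        have h1 : j ≠ (w.get t).castSucc := by
          rintro rfl
          refine hU ?_
          simp at hj
          simp [inU, hj, botL]
        have h2 : j ≠ (w.get t).succ := by
          rintro rfl
          refine hU ?_
          simp [Nat.even_add_one] at hj
          simp [inU, hj, botR]
        simp only [h1, h2, and_false]
      · simp only [Finset.mem_insert, ht, false_or]
  · induction t using Fin.cases with
    | zero => rw [next_zero hj, next_zero hj]
    | succ t =>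
      rw [next_succ hj, next_succ hj]
      by_cases ht : t = k
      · subst ht
        have h1 : j ≠ (w.get t).castSucc := by
          rintro rfl
          refine hD ?_
          simp at hj
          simp [inD, hj, topL]
        have h2 : j ≠ (w.get t).succ := by
          rintro rfl
          refine hD ?_
          simp [Nat.even_add_one] at hj
          simp [inD, hj, topR]
        simp only [h1, h2, and_false]
      · simp only [Finset.mem_insert, ht, false_or]

theorem next_bijective (s : Finset (Crossing w)) : Function.Bijective (next s) := by
  induction s using Finset.induction_on with
  | empty =>
    apply Finite.surjective_iff_bijective.1
    rintro ⟨t, j⟩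
    by_cases hj : Even (j : ℕ)
    · induction t using Fin.cases with
      | zero => exact ⟨_, next_last hj⟩
      | succ t => exact ⟨(t.castSucc, j), by rw [next_castSucc hj]; simp⟩
    · induction t using Fin.lastCases with
      | last => exact ⟨_, next_zero hj⟩
      | cast t => exact ⟨(t.succ, j), by rw [next_succ hj]; simp⟩
  | insert k s hk ih =>
    have : next (insert k s) = next s ∘ Equiv.swap (inU k) (inD k) :=
      funext fun p => next_insert hk p
    rw [this]
    exact ih.comp (Equiv.bijective _)

/-- The permutation of the points that follows the circles. -/
def tour (s : Finset (Crossing w)) : Equiv.Perm (Pt w) := Equiv.ofBijective _ (next_bijective s)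

theorem tour_insert {s : Finset (Crossing w)} {k : Crossing w} (hk : k ∉ s) :
    tour (insert k s) = tour s * Equiv.swap (inU k) (inD k) :=
  Equiv.ext fun p => next_insert hk p

theorem same_next (s : Finset (Crossing w)) (p : Pt w) : sameCircle w s p (next s p) := by
  obtain ⟨t, j⟩ := p
  by_cases hj : Even (j : ℕ)
  · induction t using Fin.lastCases with
    | last => rw [next_last hj]; exact (Arc.close j).same
    | cast t =>
      rw [next_castSucc hj]
      split_ifs with h1 h2
      · rw [h1.2]; exact (Arc.bot t h1.1).same
      · rw [h2.2]; exact (sameCircle w s).symm (Arc.bot t h2.1).same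
      · by_cases ht : t ∈ s
        · exact (Arc.strand t j (fun e => h1 ⟨ht, e⟩) (fun e => h2 ⟨ht, e⟩)).same
        · by_cases e1 : j = (w.get t).castSucc
          · rw [e1]; exact (Arc.left t ht).same
          by_cases e2 : j = (w.get t).succ
          · rw [e2]; exact (Arc.right t ht).same
          exact (Arc.strand t j e1 e2).same
  · induction t using Fin.cases with
    | zero => rw [next_zero hj]; exact (sameCircle w s).symm (Arc.close j).same
    | succ t =>
      rw [next_succ hj]
      split_ifs with h1 h2
      · rw [h1.2]; exact (Arc.top t h1.1).same
      · rw [h2.2]; exact (sameCircle w s).symm (Arc.top t h2.1).same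
      · refine (sameCircle w s).symm ?_
        by_cases ht : t ∈ s
        · exact (Arc.strand t j (fun e => h1 ⟨ht, e⟩) (fun e => h2 ⟨ht, e⟩)).same
        · by_cases e1 : j = (w.get t).castSucc
          · rw [e1]; exact (Arc.left t ht).same
          by_cases e2 : j = (w.get t).succ
          · rw [e2]; exact (Arc.right t ht).same
          exact (Arc.strand t j e1 e2).same

theorem arc_sameCycle {s : Finset (Crossing w)} {p q : Pt w} (h : Arc w s p q) :
    (tour s).SameCycle p q := by
  have hn : ∀ p q, next s p = q → (tour s).SameCycle p q := fun p q h => ⟨1, by simpa [tour]⟩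
  have hn' : ∀ p q, next s q = p → (tour s).SameCycle p q := fun p q h => (hn q p h).symm
  cases h with
  | close j =>
    by_cases hj : Even (j : ℕ)
    · exact hn _ _ (next_last hj)
    · exact hn' _ _ (next_zero hj)
  | strand t j hl hr =>
    by_cases hj : Even (j : ℕ)
    · exact hn _ _ (by rw [next_castSucc hj]; simp only [hl, hr, and_false, if_false])
    · exact hn' _ _ (by rw [next_succ hj]; simp only [hl, hr, and_false, if_false])
  | left t ht =>
    by_cases hj : Even ((w.get t).castSucc : ℕ)
    · exact hn _ _ (by rw [botL, next_castSucc hj]; simp [ht, topL])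
    · exact hn' _ _ (by rw [topL, next_succ hj]; simp [ht, botL])
  | right t ht =>
    by_cases hj : Even ((w.get t).succ : ℕ)
    · exact hn _ _ (by rw [botR, next_castSucc hj]; simp [ht, topR])
    · exact hn' _ _ (by rw [topR, next_succ hj]; simp [ht, botR])
  | bot t ht =>
    by_cases hj : Even ((w.get t).castSucc : ℕ)
    · exact hn _ _ (by rw [botL, next_castSucc hj]; simp [ht])
    · have hj' : Even ((w.get t).succ : ℕ) := by simpa [Nat.even_add_one] using hj
      exact hn' _ _ (by rw [botR, next_castSucc hj']; simp [ht, Fin.ext_iff])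
  | top t ht =>
    by_cases hj : Even ((w.get t).castSucc : ℕ)
    · have hj' : ¬ Even ((w.get t).succ : ℕ) := by simpa [Nat.even_add_one] using hj
      exact hn' _ _ (by rw [topR, next_succ hj']; simp [ht, Fin.ext_iff])
    · exact hn _ _ (by rw [topL, next_succ hj]; simp [ht])

theorem sameCircle_iff (s : Finset (Crossing w)) (p q : Pt w) :
    sameCircle w s p q ↔ (tour s).SameCycle p q := by
  constructor
  · exact sameCircle_le (r := Equiv.Perm.SameCycle.setoid (tour s)) fun p q h => arc_sameCycle h
  · intro h
    obtain ⟨n, rfl⟩ := h.exists_nat_pow_eq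
    clear h
    induction n with
    | zero => exact (sameCircle w s).refl _
    | succ n ih =>
      rw [pow_succ', Equiv.Perm.mul_apply]
      exact (sameCircle w s).trans ih (same_next s _)

/-! How the circles change at one crossing. -/

section Change

variable {s : Finset (Crossing w)} {k : Crossing w}

theorem same_in_insert (hk : k ∉ s) :
    sameCircle w (insert k s) (inU k) (inD k) ↔ ¬ sameCircle w s (inU k) (inD k) := by
  rw [sameCircle_iff, sameCircle_iff, tour_insert hk]
  exact ⟨fun h h' => not_sameCycle_mul_swap (inU_ne_inD k) h' h, sameCycle_mul_swap_of_not⟩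

/-- `p` lies on a circle through the crossing `k`. -/
def Near (s : Finset (Crossing w)) (k : Crossing w) (p : Pt w) : Prop :=
  sameCircle w s p (inU k) ∨ sameCircle w s p (inD k)

theorem Near.of_same {p q : Pt w} (h : Near s k q) (hpq : sameCircle w s p q) : Near s k p :=
  h.imp ((sameCircle w s).trans hpq) ((sameCircle w s).trans hpq)

theorem near_corners (s : Finset (Crossing w)) (k : Crossing w) :
    Near s k (botL k) ∧ Near s k (botR k) ∧ Near s k (topL k) ∧ Near s k (topR k) := by
  by_cases hk : k ∈ s
  · have h1 := (Arc.bot k hk).same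
    have h2 := (Arc.top k hk).same
    have h1' := (sameCircle w s).symm h1
    have h2' := (sameCircle w s).symm h2
    unfold Near inU inD
    split_ifs
    · exact ⟨Or.inl ((sameCircle w s).refl _), Or.inl h1', Or.inr h2,
        Or.inr ((sameCircle w s).refl _)⟩
    · exact ⟨Or.inl h1, Or.inl ((sameCircle w s).refl _), Or.inr ((sameCircle w s).refl _),
        Or.inr h2'⟩
  · have h1 := (Arc.left k hk).same
    have h2 := (Arc.right k hk).same
    have h1' := (sameCircle w s).symm h1
    have h2' := (sameCircle w s).symm h2
    unfold Near inU inD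
    split_ifs
    · exact ⟨Or.inl ((sameCircle w s).refl _), Or.inr h2, Or.inl h1',
        Or.inr ((sameCircle w s).refl _)⟩
    · exact ⟨Or.inr h1, Or.inl ((sameCircle w s).refl _), Or.inr ((sameCircle w s).refl _),
        Or.inl h2'⟩

/-- The equivalence relation in which the circles through the crossing `k` are joined. -/
def joined (s : Finset (Crossing w)) (k : Crossing w) : Setoid (Pt w) where
  r p q := sameCircle w s p q ∨ (Near s k p ∧ Near s k q)
  iseqv :=
    { refl := fun p => Or.inl ((sameCircle w s).refl p)
      symm := fun h => h.imp (sameCircle w s).symm And.symm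
      trans := by
        rintro p q r (h | h) (h' | h')
        · exact Or.inl ((sameCircle w s).trans h h')
        · exact Or.inr ⟨h'.1.of_same h, h'.2⟩
        · exact Or.inr ⟨h.1, h.2.of_same ((sameCircle w s).symm h')⟩
        · exact Or.inr ⟨h.1, h'.2⟩ }

theorem arc_cases {s t : Finset (Crossing w)} {k : Crossing w} (hst : ∀ l, l ≠ k → (l ∈ s ↔ l ∈ t))
    {p q : Pt w} (h : Arc w s p q) : joined t k p q := by
  obtain ⟨h1, h2, h3, h4⟩ := near_corners t k
  cases h with
  | close j => exact Or.inl (Arc.close j).same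
  | strand l j hl hr => exact Or.inl (Arc.strand l j hl hr).same
  | left l hl =>
    by_cases e : l = k
    · subst e; exact Or.inr ⟨h1, h3⟩
    · exact Or.inl (Arc.left l (by rwa [← hst l e])).same
  | right l hl =>
    by_cases e : l = k
    · subst e; exact Or.inr ⟨h2, h4⟩
    · exact Or.inl (Arc.right l (by rwa [← hst l e])).same
  | bot l hl =>
    by_cases e : l = k
    · subst e; exact Or.inr ⟨h1, h2⟩
    · exact Or.inl (Arc.bot l (by rwa [← hst l e])).same
  | top l hl =>
    by_cases e : l = k
    · subst e; exact Or.inr ⟨h3, h4⟩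
    · exact Or.inl (Arc.top l (by rwa [← hst l e])).same

theorem same_insert_joined {p q : Pt w} (h : sameCircle w (insert k s) p q) : joined s k p q :=
  sameCircle_le (fun _ _ h => arc_cases (fun l hl => by simp [hl]) h) h

theorem same_joined_insert {p q : Pt w} (h : sameCircle w s p q) : joined (insert k s) k p q :=
  sameCircle_le (fun _ _ h => arc_cases (fun l hl => by simp [hl]) h) h

theorem same_of_joined {p q : Pt w} (hk : sameCircle w s (inU k) (inD k))
    (h : joined s k p q) : sameCircle w s p q := by
  have hn : ∀ {p}, Near s k p → sameCircle w s p (inU k) := fun h =>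
    h.elim id fun h => (sameCircle w s).trans h ((sameCircle w s).symm hk)
  exact h.elim id fun h => (sameCircle w s).trans (hn h.1) ((sameCircle w s).symm (hn h.2))

theorem near_of_joined {p q : Pt w} (h : joined s k p q) (h' : ¬ sameCircle w s p q) :
    Near s k p ∧ Near s k q :=
  Or.resolve_left h h'

theorem near_inU (s : Finset (Crossing w)) (k : Crossing w) : Near s k (inU k) :=
  Or.inl ((sameCircle w s).refl _)

theorem near_inD (s : Finset (Crossing w)) (k : Crossing w) : Near s k (inD k) :=
  Or.inr ((sameCircle w s).refl _)

theorem numCircles_merge (hk : k ∉ s) (h : sameCircle w (insert k s) (inU k) (inD k)) :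
    numCircles w s = numCircles w (insert k s) + 1 := by
  have h' := (same_in_insert hk).1 h
  refine card_quotient_of_merge _ _ h' fun p q => ⟨fun e => same_insert_joined e, fun e => ?_⟩
  refine same_of_joined h ?_
  rcases e with e | ⟨e1, e2⟩
  · exact same_joined_insert e
  · have hn : ∀ {p}, Near s k p → Near (insert k s) k p := by
      intro p hp
      have : ∀ {a b}, sameCircle w s a b → sameCircle w (insert k s) a b :=
        fun e => same_of_joined h (same_joined_insert e)
      exact hp.imp this this
    exact Or.inr ⟨hn e1, hn e2⟩

theorem numCircles_split (hk : k ∉ s) (h : ¬ sameCircle w (insert k s) (inU k) (inD k)) :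
    numCircles w (insert k s) = numCircles w s + 1 := by
  have h' : sameCircle w s (inU k) (inD k) := by
    by_contra h'
    exact h ((same_in_insert hk).2 h')
  refine card_quotient_of_merge _ _ h fun p q => ⟨fun e => same_joined_insert e, fun e => ?_⟩
  refine same_of_joined h' ?_
  rcases e with e | ⟨e1, e2⟩
  · exact same_insert_joined e
  · have hn : ∀ {p}, Near (insert k s) k p → Near s k p := by
      intro p hp
      have : ∀ {a b}, sameCircle w (insert k s) a b → sameCircle w s a b :=
        fun e => same_of_joined h' (same_insert_joined e)
      exact hp.imp this this
    exact Or.inr ⟨hn e1, hn e2⟩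

end Change

end Braid
/-! ### The Khovanov complex -/

section Complex

variable {m : ℕ} (w : List (Fin m))

/-- The polynomial ring with one variable `x_p` for each point `p`. -/
abbrev Poly : Type := MvPolynomial (Pt w) ℤ

/-- The relations `x_p² = 0`, and `x_p = x_q` if `p` and `q` lie on the same circle. -/
def circleIdeal (s : Finset (Crossing w)) : Ideal (Poly w) :=
  Ideal.span ({f | ∃ p, f = MvPolynomial.X p ^ 2} ∪
    {f | ∃ p q, Arc w s p q ∧ f = MvPolynomial.X p - MvPolynomial.X q})

/-- The ring `ℤ[x_p] / (x_p² = 0, x_p = x_q if p and q lie on the same circle)` of a smoothing;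
this is the tensor product of one copy of `R` for each circle. -/
abbrev StateRing (s : Finset (Crossing w)) : Type := Poly w ⧸ circleIdeal w s

/-- The class of a polynomial. -/
abbrev cls (s : Finset (Crossing w)) : Poly w →+* StateRing w s :=
  Ideal.Quotient.mk (circleIdeal w s)

/-- Polynomials that are homogeneous of degree `q`, where every variable has degree `-2`. -/
abbrev polyGr (q : ℤ) : Submodule ℤ (Poly w) :=
  MvPolynomial.weightedHomogeneousSubmodule ℤ (fun _ : Pt w => (-2 : ℤ)) q

/-- The classes of the homogeneous polynomials of degree `q`. -/
def stateGr (s : Finset (Crossing w)) (q : ℤ) : Submodule ℤ (StateRing w s) :=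
  AddSubgroup.toIntSubmodule ((polyGr w q).toAddSubgroup.map (cls w s).toAddMonoidHom)

variable {w}

theorem mem_stateGr {s : Finset (Crossing w)} {q : ℤ} {x : StateRing w s} :
    x ∈ stateGr w s q ↔ ∃ f ∈ polyGr w q, cls w s f = x := Iff.rfl

theorem X_mem_polyGr (p : Pt w) : (MvPolynomial.X p : Poly w) ∈ polyGr w (-2) :=
  MvPolynomial.isWeightedHomogeneous_X _ _ _

theorem mul_mem_polyGr {a b : ℤ} {f g : Poly w} (hf : f ∈ polyGr w a) (hg : g ∈ polyGr w b) :
    f * g ∈ polyGr w (a + b) :=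
  MvPolynomial.IsWeightedHomogeneous.mul hf hg

theorem component_mem_circleIdeal (s : Finset (Crossing w)) (q : ℤ) {f : Poly w}
    (hf : f ∈ circleIdeal w s) :
    MvPolynomial.weightedHomogeneousComponent (fun _ : Pt w => (-2 : ℤ)) q f ∈ circleIdeal w s := by
  let _ := MvPolynomial.weightedGradedAlgebra ℤ (fun _ : Pt w => (-2 : ℤ))
  have h : (circleIdeal w s).IsHomogeneous (polyGr w) := by
    refine Ideal.homogeneous_span _ _ ?_
    rintro _ (⟨p, rfl⟩ | ⟨p, p', -, rfl⟩)
    · refine ⟨-2 + -2, ?_⟩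
      rw [pow_two]
      exact mul_mem_polyGr (X_mem_polyGr p) (X_mem_polyGr p)
    · exact ⟨-2, Submodule.sub_mem _ (X_mem_polyGr p) (X_mem_polyGr p')⟩
  exact MvPolynomial.weightedHomogeneousComponent_mem_of_mem ℤ _ h hf q

theorem stateGr_isInternal (s : Finset (Crossing w)) : DirectSum.IsInternal (stateGr w s) := by
  let c : ℤ → Poly w →+ Poly w := fun q =>
    (MvPolynomial.weightedHomogeneousComponent (fun _ : Pt w => (-2 : ℤ)) q).toAddMonoidHom
  let π : ℤ → StateRing w s →+ StateRing w s := fun q =>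
    QuotientAddGroup.map (circleIdeal w s).toAddSubgroup (circleIdeal w s).toAddSubgroup (c q)
      fun f hf => component_mem_circleIdeal s q hf
  have hπ : ∀ q f, π q (cls w s f) = cls w s (c q f) := fun q f => rfl
  refine isInternal_of_proj ?_ π ?_ ?_
  · rw [eq_top_iff]
    rintro x -
    obtain ⟨f, rfl⟩ := Ideal.Quotient.mk_surjective x
    rw [← MvPolynomial.sum_weightedHomogeneousComponent (fun _ : Pt w => (-2 : ℤ)) f,
      finsum_eq_sum _ (MvPolynomial.weightedHomogeneousComponent_finsupp f), map_sum]
    refine Submodule.sum_mem _ fun q _ => Submodule.mem_iSup_of_mem q ?_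
    exact ⟨_, MvPolynomial.weightedHomogeneousComponent_isWeightedHomogeneous q f, rfl⟩
  · rintro q _ ⟨f, hf, rfl⟩
    exact congrArg (cls w s) (MvPolynomial.IsWeightedHomogeneous.weightedHomogeneousComponent_same hf)
  · rintro q q' _ ⟨f, hf, rfl⟩ hq
    refine (congrArg (cls w s)
      (MvPolynomial.IsWeightedHomogeneous.weightedHomogeneousComponent_ne q' hf hq.symm)).trans ?_
    exact map_zero _

theorem cls_X_sq (s : Finset (Crossing w)) (p : Pt w) :
    cls w s (MvPolynomial.X p) * cls w s (MvPolynomial.X p) = 0 := by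
  rw [← map_mul, ← pow_two]
  exact Ideal.Quotient.eq_zero_iff_mem.2 (Ideal.subset_span (Or.inl ⟨p, rfl⟩))

theorem cls_X_eq {s : Finset (Crossing w)} {p q : Pt w} (h : sameCircle w s p q) :
    cls w s (MvPolynomial.X p) = cls w s (MvPolynomial.X q) :=
  sameCircle_le (r := Setoid.ker fun p => cls w s (MvPolynomial.X p))
    (fun p q h => Ideal.Quotient.eq.2 (Ideal.subset_span (Or.inr ⟨p, q, h, rfl⟩))) h

variable (w)

/-- The action of `R` through a basepoint `p`: `X` acts as `x_p`. -/
def pointHom (s : Finset (Crossing w)) (p : Pt w) : R →ₐ[ℤ] StateRing w s :=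
  DualNumber.lift ⟨(Algebra.ofId ℤ _, cls w s (MvPolynomial.X p)), cls_X_sq s p,
    fun _ => Commute.all _ _⟩

/-- The action of `R ⊗ R` through basepoints on the closing arcs of the strands `u` (left action)
and `v` (right action). -/
def actHom (u v : Fin (m + 1)) (s : Finset (Crossing w)) : RR →ₐ[ℤ] StateRing w s :=
  Algebra.TensorProduct.productMap (pointHom w s (0, u)) (pointHom w s (0, v))

theorem actHom_XL (u v : Fin (m + 1)) (s : Finset (Crossing w)) :
    actHom w u v s XL = cls w s (MvPolynomial.X (0, u)) := by
  simp [actHom, XL, pointHom]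

theorem actHom_XR (u v : Fin (m + 1)) (s : Finset (Crossing w)) :
    actHom w u v s XR = cls w s (MvPolynomial.X (0, v)) := by
  simp [actHom, XR, pointHom]

/-- The ring of a smoothing as a graded bimodule, with `1` in degree `0`. -/
def stateBimod (u v : Fin (m + 1)) (s : Finset (Crossing w)) : GrBimod where
  carrier := StateRing w s
  module := Module.compHom _ (actHom w u v s).toRingHom
  gr := stateGr w s
  internal := stateGr_isInternal s
  left_mem := by
    rintro q _ ⟨f, hf, rfl⟩
    change actHom w u v s XL * cls w s f ∈ _
    rw [actHom_XL, ← map_mul]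
    refine ⟨_, ?_, rfl⟩
    rw [sub_eq_neg_add]
    exact mul_mem_polyGr (X_mem_polyGr _) hf
  right_mem := by
    rintro q _ ⟨f, hf, rfl⟩
    change actHom w u v s XR * cls w s f ∈ _
    rw [actHom_XR, ← map_mul]
    refine ⟨_, ?_, rfl⟩
    rw [sub_eq_neg_add]
    exact mul_mem_polyGr (X_mem_polyGr _) hf

/-- The bimodule at a vertex of the cube of smoothings. The unit, that is, the state in which
every circle carries the label `1`, has quantum degree (number of circles) + (number of
`1`-smoothings) + (number of positive crossings). -/
def vertex (u v : Fin (m + 1)) (s : Finset (Crossing w)) : GrBimod :=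
  GrBimod.twist (numCircles w s + s.card + w.length) (stateBimod w u v s)

variable {w}

open Classical in
/-- Changing the crossing `k` from the `0`- to the `1`-smoothing, with result `t`, either merges
two circles or splits one circle into two. It is a merge if in `t` the two arcs at `k` lie on the
same circle; then the edge map is the multiplication `R ⊗ R → R`, which is induced by the identity
of the polynomial ring. Otherwise the edge map is `Δ : R → R ⊗ R`, which is multiplication by
`x_p + x_q` for points `p`, `q` on the two new circles. -/
def saddle (t : Finset (Crossing w)) (k : Crossing w) : Poly w :=
  if sameCircle w t (botL k) (topL k) then 1
  else MvPolynomial.X (botL k) + MvPolynomial.X (topL k)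

theorem same_corner_iff {t : Finset (Crossing w)} {k : Crossing w} (hk : k ∈ t) :
    sameCircle w t (botL k) (topL k) ↔ sameCircle w t (inU k) (inD k) := by
  have h1 := (Arc.bot k hk).same
  have h2 := (Arc.top k hk).same
  have h1' := (sameCircle w t).symm h1
  have h2' := (sameCircle w t).symm h2
  unfold inU inD
  split_ifs
  · exact ⟨fun h => (sameCircle w t).trans h h2, fun h => (sameCircle w t).trans h h2'⟩
  · exact ⟨fun h => (sameCircle w t).trans h1' h, fun h => (sameCircle w t).trans h1 h⟩

theorem cls_corner {t : Finset (Crossing w)} {k : Crossing w} (hk : k ∈ t) :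
    cls w t (MvPolynomial.X (botL k) + MvPolynomial.X (topL k)) =
      cls w t (MvPolynomial.X (inU k) + MvPolynomial.X (inD k)) := by
  have h1 := cls_X_eq (Arc.bot k hk).same
  have h2 := cls_X_eq (Arc.top k hk).same
  unfold inU inD
  split_ifs
  · rw [map_add, map_add, h2]
  · rw [map_add, map_add, h1]

theorem saddle_pos {t : Finset (Crossing w)} {k : Crossing w} (hk : k ∈ t)
    (h : sameCircle w t (inU k) (inD k)) : saddle t k = 1 :=
  if_pos ((same_corner_iff hk).2 h)

theorem saddle_neg {t : Finset (Crossing w)} {k : Crossing w} (hk : k ∈ t)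
    (h : ¬ sameCircle w t (inU k) (inD k)) :
    saddle t k = MvPolynomial.X (botL k) + MvPolynomial.X (topL k) :=
  if_neg fun h' => h ((same_corner_iff hk).1 h')

theorem saddle_mul_mem {s t : Finset (Crossing w)} {k : Crossing w} (hk : k ∉ s)
    (ht : insert k s = t) {f : Poly w} (hf : f ∈ circleIdeal w s) :
    saddle t k * f ∈ circleIdeal w t := by
  subst ht
  have hkt : k ∈ insert k s := Finset.mem_insert_self k s
  have h1 := cls_X_eq (Arc.bot k hkt).same
  have h2 := cls_X_eq (Arc.top k hkt).same
  have hs : ∀ p : Pt w, cls w (insert k s) (MvPolynomial.X p) * cls w (insert k s) (MvPolynomial.X p) = 0 :=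
    cls_X_sq _
  have key : cls w (insert k s) (saddle (insert k s) k) *
      (cls w (insert k s) (MvPolynomial.X (botL k)) -
        cls w (insert k s) (MvPolynomial.X (topL k))) = 0 := by
    unfold saddle
    split_ifs with h
    · rw [cls_X_eq h, sub_self, mul_zero]
    · rw [map_add]
      linear_combination hs (botL k) - hs (topL k)
  have hle : circleIdeal w s ≤
      (Submodule.comap (LinearMap.mulLeft (Poly w) (saddle (insert k s) k))
        (circleIdeal w (insert k s))) := by
    refine Ideal.span_le.2 ?_
    rintro _ (⟨p, rfl⟩ | ⟨p, q, h, rfl⟩)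
    · change saddle (insert k s) k * _ ∈ circleIdeal w (insert k s)
      exact Ideal.mul_mem_left _ _ (Ideal.subset_span (Or.inl ⟨p, rfl⟩))
    · change saddle (insert k s) k * _ ∈ circleIdeal w (insert k s)
      rw [← Ideal.Quotient.eq_zero_iff_mem, map_mul, map_sub]
      cases h with
      | close j => rw [cls_X_eq (Arc.close j).same, sub_self, mul_zero]
      | strand l j hl hr => rw [cls_X_eq (Arc.strand l j hl hr).same, sub_self, mul_zero]
      | left l hl =>
        by_cases e : l = k
        · subst e; exact key
        · rw [cls_X_eq (Arc.left l (by simp [e, hl])).same, sub_self, mul_zero]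
      | right l hl =>
        by_cases e : l = k
        · subst e; rw [← h1, ← h2]; exact key
        · rw [cls_X_eq (Arc.right l (by simp [e, hl])).same, sub_self, mul_zero]
      | bot l hl =>
        rw [cls_X_eq (Arc.bot l (Finset.mem_insert_of_mem hl)).same, sub_self, mul_zero]
      | top l hl =>
        rw [cls_X_eq (Arc.top l (Finset.mem_insert_of_mem hl)).same, sub_self, mul_zero]
  exact hle hf

/-- The additive map underlying an edge map. -/
def edgeAdd {s t : Finset (Crossing w)} {k : Crossing w} (hk : k ∉ s) (ht : insert k s = t) :
    StateRing w s →+ StateRing w t :=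
  QuotientAddGroup.map (circleIdeal w s).toAddSubgroup (circleIdeal w t).toAddSubgroup
    (AddMonoidHom.mulLeft (saddle t k)) fun _ hf => saddle_mul_mem hk ht hf

theorem edgeAdd_cls {s t : Finset (Crossing w)} {k : Crossing w} (hk : k ∉ s)
    (ht : insert k s = t) (f : Poly w) :
    edgeAdd hk ht (cls w s f) = cls w t (saddle t k * f) := rfl

theorem edgeAdd_smul (u v : Fin (m + 1)) {s t : Finset (Crossing w)} {k : Crossing w} (hk : k ∉ s)
    (ht : insert k s = t) (a : RR) (x : StateRing w s) :
    edgeAdd hk ht (actHom w u v s a * x) = actHom w u v t a * edgeAdd hk ht x := by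
  obtain ⟨f, rfl⟩ := Ideal.Quotient.mk_surjective x
  induction a using TensorProduct.induction_on with
  | zero => simp
  | add a b ha hb => rw [map_add, map_add, add_mul, add_mul, map_add, ha, hb]
  | tmul a b =>
    have h : ∀ s, actHom w u v s (a ⊗ₜ b) =
        cls w s ((MvPolynomial.C a.fst + MvPolynomial.C a.snd * MvPolynomial.X (0, u)) *
          (MvPolynomial.C b.fst + MvPolynomial.C b.snd * MvPolynomial.X (0, v))) := by
      intro s
      simp [actHom, pointHom, DualNumber.lift_apply_apply]
    rw [h, h, ← map_mul, edgeAdd_cls, edgeAdd_cls, ← map_mul, mul_left_comm]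

/-- The edge map of the cube of smoothings, without sign. -/
def edge (u v : Fin (m + 1)) {s t : Finset (Crossing w)} {k : Crossing w} (hk : k ∉ s)
    (ht : insert k s = t) : vertex w u v s ⟶ vertex w u v t :=
  GrBimod.ofLin (M := vertex w u v s) (N := vertex w u v t)
    { toFun := edgeAdd hk ht
      map_add' := map_add (edgeAdd hk ht)
      map_smul' := edgeAdd_smul u v hk ht } (by
    rintro q _ ⟨f, hf, rfl⟩
    refine ⟨saddle t k * f, ?_, rfl⟩
    subst ht
    have hc := Finset.card_insert_of_notMem hk
    have hs := same_corner_iff (Finset.mem_insert_self k s)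
    change saddle _ k * f ∈
      polyGr w (q - (numCircles w (insert k s) + (insert k s).card + w.length))
    change f ∈ polyGr w (q - (numCircles w s + s.card + w.length)) at hf
    unfold saddle
    split_ifs with h
    · have hm := numCircles_merge hk (hs.1 h)
      have e : q - (numCircles w (insert k s) + (insert k s).card + w.length : ℤ) =
          q - (numCircles w s + s.card + w.length) := by
        rw [hm, hc]; push_cast; ring
      rw [one_mul, e]
      exact hf
    · have hm := numCircles_split hk (fun h' => h (hs.2 h'))
      have e : q - (numCircles w (insert k s) + (insert k s).card + w.length : ℤ) =
          -2 + (q - (numCircles w s + s.card + w.length)) := by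
        rw [hm, hc]; push_cast; ring
      rw [e]
      exact mul_mem_polyGr
        (Submodule.add_mem _ (X_mem_polyGr (botL k)) (X_mem_polyGr (topL k))) hf)

theorem saddle_comm_split {s t t' u : Finset (Crossing w)} {k l : Crossing w} (hk : k ∉ s)
    (hkl : k ≠ l) (ht : insert k s = t) (ht' : insert l s = t')
    (hu : insert l t = u) (hu' : insert k t' = u)
    (h00 : sameCircle w s (inU k) (inD k)) (h01 : ¬ sameCircle w t' (inU k) (inD k)) :
    cls w u (saddle u l * saddle t k) = cls w u (saddle u k * saddle t' l) := by
  have hkt' : k ∉ t' := by rw [← ht']; simp [hk, hkl]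
  have hku : k ∈ u := by rw [← hu']; simp
  have hlu : l ∈ u := by rw [← hu]; simp
  have hkt : k ∈ t := by rw [← ht]; simp
  have hlt' : l ∈ t' := by rw [← ht']; simp
  have m10 : ¬ sameCircle w t (inU k) (inD k) := by
    rw [← ht, same_in_insert hk, not_not]; exact h00
  have h11k : sameCircle w u (inU k) (inD k) := by
    rw [← hu', same_in_insert hkt']; exact h01
  have hj : joined t' l (inU k) (inD k) := by
    rw [← ht']; exact same_joined_insert h00
  have hl01 : ¬ sameCircle w t' (inU l) (inD l) := fun e => h01 (same_of_joined e hj)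
  obtain ⟨nU, nD⟩ := near_of_joined hj h01
  have hle : ∀ {a b}, sameCircle w t' a b → sameCircle w u a b := by
    intro a b e
    refine same_of_joined h11k ?_
    rw [← hu']
    exact same_joined_insert e
  have all : sameCircle w u (inU k) (inU l) ∧ sameCircle w u (inU k) (inD l) := by
    rcases nU with a | a <;> rcases nD with b | b
    · exact absurd ((sameCircle w _).trans a ((sameCircle w _).symm b)) h01
    · exact ⟨hle a, (sameCircle w _).trans h11k (hle b)⟩
    · exact ⟨(sameCircle w _).trans h11k (hle b), hle a⟩
    · exact absurd ((sameCircle w _).trans a ((sameCircle w _).symm b)) h01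
  have h11l : sameCircle w u (inU l) (inD l) :=
    (sameCircle w _).trans ((sameCircle w _).symm all.1) all.2
  rw [saddle_pos hlu h11l, saddle_neg hkt m10, saddle_pos hku h11k, saddle_neg hlt' hl01, one_mul,
    one_mul, cls_corner hku, cls_corner hlu, map_add, map_add, ← cls_X_eq h11k, ← cls_X_eq all.1,
    ← cls_X_eq all.2]

theorem saddle_comm_merge {s t t' u : Finset (Crossing w)} {k l : Crossing w} (hk : k ∉ s)
    (hl : l ∉ s) (hkl : k ≠ l) (ht : insert k s = t) (ht' : insert l s = t')
    (hu : insert l t = u) (hu' : insert k t' = u)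
    (h00 : ¬ sameCircle w s (inU k) (inD k)) (h01 : sameCircle w t' (inU k) (inD k)) :
    cls w u (saddle u l * saddle t k) = cls w u (saddle u k * saddle t' l) := by
  have hkt' : k ∉ t' := by rw [← ht']; simp [hk, hkl]
  have hlt : l ∉ t := by rw [← ht]; simp [hl, hkl.symm]
  have hku : k ∈ u := by rw [← hu']; simp
  have hlu : l ∈ u := by rw [← hu]; simp
  have hkt : k ∈ t := by rw [← ht]; simp
  have hlt' : l ∈ t' := by rw [← ht']; simp
  have hj : joined s l (inU k) (inD k) := by
    rw [← ht'] at h01; exact same_insert_joined h01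
  have hl00 : ¬ sameCircle w s (inU l) (inD l) := fun e => h00 (same_of_joined e hj)
  have hl01 : sameCircle w t' (inU l) (inD l) := by
    rw [← ht', same_in_insert hl]; exact hl00
  have h10 : sameCircle w t (inU k) (inD k) := by
    rw [← ht, same_in_insert hk]; exact h00
  have h11k : ¬ sameCircle w u (inU k) (inD k) := by
    rw [← hu', same_in_insert hkt', not_not]; exact h01
  obtain ⟨nU, nD⟩ := near_of_joined hj h00
  have hle : ∀ {a b}, sameCircle w s a b → sameCircle w t a b := by
    intro a b e
    refine same_of_joined h10 ?_
    rw [← ht]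
    exact same_joined_insert e
  have hl10 : sameCircle w t (inU l) (inD l) := by
    rcases nU with a | a <;> rcases nD with b | b
    · exact absurd ((sameCircle w _).trans a ((sameCircle w _).symm b)) h00
    · exact (sameCircle w _).trans ((sameCircle w _).symm (hle a))
        ((sameCircle w _).trans h10 (hle b))
    · exact (sameCircle w _).trans ((sameCircle w _).symm (hle b))
        ((sameCircle w _).trans ((sameCircle w _).symm h10) (hle a))
    · exact absurd ((sameCircle w _).trans a ((sameCircle w _).symm b)) h00
  have h11l : ¬ sameCircle w u (inU l) (inD l) := by
    rw [← hu, same_in_insert hlt, not_not]; exact hl10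
  have near' : ∀ {a b}, Near u l b → sameCircle w t a b → Near u l a := by
    intro a b hb e
    have hj' : joined u l a b := by rw [← hu]; exact same_joined_insert e
    by_cases e' : sameCircle w u a b
    · exact hb.of_same e'
    · exact (near_of_joined hj' e').1
  have near : ∀ {a}, Near s l a → Near u l a := fun ha =>
    ha.elim (fun e => near' (near_inU u l) (hle e)) (fun e => near' (near_inD u l) (hle e))
  rw [saddle_neg hlu h11l, saddle_pos hkt h10, saddle_neg hku h11k, saddle_pos hlt' hl01, mul_one,
    mul_one, cls_corner hku, cls_corner hlu, map_add, map_add]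
  rcases near nU with a | a <;> rcases near nD with b | b
  · exact absurd ((sameCircle w _).trans a ((sameCircle w _).symm b)) h11k
  · rw [cls_X_eq a, cls_X_eq b]
  · rw [cls_X_eq a, cls_X_eq b, add_comm]
  · exact absurd ((sameCircle w _).trans a ((sameCircle w _).symm b)) h11k

theorem saddle_eq {s t t' u : Finset (Crossing w)} {k : Crossing w} (hk : k ∉ s)
    (hkt' : k ∉ t') (ht : insert k s = t) (hu' : insert k t' = u)
    (h : sameCircle w s (inU k) (inD k) ↔ sameCircle w t' (inU k) (inD k)) :
    saddle t k = saddle u k := by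
  have hku : k ∈ u := by rw [← hu']; simp
  have hkt : k ∈ t := by rw [← ht]; simp
  have h1 := same_in_insert (w := w) hk
  have h2 := same_in_insert (w := w) hkt'
  rw [ht] at h1
  rw [hu'] at h2
  by_cases h3 : sameCircle w s (inU k) (inD k)
  · rw [saddle_neg hkt fun e => h1.1 e h3, saddle_neg hku fun e => h2.1 e (h.1 h3)]
  · rw [saddle_pos hkt (h1.2 h3), saddle_pos hku (h2.2 fun e => h3 (h.2 e))]

/-- The edge maps at two crossings commute. -/
theorem saddle_comm {s t t' u : Finset (Crossing w)} {k l : Crossing w} (hk : k ∉ s)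
    (hl : l ∉ s) (hkl : k ≠ l) (ht : insert k s = t) (ht' : insert l s = t')
    (hu : insert l t = u) (hu' : insert k t' = u) :
    cls w u (saddle u l * saddle t k) = cls w u (saddle u k * saddle t' l) := by
  have hkt' : k ∉ t' := by rw [← ht']; simp [hk, hkl]
  have hlt : l ∉ t := by rw [← ht]; simp [hl, hkl.symm]
  by_cases a : sameCircle w s (inU k) (inD k) <;> by_cases b : sameCircle w t' (inU k) (inD k)
  on_goal 2 => exact saddle_comm_split hk hkl ht ht' hu hu' a b
  on_goal 2 => exact saddle_comm_merge hk hl hkl ht ht' hu hu' a b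
  all_goals
    rw [saddle_eq hk hkt' ht hu' (by simp only [a, b])]
    by_cases c : sameCircle w s (inU l) (inD l) <;> by_cases d : sameCircle w t (inU l) (inD l)
    on_goal 2 =>
      have := saddle_comm_split hl hkl.symm ht' ht hu' hu c d
      rw [saddle_eq hk hkt' ht hu' (by simp only [a, b])] at this
      exact this.symm
    on_goal 2 =>
      have := saddle_comm_merge hl hk hkl.symm ht' ht hu' hu c d
      rw [saddle_eq hk hkt' ht hu' (by simp only [a, b])] at this
      exact this.symm
    all_goals
      rw [saddle_eq hl hlt ht' hu (by simp only [c, d]), mul_comm]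

end Complex

/-- The morphism between finite direct sums with given matrix entries. -/
def GrBimod.matrix {ι κ : Type} [Fintype ι] [Finite κ] {M : ι → GrBimod} {N : κ → GrBimod}
    (D : ∀ i j, M i ⟶ N j) : GrBimod.pi M ⟶ GrBimod.pi N :=
  GrBimod.ofLin (M := GrBimod.pi M) (N := GrBimod.pi N)
    { toFun := fun x j => ∑ i, GrBimod.toLin (D i j) (x i)
      map_add' := fun x y => funext fun j =>
        (Finset.sum_congr rfl fun i _ => map_add (GrBimod.toLin (D i j)) (x i) (y i)).trans
          Finset.sum_add_distrib
      map_smul' := fun a x => funext fun j =>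
        (Finset.sum_congr rfl fun i _ => map_smul (GrBimod.toLin (D i j)) a (x i)).trans
          Finset.smul_sum.symm }
    fun q _ hx j _ => Submodule.sum_mem ((N j).gr q) fun i _ => (D i j).2 q _ (hx i trivial)

theorem GrBimod.matrix_apply {ι κ : Type} [Fintype ι] [Finite κ] {M : ι → GrBimod}
    {N : κ → GrBimod} (D : ∀ i j, M i ⟶ N j) (x : ∀ i, M i) (j : κ) :
    (GrBimod.toLin (GrBimod.matrix D) x : ∀ j, N j) j = ∑ i, GrBimod.toLin (D i j) (x i) := rfl

theorem GrBimod.matrix_comp {ι κ ν : Type} [Fintype ι] [Fintype κ] [Finite ν]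
    {M : ι → GrBimod} {N : κ → GrBimod} {P : ν → GrBimod} (D : ∀ i j, M i ⟶ N j)
    (D' : ∀ j l, N j ⟶ P l) (h : ∀ i l, ∑ j, D i j ≫ D' j l = 0) :
    GrBimod.matrix D ≫ GrBimod.matrix D' = 0 := by
  refine GrBimod.hom_ext fun x => funext fun l => ?_
  have h1 : ∀ i, ∑ j, GrBimod.toLin (D' j l) (GrBimod.toLin (D i j) (x i)) = 0 := by
    intro i
    have e : (∑ j, D i j ≫ D' j l).1 (x i) = 0 := by rw [h i l]; rfl
    rw [AddSubgroup.val_finsetSum, LinearMap.sum_apply] at e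
    exact e
  change ∑ j, GrBimod.toLin (D' j l) (∑ i, GrBimod.toLin (D i j) (x i)) = 0
  simp only [map_sum]
  rw [Finset.sum_comm]
  exact Finset.sum_eq_zero fun i _ => h1 i

section Complex

variable {m : ℕ} {w : List (Fin m)} (u v : Fin (m + 1))

/-- The sign of the edge of the cube that changes the crossing `k` of `s`. -/
def edgeSign (s : Finset (Crossing w)) (k : Crossing w) : ℤ := (-1) ^ (s.filter (· < k)).card

/-- The part of the coboundary from `s` to `t` that changes the crossing `k`. -/
def edgeAt (k : Crossing w) (s t : Finset (Crossing w)) : vertex w u v s ⟶ vertex w u v t :=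
  if h : k ∉ s ∧ insert k s = t then edgeSign s k • edge u v h.1 h.2 else 0

/-- The matrix entry of the coboundary from the smoothing `s` to the smoothing `t`. -/
def cubeMap (s t : Finset (Crossing w)) : vertex w u v s ⟶ vertex w u v t :=
  ∑ k, edgeAt u v k s t

theorem edge_comp {s t t' r : Finset (Crossing w)} {k l : Crossing w} (hk : k ∉ s)
    (hl : l ∉ s) (hkl : k ≠ l) (ht : insert k s = t) (ht' : insert l s = t')
    (hlt : l ∉ t) (hkt' : k ∉ t') (hr : insert l t = r) (hr' : insert k t' = r) :
    edge u v hk ht ≫ edge u v hlt hr = edge u v hl ht' ≫ edge u v hkt' hr' := by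
  refine GrBimod.hom_ext fun x => ?_
  obtain ⟨f, rfl⟩ := Ideal.Quotient.mk_surjective (I := circleIdeal w s) x
  change cls w r (saddle r l * (saddle t k * f)) = cls w r (saddle r k * (saddle t' l * f))
  rw [← mul_assoc, ← mul_assoc, map_mul, saddle_comm hk hl hkl ht ht' hr hr', ← map_mul]

theorem edgeSign_anti {s : Finset (Crossing w)} {k l : Crossing w} (hk : k ∉ s) (hl : l ∉ s)
    (hkl : k ≠ l) : edgeSign s k * edgeSign (insert k s) l +
      edgeSign s l * edgeSign (insert l s) k = 0 := by
  wlog h : k < l generalizing k l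
  · rw [add_comm]
    exact this hl hk hkl.symm (lt_of_le_of_ne (not_lt.1 h) hkl.symm)
  have h1 : edgeSign (insert k s) l = - edgeSign s l := by
    unfold edgeSign
    rw [Finset.filter_insert, if_pos h, Finset.card_insert_of_notMem (by simp [hk]), pow_succ,
      mul_neg_one]
  have h2 : edgeSign (insert l s) k = edgeSign s k := by
    unfold edgeSign
    rw [Finset.filter_insert, if_neg (not_lt.2 h.le)]
  rw [h1, h2]
  ring

theorem sum_edgeAt {i : ℕ} (k l : Crossing w) (s : {s : Finset (Crossing w) // s.card = i})
    (r : Finset (Crossing w)) (hk : k ∉ s.1) :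
    ∑ t : {t : Finset (Crossing w) // t.card = i + 1}, edgeAt u v k s.1 t.1 ≫ edgeAt u v l t.1 r =
      edgeAt u v k s.1 (insert k s.1) ≫ edgeAt u v l (insert k s.1) r := by
  have hc : (insert k s.1).card = i + 1 := by rw [Finset.card_insert_of_notMem hk, s.2]
  refine Finset.sum_eq_single_of_mem
    (⟨insert k s.1, hc⟩ : {t : Finset (Crossing w) // t.card = i + 1}) (Finset.mem_univ _) fun t _ ht => ?_
  have : edgeAt u v k s.1 t.1 = 0 := dif_neg fun h => ht (Subtype.ext h.2.symm)
  rw [this, zero_comp]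

theorem cube_sq {i : ℕ} (s : {s : Finset (Crossing w) // s.card = i}) (r : Finset (Crossing w)) :
    ∑ t : {t : Finset (Crossing w) // t.card = i + 1}, cubeMap u v s.1 t.1 ≫ cubeMap u v t.1 r =
      0 := by
  have hsum : ∑ t : {t : Finset (Crossing w) // t.card = i + 1},
      cubeMap u v s.1 t.1 ≫ cubeMap u v t.1 r =
      ∑ kl : Crossing w × Crossing w, ∑ t : {t : Finset (Crossing w) // t.card = i + 1},
        edgeAt u v kl.1 s.1 t.1 ≫ edgeAt u v kl.2 t.1 r := by
    refine Eq.trans (Finset.sum_congr rfl fun t _ => ?_) Finset.sum_comm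
    rw [cubeMap, cubeMap, Preadditive.sum_comp, Fintype.sum_prod_type]
    exact Finset.sum_congr rfl fun k _ => Preadditive.comp_sum _ _ _
  rw [hsum]
  have hzero : ∀ k l, (k ∈ s.1 ∨ l ∈ insert k s.1 ∨ insert l (insert k s.1) ≠ r) →
      ∑ t : {t : Finset (Crossing w) // t.card = i + 1},
        edgeAt u v k s.1 t.1 ≫ edgeAt u v l t.1 r = 0 := by
    intro k l h
    by_cases hk : k ∈ s.1
    · refine Finset.sum_eq_zero fun t _ => ?_
      have : edgeAt u v k s.1 t.1 = 0 := dif_neg fun h => h.1 hk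
      rw [this, zero_comp]
    · rw [sum_edgeAt u v k l s r hk]
      have : edgeAt u v l (insert k s.1) r = 0 := dif_neg (by tauto)
      rw [this, comp_zero]
  refine Finset.sum_involution (fun kl _ => kl.swap) ?_ ?_ (fun _ _ => Finset.mem_univ _)
    (fun _ _ => Prod.swap_swap _)
  · rintro ⟨k, l⟩ -
    change (∑ t : {t : Finset (Crossing w) // t.card = i + 1},
      edgeAt u v k s.1 t.1 ≫ edgeAt u v l t.1 r) + (∑ t : {t : Finset (Crossing w) // t.card = i + 1},
        edgeAt u v l s.1 t.1 ≫ edgeAt u v k t.1 r) = 0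
    by_cases h : k ∈ s.1 ∨ l ∈ s.1 ∨ k = l ∨ insert l (insert k s.1) ≠ r
    · rw [hzero k l (by rw [Finset.mem_insert]; tauto),
        hzero l k (by rw [Finset.mem_insert, Finset.insert_comm]; tauto), add_zero]
    · simp only [not_or, not_not] at h
      obtain ⟨hk, hl, hkl, hr⟩ := h
      have hr' : insert k (insert l s.1) = r := by rw [Finset.insert_comm]; exact hr
      have hlt : l ∉ insert k s.1 := by
        rw [Finset.mem_insert]; exact fun h => h.elim (fun e => hkl e.symm) hl
      have hkt : k ∉ insert l s.1 := by
        rw [Finset.mem_insert]; exact fun h => h.elim hkl hk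
      rw [sum_edgeAt u v k l s r hk, sum_edgeAt u v l k s r hl, edgeAt, dif_pos ⟨hk, rfl⟩, edgeAt,
        dif_pos ⟨hlt, hr⟩, edgeAt, dif_pos ⟨hl, rfl⟩, edgeAt, dif_pos ⟨hkt, hr'⟩,
        Preadditive.zsmul_comp, Preadditive.comp_zsmul, Preadditive.zsmul_comp,
        Preadditive.comp_zsmul, smul_smul, smul_smul,
        edge_comp u v hk hl hkl rfl rfl hlt hkt hr hr', ← add_smul, edgeSign_anti hk hl hkl,
        zero_smul]
  · rintro ⟨k, l⟩ - hne heq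
    have hkl : l = k := congrArg Prod.fst heq
    exact hne (hzero k l (Or.inr (Or.inl (by simp [hkl]))))

variable (w) in
/-- The Khovanov complex of the closure of the positive braid word `w` on `m + 1` strands (the
letter `i` stands for the generator `σ_{i+1}`), as a complex of graded `R-R` bimodules: the
cochain group in degree `i` is the direct sum over all smoothings with `i` crossings
`1`-smoothed, the left action uses a basepoint on the closing arc of the strand `u`, and the
right action a basepoint on the closing arc of the strand `v`. -/
def khovanovComplex : CochainComplex GrBimod ℕ :=
  CochainComplex.of
    (fun i => GrBimod.pi fun s : {s : Finset (Crossing w) // s.card = i} => vertex w u v s.1)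
    (fun _ => GrBimod.matrix fun s t => cubeMap u v s.1 t.1)
    (fun _ => GrBimod.matrix_comp _ _ fun s r => cube_sq u v s r.1)

end Complex

/-! ### The links `L_n` -/

/-- The braid word `(σ_1 ⋯ σ_n)^{n+1} σ_1 ⋯ σ_{n-1}` on `n + 1` strands. -/
def wordL (n : ℕ) : List (Fin n) :=
  (List.replicate (n + 1) (List.finRange n)).flatten ++ (List.finRange n).take (n - 1)

/-- The Khovanov complex of the link `L_n`, the closure of `wordL n`. The left basepoint is on
the closing arc of the strand number `n`, which belongs to the component `T(n, n+1)`, the right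
basepoint on the closing arc of the last strand, number `n + 1`, which forms the unknot
component. (Strands are numbered from `0` in the code.) -/
def khovanovL (n : ℕ) : CochainComplex GrBimod ℕ :=
  khovanovComplex (wordL n) ⟨n - 1, by omega⟩ (Fin.last n)

end Khovanov

end

/-! The argument works for every positive braid word `w` with at least two letters in which each
generator occurs, with basepoints on the last two lines. Number the lines `0, …, m` and put `e = m -
1`. In degree `0` the cochain group is `ℤ[x_0, …, x_m]/(x_c²)`, one variable for each line. In
degree `1` the component of a crossing with letter `j` is the quotient of this ring by `x_j =
x_{j+1}`, and the coboundary is the quotient map on each component.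

Let `P_i` be the product of the `x_c - x_{c+1}` with `c < i` (`prodDiff`), let `top_i` extract the
coefficient of `x_0 ⋯ x_{i-1}`, and let `elim_i f = P_i top_i (f with x_i replaced by x_{i+1})`.
Since a polynomial is affine in each `x_i` modulo squares, replacing `x_i` by `x_{i+1}` changes `f`
by `x_i - x_{i+1}` times its linear coefficient. Iterating this gives `f = ∑_{i < j} elim_i f + P_j
top_j f` (`cls_telescope`). The point is that `elim_i f` depends only on the image of `f` at a
crossing with letter `i`.

For `j = e` this is the homotopy identity in degree `0`: the sum is `h1` after the coboundary, with
one chosen crossing for each letter, and the remainder `P_e top_e f` factors through `R ⊗ R`,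
because on multiples of `P_e` each `x_c` with `c ≤ e` acts as `± x_e` (`vcls_mul_prodDiff`). So `1 ↦
P_e` embeds `R ⊗ R`. In degree `1` the same element `P_e` vanishes at all crossings except those
with the last letter, where `x_e = x_{e+1}`; this gives the term `R` of `E`.

In degree `1` the homotopy `h2` uses two kinds of pairs of crossings. For a pair with different
letters both edges are merges, and `elim_i` is used again. For a pair with the same letter the edges
split off a circle between the two crossings, and `h2` reads off the coefficient of the variable of
that circle (`elimSame`). The telescoping identity at a crossing with letter `j`, together with `P_i
= 0` there for `i > j`, yields the homotopy identity (`homotopy_one`).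

These identities give `d h2 d = d` in degree `1`, so that `1` minus `h2` followed by the coboundary
is an idempotent in degree `2`. Its image, followed by the unchanged cochain groups in higher
degrees, is the complement `G` (`LowSplitting`). -/

noncomputable section

namespace Khovanov

/-! ### Splitting a two-term complex off a cochain complex -/

section Split

universe v u

variable {V : Type u} [Category.{v} V] [Preadditive V]

/-- A two-term complex `E` in degrees `0` and `1` that is, up to homotopy, a direct summand of the
complex `C`, and carries all of it in these degrees. The homotopy is only prescribed in low
degrees, and its failure to be a contraction in degree `2` is the idempotent that `Q` splits. -/
structure LowSplitting (C E : CochainComplex V ℕ) (Z Q : V) where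
  isZero : IsZero Z
  isZero_E : ∀ i, IsZero (E.X (i + 2))
  epi : Epi (E.d 0 1)
  p0 : C.X 0 ⟶ E.X 0
  p1 : C.X 1 ⟶ E.X 1
  i0 : E.X 0 ⟶ C.X 0
  i1 : E.X 1 ⟶ C.X 1
  h1 : C.X 1 ⟶ C.X 0
  h2 : C.X 2 ⟶ C.X 1
  q : C.X 2 ⟶ Q
  s : Q ⟶ C.X 2
  p_comm : p0 ≫ E.d 0 1 = C.d 0 1 ≫ p1
  i_comm : i0 ≫ C.d 0 1 = E.d 0 1 ≫ i1
  i0_p0 : i0 ≫ p0 = 𝟙 _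
  homotopy0 : C.d 0 1 ≫ h1 + p0 ≫ i0 = 𝟙 _
  homotopy1 : C.d 1 2 ≫ h2 + h1 ≫ C.d 0 1 + p1 ≫ i1 = 𝟙 _
  s_q : s ≫ q = 𝟙 _
  q_s : h2 ≫ C.d 1 2 + q ≫ s = 𝟙 _

namespace LowSplitting

/-- The terms of the complement. -/
def restX (C : CochainComplex V ℕ) (Z Q : V) : ℕ → V
  | 0 => Z
  | 1 => Z
  | 2 => Q
  | i + 3 => C.X (i + 3)

variable {C E : CochainComplex V ℕ} {Z Q : V} (S : LowSplitting C E Z Q)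

/-- After the epimorphism `E.d 0 1` the composite becomes `i0` followed by two coboundaries of `C`.
-/
theorem i1_d : S.i1 ≫ C.d 1 2 = 0 := by
  have := S.epi
  rw [← cancel_epi (E.d 0 1), ← Category.assoc, ← S.i_comm, Category.assoc, C.d_comp_d, comp_zero,
    comp_zero]

/-- Cancelling the epimorphism `E.d 0 1` reduces this to `i0_p0`, which is why the structure has no
such field. -/
theorem i1_p1 : S.i1 ≫ S.p1 = 𝟙 _ := by
  have := S.epi
  rw [← cancel_epi (E.d 0 1), ← Category.assoc, ← S.i_comm, Category.assoc, ← S.p_comm,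
    ← Category.assoc, S.i0_p0, Category.id_comp, Category.comp_id]

/-- Composing `homotopy1` with the coboundary gives `d h2 d = d`. Then `q_s` forces `d ≫ q ≫ s = 0`,
and `s` has the left inverse `q`. -/
theorem d_q : C.d 1 2 ≫ S.q = 0 := by
  have h := congrArg (· ≫ C.d 1 2) S.homotopy1
  simp only [Preadditive.add_comp, Category.assoc, C.d_comp_d, S.i1_d, comp_zero, add_zero,
    Category.id_comp] at h
  have h' := congrArg (C.d 1 2 ≫ ·) S.q_s
  simp only [Preadditive.comp_add, h, Category.comp_id, add_eq_left] at h'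
  have := congrArg (· ≫ S.q) h'
  simpa [Category.assoc, S.s_q] using this

/-- `q ≫ s` differs from the identity by a map ending in `C.d 1 2`, which the next coboundary kills.
-/
theorem q_s_d : S.q ≫ S.s ≫ C.d 2 3 = C.d 2 3 := by
  have h := congrArg (· ≫ C.d 2 3) S.q_s
  simpa [Preadditive.add_comp, Category.assoc] using h

/-- The coboundaries of the complement. -/
def restD : ∀ i, restX C Z Q i ⟶ restX C Z Q (i + 1)
  | 0 => (0 : Z ⟶ Z)
  | 1 => (0 : Z ⟶ Q)
  | 2 => (S.s ≫ C.d 2 3 : Q ⟶ C.X 3)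
  | i + 3 => C.d (i + 3) (i + 4)

/-- The complement: it agrees with `C` above degree `2` and vanishes below degree `2`. -/
def rest : CochainComplex V ℕ :=
  CochainComplex.of (restX C Z Q) S.restD (by
    rintro (_ | _ | _ | i)
    · exact comp_zero
    · exact zero_comp
    · change (S.s ≫ C.d 2 3) ≫ C.d 3 4 = 0
      rw [Category.assoc, C.d_comp_d, comp_zero]
    · exact C.d_comp_d _ _ _)

theorem rest_d (i : ℕ) : S.rest.d i (i + 1) = S.restD i := CochainComplex.of_d _ _ _

/-- The components of the projection to the complement. -/
def toRestF : ∀ i, C.X i ⟶ restX C Z Q i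
  | 0 => (0 : C.X 0 ⟶ Z)
  | 1 => (0 : C.X 1 ⟶ Z)
  | 2 => S.q
  | i + 3 => 𝟙 (C.X (i + 3))

/-- The components of the inclusion of the complement. -/
def ofRestF : ∀ i, restX C Z Q i ⟶ C.X i
  | 0 => (0 : Z ⟶ C.X 0)
  | 1 => (0 : Z ⟶ C.X 1)
  | 2 => S.s
  | i + 3 => 𝟙 (C.X (i + 3))

/-- The projection to the complement. -/
def toRest : C ⟶ S.rest where
  f := S.toRestF
  comm' := by
    rintro i _ rfl
    rw [S.rest_d]
    rcases i with _ | _ | _ | i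
    · exact comp_zero.trans comp_zero.symm
    · exact comp_zero.trans S.d_q.symm
    · exact (S.q_s_d).trans (Category.comp_id _).symm
    · exact (Category.id_comp _).trans (Category.comp_id _).symm

/-- The inclusion of the complement. -/
def ofRest : S.rest ⟶ C where
  f := S.ofRestF
  comm' := by
    rintro i _ rfl
    rw [S.rest_d]
    rcases i with _ | _ | _ | i
    · exact zero_comp.trans zero_comp.symm
    · exact zero_comp.trans zero_comp.symm
    · exact (Category.comp_id _).symm
    · exact (Category.id_comp _).trans (Category.comp_id _).symm

/-- The components of the projection to `E`. -/
def toEF : ∀ i, C.X i ⟶ E.X i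
  | 0 => S.p0
  | 1 => S.p1
  | _ + 2 => 0

/-- The components of the inclusion of `E`. -/
def ofEF : ∀ i, E.X i ⟶ C.X i
  | 0 => S.i0
  | 1 => S.i1
  | _ + 2 => 0

/-- The projection to `E`. -/
def toE : C ⟶ E where
  f := S.toEF
  comm' := by
    rintro i _ rfl
    rcases i with _ | i
    · exact S.p_comm
    · exact (S.isZero_E i).eq_of_tgt _ _

/-- The inclusion of `E`. -/
def ofE : E ⟶ C where
  f := S.ofEF
  comm' := by
    rintro i _ rfl
    rcases i with _ | _ | i
    · exact S.i_comm
    · exact S.i1_d.trans comp_zero.symm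
    · exact (S.isZero_E i).eq_of_src _ _

theorem ofE_toE : S.ofE ≫ S.toE = 𝟙 _ := by
  ext i
  rcases i with _ | _ | i
  · exact S.i0_p0
  · exact S.i1_p1
  · exact (S.isZero_E i).eq_of_src _ _

theorem ofRest_toRest : S.ofRest ≫ S.toRest = 𝟙 _ := by
  ext i
  rcases i with _ | _ | _ | i
  · exact S.isZero.eq_of_src _ _
  · exact S.isZero.eq_of_src _ _
  · exact S.s_q
  · exact Category.id_comp _

theorem ofE_toRest : S.ofE ≫ S.toRest = 0 := by
  ext i
  rcases i with _ | _ | i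
  · exact S.isZero.eq_of_tgt _ _
  · exact S.isZero.eq_of_tgt _ _
  · exact (S.isZero_E i).eq_of_src _ _

theorem ofRest_toE : S.ofRest ≫ S.toE = 0 := by
  ext i
  rcases i with _ | _ | i
  · exact S.isZero.eq_of_src _ _
  · exact S.isZero.eq_of_src _ _
  · exact (S.isZero_E i).eq_of_tgt _ _

/-- The components of the homotopy. -/
def homotopyF : ∀ i, C.X (i + 1) ⟶ C.X i
  | 0 => S.h1
  | 1 => S.h2
  | _ + 2 => 0

/-- The sum of the projections to the two summands. -/
abbrev proj : C ⟶ C := S.toE ≫ S.ofE + S.toRest ≫ S.ofRest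

theorem proj_f0 : S.proj.f 0 = S.p0 ≫ S.i0 :=
  (congrArg (S.p0 ≫ S.i0 + ·) zero_comp).trans (add_zero _)

theorem proj_f1 : S.proj.f 1 = S.p1 ≫ S.i1 :=
  (congrArg (S.p1 ≫ S.i1 + ·) zero_comp).trans (add_zero _)

theorem proj_f2 : S.proj.f 2 = S.q ≫ S.s :=
  (congrArg (· + S.q ≫ S.s) zero_comp).trans (zero_add _)

theorem proj_f (i : ℕ) : S.proj.f (i + 3) = 𝟙 (C.X (i + 3)) :=
  (congrArg₂ (· + ·) zero_comp (Category.id_comp _)).trans (zero_add _)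

open Classical in
/-- The homotopy between the identity and the projection to both summands. -/
def homotopy : Homotopy S.proj (𝟙 C) :=
  -- The equations at hand express `𝟙` as `proj` plus the homotopy terms, so they give the homotopy
  -- in the opposite direction.
  Homotopy.symm
    { hom := fun i j => if h : j + 1 = i then eqToHom (by rw [h]) ≫ S.homotopyF j else 0
      zero := fun i j h => dif_neg h
      comm := by
        intro i
        rcases i with _ | _ | _ | i
        · rw [dNext_eq _ (show (ComplexShape.up ℕ).Rel 0 1 from rfl), S.proj_f0]
          simpa [homotopyF] using S.homotopy0.symm
        · rw [dNext_eq _ (show (ComplexShape.up ℕ).Rel 1 2 from rfl),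
            prevD_eq _ (show (ComplexShape.up ℕ).Rel 0 1 from rfl), S.proj_f1]
          simpa [homotopyF] using S.homotopy1.symm
        · rw [dNext_eq _ (show (ComplexShape.up ℕ).Rel 2 3 from rfl),
            prevD_eq _ (show (ComplexShape.up ℕ).Rel 1 2 from rfl), S.proj_f2]
          simpa [homotopyF] using S.q_s.symm
        · rw [dNext_eq _ (show (ComplexShape.up ℕ).Rel (i + 3) (i + 4) from rfl),
            prevD_eq _ (show (ComplexShape.up ℕ).Rel (i + 2) (i + 3) from rfl), S.proj_f]
          simp [homotopyF] }

/-- The complex is homotopy equivalent to the direct sum of `E` and the complement. -/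
def homotopyEquiv [HasBinaryBiproducts V] : HomotopyEquiv C (E ⊞ S.rest) where
  hom := biprod.lift S.toE S.toRest
  inv := biprod.desc S.ofE S.ofRest
  homotopyHomInvId := (Homotopy.ofEq (by rw [biprod.lift_desc])).trans S.homotopy
  homotopyInvHomId := Homotopy.ofEq (by
    apply biprod.hom_ext' <;> apply biprod.hom_ext <;>
      simp [S.ofE_toE, S.ofRest_toRest, S.ofE_toRest, S.ofRest_toE])

end LowSplitting

end Split

/-! ### Morphisms of graded bimodules -/

namespace GrBimod

variable {M N P : GrBimod}

theorem toLin_comp (f : M ⟶ N) (g : N ⟶ P) (x : M) : toLin (f ≫ g) x = toLin g (toLin f x) := rfl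

theorem toLin_add (f g : M ⟶ N) (x : M) : toLin (f + g) x = toLin f x + toLin g x := rfl

theorem toLin_zsmul (n : ℤ) (f : M ⟶ N) (x : M) : toLin (n • f) x = n • toLin f x := rfl

theorem toLin_sum {ι : Type} (s : Finset ι) (f : ι → (M ⟶ N)) (x : M) :
    toLin (∑ i ∈ s, f i) x = ∑ i ∈ s, toLin (f i) x := by
  change (∑ i ∈ s, f i).1 x = _
  rw [AddSubgroup.val_finsetSum, LinearMap.sum_apply]
  rfl

theorem isZero_of_subsingleton (M : GrBimod) [Subsingleton M] : IsZero M :=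
  (IsZero.iff_id_eq_zero M).2 (hom_ext fun _ => Subsingleton.elim _ _)

/-- An additive map that commutes with both actions of `X` is a bimodule map. -/
theorem map_smul_of_X {A B : Type} [AddCommGroup A] [AddCommGroup B] [Module RR A] [Module RR B]
    (g : A →+ B) (hL : ∀ x, g (XL • x) = XL • g x) (hR : ∀ x, g (XR • x) = XR • g x) (a : RR)
    (x : A) : g (a • x) = a • g x := by
  induction a using TensorProduct.induction_on with
  | zero =>
    exact (congrArg g (zero_smul RR x)).trans ((map_zero g).trans (zero_smul RR (g x)).symm)
  | add a b ha hb => rw [add_smul, add_smul, map_add, ha, hb]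
  | tmul a b =>
    -- As a ring, `R ⊗ R` is generated by `XL` and `XR`, and additive maps respect the integer
    -- coefficients.
    have e : a ⊗ₜ[ℤ] b = (TrivSqZeroExt.fst a • (1 : RR) + TrivSqZeroExt.snd a • XL) *
        (TrivSqZeroExt.fst b • (1 : RR) + TrivSqZeroExt.snd b • XR) := by
      have h : ∀ c : R, c = TrivSqZeroExt.fst c • (1 : R) + TrivSqZeroExt.snd c • DualNumber.eps := by
        intro c
        ext <;> simp
      have hL : (TrivSqZeroExt.fst a • (1 : RR) + TrivSqZeroExt.snd a • XL) = a ⊗ₜ[ℤ] (1 : R) := by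
        conv_rhs => rw [h a]
        rw [TensorProduct.add_tmul, ← TensorProduct.smul_tmul', ← TensorProduct.smul_tmul']
        rfl
      have hR : (TrivSqZeroExt.fst b • (1 : RR) + TrivSqZeroExt.snd b • XR) = (1 : R) ⊗ₜ[ℤ] b := by
        conv_rhs => rw [h b]
        rw [TensorProduct.tmul_add, TensorProduct.tmul_smul, TensorProduct.tmul_smul]
        rfl
      rw [hL, hR, Algebra.TensorProduct.tmul_mul_tmul, one_mul, mul_one]
    rw [e]
    simp only [mul_smul, add_smul, map_add, smul_assoc, one_smul, map_zsmul, hL, hR]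

/-- An additive map that respects the actions of `X` and the grading as a morphism. -/
def ofAdd (g : M →+ N) (hL : ∀ x, g (XL • x) = XL • g x) (hR : ∀ x, g (XR • x) = XR • g x)
    (hg : ∀ q, ∀ x ∈ M.gr q, g x ∈ N.gr q) : M ⟶ N :=
  ofLin { g with map_smul' := map_smul_of_X g hL hR } hg

/-- The projections of a direct sum. -/
def piProj {ι : Type} [Finite ι] (M : ι → GrBimod) (i : ι) : pi M ⟶ M i :=
  ofLin (M := pi M) (N := M i) (LinearMap.proj i) fun _ _ hx => hx i trivial

theorem toLin_piProj {ι : Type} [Finite ι] (M : ι → GrBimod) (i : ι) (x : pi M) :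
    toLin (piProj M i) x = (x : ∀ i, M i) i := rfl

/-- Morphisms to a direct sum. -/
def piLift {ι : Type} [Finite ι] {M : ι → GrBimod} (f : ∀ i, P ⟶ M i) : P ⟶ pi M :=
  ofLin (M := P) (N := pi M) (LinearMap.pi fun i => toLin (f i)) fun q x hx i _ => (f i).2 q x hx

theorem toLin_piLift {ι : Type} [Finite ι] {M : ι → GrBimod} (f : ∀ i, P ⟶ M i) (x : P) (i : ι) :
    (toLin (piLift f) x : ∀ i, M i) i = toLin (f i) x := rfl

/-- The image of an idempotent. -/
def image (e : M ⟶ M) (he : e ≫ e = e) : GrBimod where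
  carrier := LinearMap.range (toLin e)
  gr q := (M.gr q).comap (LinearMap.range (toLin e)).subtype.toAddMonoidHom.toIntLinearMap
  internal := by
    obtain ⟨π, h1, h2⟩ := exists_proj M.internal
    have hid : ∀ x ∈ LinearMap.range (toLin e), toLin e x = x := by
      rintro _ ⟨x, rfl⟩
      exact congrArg (fun f => toLin f x) he
    -- The homogeneous projections of `M` take values in `M`; applying `e` afterwards brings these
    -- values into the image and fixes what lies there already.
    let r : M →+ LinearMap.range (toLin e) := (toLin e).rangeRestrict.toAddMonoidHom
    have hr : ∀ x : LinearMap.range (toLin e), r x = x := fun x => Subtype.ext (hid x x.2)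
    refine isInternal_of_proj ?_
      (fun q => r.comp ((π q).comp (LinearMap.range (toLin e)).subtype.toAddMonoidHom)) ?_ ?_
    · rw [eq_top_iff]
      rintro x -
      have hx : (x : M) ∈ ⨆ q, M.gr q := by rw [M.internal.submodule_iSup_eq_top]; trivial
      have hx' := Submodule.mem_map_of_mem (f := r.toIntLinearMap) hx
      rw [Submodule.map_iSup] at hx'
      have e' : r.toIntLinearMap (x : M) = x := hr x
      rw [e'] at hx'
      refine SetLike.le_def.1 (iSup_mono fun q => ?_) hx'
      rintro _ ⟨z, hz, rfl⟩
      exact e.2 q z hz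
    · intro q x hx
      change r (π q x) = x
      rw [h1 q x hx, hr]
    · intro q q' x hx hq
      change r (π q' x) = 0
      rw [h2 q q' x hx hq, map_zero]
  left_mem := by
    intro q x hx
    exact M.left_mem q x.1 hx
  right_mem := by
    intro q x hx
    exact M.right_mem q x.1 hx

/-- The projection to the image of an idempotent. -/
def toImage (e : M ⟶ M) (he : e ≫ e = e) : M ⟶ image e he :=
  ofLin (M := M) (N := image e he) (toLin e).rangeRestrict fun q x hx => e.2 q x hx

/-- The inclusion of the image of an idempotent. -/
def ofImage (e : M ⟶ M) (he : e ≫ e = e) : image e he ⟶ M :=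
  ofLin (M := image e he) (N := M) (LinearMap.range (toLin e)).subtype fun _ _ hx => hx

theorem ofImage_toImage (e : M ⟶ M) (he : e ≫ e = e) : ofImage e he ≫ toImage e he = 𝟙 _ := by
  refine hom_ext fun x => Subtype.ext ?_
  obtain ⟨_, x, rfl⟩ := x
  exact congrArg (fun f => toLin f x) he

end GrBimod

/-! ### Operators on polynomials -/

section Operators

open MvPolynomial

variable {m : ℕ} {w : List (Fin m)}

/-- A property of homogeneous polynomials that is stable under multiplication by variables. -/
theorem mem_of_mem_polyGr {N : Type} [AddCommGroup N] (g : Poly w →+ N) (T : ℤ → Submodule ℤ N)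
    (h1 : g 1 ∈ T 0) (hX : ∀ q f p, g f ∈ T q → g (f * X p) ∈ T (q - 2)) {q : ℤ} {f : Poly w}
    (hf : f ∈ polyGr w q) : g f ∈ T q := by
  have hmon : ∀ d : Pt w →₀ ℕ,
      g (monomial d 1) ∈ T (Finsupp.weight (fun _ : Pt w => (-2 : ℤ)) d) := by
    have hstep : ∀ (p : Pt w) (n : ℕ) (d : Pt w →₀ ℕ),
        g (monomial d 1) ∈ T (Finsupp.weight (fun _ : Pt w => (-2 : ℤ)) d) →
        g (monomial (Finsupp.single p n + d) 1) ∈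
          T (Finsupp.weight (fun _ : Pt w => (-2 : ℤ)) (Finsupp.single p n + d)) := by
      intro p n d hd
      induction n with
      | zero => simpa using hd
      | succ n ih =>
        convert hX _ _ p ih using 2
        · simp only [map_add, Finsupp.weight_single]
          simp only [nsmul_eq_mul]
          push_cast
          ring
        · rw [← pow_one (X p : Poly w), X_pow_eq_monomial, monomial_mul, one_mul,
            Finsupp.single_add, add_right_comm]
    intro d
    induction d using Finsupp.induction with
    | zero => simpa using h1
    | single_add p n d _ _ ih => exact hstep p n d ih
  rw [f.as_sum, map_sum]
  refine Submodule.sum_mem _ fun d hd => ?_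
  have h2 := hmon d
  rw [hf (mem_support_iff.1 hd)] at h2
  have e : monomial d (coeff d f) = coeff d f • (monomial d 1 : Poly w) := by
    rw [smul_monomial, smul_eq_mul, mul_one]
  rw [e, map_zsmul]
  exact Submodule.smul_mem _ _ h2

/-- The variable of the bottom point of a line. -/
def y (w : List (Fin m)) (c : ℕ) : Poly w := X (0, Fin.ofNat (m + 1) c)

/-- The substitution of `x_{i+1}` for `x_i`; all other lines are kept. -/
def subst (w : List (Fin m)) (i : ℕ) : Poly w →ₐ[ℤ] Poly w :=
  aeval fun p => if (p.2 : ℕ) = i then y w (i + 1) else X (0, p.2)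

open Classical in
/-- The expansion of a polynomial to first order in the variables of a set of points. -/
def expand (S : Set (Pt w)) : Poly w →ₐ[ℤ] DualNumber (Poly w) :=
  aeval fun p => if p ∈ S then DualNumber.eps else TrivSqZeroExt.inl (X p)

/-- The part of a polynomial that is linear in the variables of a set of points. -/
def lin (S : Set (Pt w)) : Poly w →+ Poly w where
  toFun f := (expand S f).snd
  map_zero' := by simp
  map_add' f g := by simp

/-- The part of a polynomial without variables of a set of points. -/
def const (S : Set (Pt w)) : Poly w →+ Poly w where
  toFun f := (expand S f).fst
  map_zero' := by simp
  map_add' f g := by simp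

/-- The Leibniz rule of the dual numbers: `const` and `lin` are the two components of the ring map
`expand`. -/
theorem lin_mul (S : Set (Pt w)) (f g : Poly w) :
    lin S (f * g) = const S f * lin S g + lin S f * const S g := by
  simp [lin, const, mul_comm]

theorem const_mul (S : Set (Pt w)) (f g : Poly w) :
    const S (f * g) = const S f * const S g := by
  simp [const]

theorem lin_C (S : Set (Pt w)) (a : ℤ) : lin S (C a) = 0 := by
  simp [lin]

theorem const_C (S : Set (Pt w)) (a : ℤ) : const S (C a) = C a := by
  simp [const]

theorem lin_one (S : Set (Pt w)) : lin S 1 = 0 := by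
  simp [lin]

theorem const_one (S : Set (Pt w)) : const S 1 = 1 := by
  simp [const]

theorem lin_X_of_mem {S : Set (Pt w)} {p : Pt w} (h : p ∈ S) : lin S (X p) = 1 := by
  simp [lin, expand, h]

theorem const_X_of_mem {S : Set (Pt w)} {p : Pt w} (h : p ∈ S) : const S (X p) = 0 := by
  simp [const, expand, h]

theorem lin_X_of_notMem {S : Set (Pt w)} {p : Pt w} (h : p ∉ S) : lin S (X p) = 0 := by
  simp [lin, expand, h]

theorem const_X_of_notMem {S : Set (Pt w)} {p : Pt w} (h : p ∉ S) : const S (X p) = X p := by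
  simp [const, expand, h]

/-! ### Coefficient extraction and the product of differences -/

/-- The points on a line. -/
def line (w : List (Fin m)) (c : ℕ) : Set (Pt w) := {p | (p.2 : ℕ) = c}

/-- The coefficient of `x_0 ⋯ x_{i-1}`. -/
def top (w : List (Fin m)) : ℕ → Poly w →+ Poly w
  | 0 => AddMonoidHom.id _
  | i + 1 => (top w i).comp (lin (line w i))

theorem top_succ (i : ℕ) (f : Poly w) : top w (i + 1) f = top w i (lin (line w i) f) := rfl

/-- The product of the `x_c - x_{c+1}` for `c < i`. -/
def prodDiff (w : List (Fin m)) (i : ℕ) : Poly w := ∏ c ∈ Finset.range i, (y w c - y w (c + 1))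

theorem prodDiff_succ (i : ℕ) : prodDiff w (i + 1) = prodDiff w i * (y w i - y w (i + 1)) :=
  Finset.prod_range_succ _ _

theorem ofNat_val {c : ℕ} (hc : c ≤ m) : (Fin.ofNat (m + 1) c : ℕ) = c :=
  Nat.mod_eq_of_lt (by omega)

theorem y_val (j : Fin (m + 1)) : y w j = X (0, j) := by
  unfold y
  congr 2
  exact Fin.ext (ofNat_val (by omega))

theorem mem_line_y {c i : ℕ} (hc : c ≤ m) : ((0, Fin.ofNat (m + 1) c) : Pt w) ∈ line w i ↔ c = i := by
  change (Fin.ofNat (m + 1) c : ℕ) = i ↔ _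
  rw [ofNat_val hc]

theorem lin_y_self {c : ℕ} (hc : c ≤ m) : lin (line w c) (y w c) = 1 :=
  lin_X_of_mem ((mem_line_y hc).2 rfl)

theorem const_y_self {c : ℕ} (hc : c ≤ m) : const (line w c) (y w c) = 0 :=
  const_X_of_mem ((mem_line_y hc).2 rfl)

theorem lin_y_ne {c i : ℕ} (hc : c ≤ m) (h : c ≠ i) : lin (line w i) (y w c) = 0 :=
  lin_X_of_notMem fun e => h ((mem_line_y hc).1 e)

theorem const_y_ne {c i : ℕ} (hc : c ≤ m) (h : c ≠ i) : const (line w i) (y w c) = y w c :=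
  const_X_of_notMem fun e => h ((mem_line_y hc).1 e)

theorem lin_y_mul {c i : ℕ} (hc : c ≤ m) (h : c ≠ i) (f : Poly w) :
    lin (line w i) (y w c * f) = y w c * lin (line w i) f := by
  rw [lin_mul, lin_y_ne hc h, const_y_ne hc h, zero_mul, add_zero]

/-- `top w i` only extracts variables of the lines `0, …, i - 1`; a variable on any other line is a
scalar for it. -/
theorem top_y_mul {c i : ℕ} (hc : c ≤ m) (h : i ≤ c) (f : Poly w) :
    top w i (y w c * f) = y w c * top w i f := by
  induction i generalizing f with
  | zero => rfl
  | succ i ih => rw [top_succ, top_succ, lin_y_mul hc (by omega), ih (by omega)]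

/-- Only the lines `0, …, i` occur in `prodDiff w i`. -/
theorem const_lin_prodDiff {c i : ℕ} (h : i < c) (hc : c ≤ m) :
    const (line w c) (prodDiff w i) = prodDiff w i ∧ lin (line w c) (prodDiff w i) = 0 := by
  induction i with
  | zero => exact ⟨const_one _, lin_one _⟩
  | succ i ih =>
    obtain ⟨h1, h2⟩ := ih (by omega)
    rw [prodDiff_succ, const_mul, lin_mul, h1, h2, map_sub, map_sub, lin_y_ne (by omega) (by omega),
      lin_y_ne (by omega) (by omega), const_y_ne (by omega) (by omega),
      const_y_ne (by omega) (by omega)]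
    simp

/-- For reasons of degree: `i` linear factors cannot produce a monomial divisible by `i + 1`
variables. -/
theorem top_succ_prodDiff {i : ℕ} (h : i < m) : top w (i + 1) (prodDiff w i) = 0 := by
  induction i with
  | zero => rw [top_succ]; exact lin_one _
  | succ i ih =>
    obtain ⟨h1, h2⟩ := const_lin_prodDiff (w := w) (show i < i + 1 by omega) (by omega)
    rw [top_succ, prodDiff_succ, lin_mul, h1, h2, map_sub, lin_y_self (by omega),
      lin_y_ne (by omega) (by omega), zero_mul, add_zero, zero_sub, mul_neg_one, map_neg,
      ih (by omega), neg_zero]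

/-- The monomial `x_0 ⋯ x_{i-1}` arises only by choosing the first term `x_c` in every factor `x_c -
x_{c+1}`. -/
theorem top_prodDiff {i : ℕ} (h : i ≤ m) : top w i (prodDiff w i) = 1 := by
  induction i with
  | zero => rfl
  | succ i ih =>
    rcases i with _ | i
    · rw [top_succ, prodDiff_succ, lin_mul, map_sub, lin_y_self (by omega),
        lin_y_ne (by omega) (by omega)]
      change (const _ 1 * (1 - 0) + lin _ 1 * _ : Poly w) = 1
      rw [const_one, lin_one]
      ring
    · have h0 := top_succ_prodDiff (w := w) (show i < m by omega)
      obtain ⟨h1, h2⟩ := const_lin_prodDiff (w := w) (show i < i + 1 by omega) (by omega)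
      -- The linear part is `(x_i + x_{i+2}) P_i`. In this form induction covers the first summand,
      -- and the other two vanish by `h0` once their variables are pulled out of `top`.
      have e : lin (line w (i + 1)) (prodDiff w (i + 2)) =
          prodDiff w (i + 1) + (y w (i + 1) * prodDiff w i + y w (i + 2) * prodDiff w i) := by
        rw [prodDiff_succ (i + 1), prodDiff_succ i, mul_assoc, lin_mul, h1, h2, lin_mul, map_sub,
          map_sub, map_sub, map_sub, lin_y_self (by omega), lin_y_ne (c := i) (by omega) (by omega),
          lin_y_ne (c := i + 2) (by omega) (by omega), const_y_self (by omega),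
          const_y_ne (c := i) (by omega) (by omega), const_y_ne (c := i + 2) (by omega) (by omega)]
        ring
      rw [top_succ, e, map_add, map_add, top_y_mul (by omega) le_rfl, top_y_mul (by omega) (by omega),
        h0, ih (by omega)]
      ring

theorem subst_X_of_eq {i : ℕ} {p : Pt w} (h : (p.2 : ℕ) = i) : subst w i (X p) = y w (i + 1) := by
  simp [subst, h]

theorem subst_X_of_ne {i : ℕ} {p : Pt w} (h : (p.2 : ℕ) ≠ i) : subst w i (X p) = X (0, p.2) := by
  simp [subst, h]

theorem subst_y_ne {i c : ℕ} (hc : c ≤ m) (h : c ≠ i) : subst w i (y w c) = y w c :=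
  subst_X_of_ne (by rw [ofNat_val hc]; exact h)

theorem subst_y_self {i : ℕ} (hc : i ≤ m) : subst w i (y w i) = y w (i + 1) :=
  subst_X_of_eq (ofNat_val hc)

/-! Gradings. -/

theorem y_mem_polyGr (c : ℕ) : y w c ∈ polyGr w (-2) := X_mem_polyGr _

theorem mul_X_mem {q : ℤ} {f g : Poly w} (hf : f ∈ polyGr w q) (hg : g ∈ polyGr w (-2)) :
    f * g ∈ polyGr w (q - 2) := by
  rw [sub_eq_add_neg]
  exact mul_mem_polyGr hf hg

theorem one_mem_polyGr : (1 : Poly w) ∈ polyGr w 0 := isWeightedHomogeneous_one _ _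

theorem subst_mem_polyGr (i : ℕ) {q : ℤ} {f : Poly w} (hf : f ∈ polyGr w q) :
    subst w i f ∈ polyGr w q := by
  refine mem_of_mem_polyGr (subst w i).toRingHom.toAddMonoidHom (polyGr w) ?_ ?_ hf
  · change subst w i 1 ∈ _
    rw [map_one]
    exact one_mem_polyGr
  · intro q f p h
    change subst w i (f * X p) ∈ _
    rw [map_mul]
    refine mul_X_mem h ?_
    by_cases e : (p.2 : ℕ) = i
    · rw [subst_X_of_eq e]; exact y_mem_polyGr _
    · rw [subst_X_of_ne e]; exact X_mem_polyGr _

/-- Removing one variable of degree `-2` raises the degree by `2`. The induction has to carry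
`const` along, because the product rule mixes both parts. -/
theorem lin_mem_polyGr (S : Set (Pt w)) {q : ℤ} {f : Poly w} (hf : f ∈ polyGr w q) :
    lin S f ∈ polyGr w (q + 2) := by
  refine (mem_of_mem_polyGr ((const S).prod (lin S)) (fun q => (polyGr w q).prod (polyGr w (q + 2)))
    ?_ ?_ hf).2
  · exact ⟨by simpa [const_one] using one_mem_polyGr, by simp [lin_one]⟩
  · rintro q f p ⟨h1, h2⟩
    simp only [AddMonoidHom.prod_apply] at h1 h2
    refine ⟨?_, ?_⟩
    · change const S (f * X p) ∈ polyGr w _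
      rw [const_mul]
      by_cases e : p ∈ S
      · rw [const_X_of_mem e, mul_zero]; exact Submodule.zero_mem _
      · rw [const_X_of_notMem e]; exact mul_X_mem h1 (X_mem_polyGr _)
    · change lin S (f * X p) ∈ polyGr w _
      rw [lin_mul]
      by_cases e : p ∈ S
      · rw [const_X_of_mem e, lin_X_of_mem e, mul_zero, mul_one, add_zero, sub_add_cancel]; exact h1
      · rw [const_X_of_notMem e, lin_X_of_notMem e, mul_zero, zero_add, sub_add_eq_add_sub]
        exact mul_X_mem h2 (X_mem_polyGr _)

theorem top_mem_polyGr (i : ℕ) {q : ℤ} {f : Poly w} (hf : f ∈ polyGr w q) :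
    top w i f ∈ polyGr w (q + 2 * i) := by
  induction i generalizing f q with
  | zero => simpa [top] using hf
  | succ i ih =>
    rw [top_succ]
    convert ih (lin_mem_polyGr _ hf) using 1
    push_cast
    ring_nf

theorem prodDiff_mem_polyGr (i : ℕ) : prodDiff w i ∈ polyGr w (-2 * i) := by
  induction i with
  | zero => exact one_mem_polyGr
  | succ i ih =>
    rw [prodDiff_succ]
    convert mul_X_mem ih (Submodule.sub_mem _ (y_mem_polyGr i) (y_mem_polyGr (i + 1))) using 1
    push_cast
    ring_nf

end Operators

/-! ### Operators on the rings of smoothings -/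

section StateOperators

open MvPolynomial

variable {m : ℕ} {w : List (Fin m)}

/-! ### Lines and circles of a smoothing -/

theorem arc_col {s : Finset (Crossing w)} {p q : Pt w} (h : Arc w s p q) :
    p.2 = q.2 ∨ ∃ k ∈ s, p.2 = (w.get k).castSucc ∧ q.2 = (w.get k).succ := by
  cases h with
  | bot t h => exact Or.inr ⟨t, h, rfl, rfl⟩
  | top t h => exact Or.inr ⟨t, h, rfl, rfl⟩
  | _ => exact Or.inl rfl

theorem same_step {s : Finset (Crossing w)} {t : Crossing w} (h : t ∉ s) (c : Fin (m + 1)) :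
    sameCircle w s (t.castSucc, c) (t.succ, c) := by
  by_cases h1 : c = (w.get t).castSucc
  · rw [h1]; exact (Arc.left t h).same
  by_cases h2 : c = (w.get t).succ
  · rw [h2]; exact (Arc.right t h).same
  exact (Arc.strand t c h1 h2).same

theorem same_zero {s : Finset (Crossing w)} (h : Fin (w.length + 1)) (c : Fin (m + 1))
    (hs : ∀ t : Crossing w, t.castSucc < h → t ∉ s) : sameCircle w s (h, c) (0, c) := by
  induction h using Fin.induction with
  | zero => exact (sameCircle w s).refl _
  | succ t ih =>
    exact (sameCircle w s).trans ((sameCircle w s).symm (same_step (hs t (Fin.castSucc_lt_succ)) c))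
      (ih fun l hl => hs l (hl.trans Fin.castSucc_lt_succ))

theorem same_last {s : Finset (Crossing w)} (h : Fin (w.length + 1)) (c : Fin (m + 1))
    (hs : ∀ t : Crossing w, h ≤ t.castSucc → t ∉ s) :
    sameCircle w s (h, c) (Fin.last _, c) := by
  induction h using Fin.reverseInduction with
  | last => exact (sameCircle w s).refl _
  | cast t ih =>
    exact (sameCircle w s).trans (same_step (hs t le_rfl) c)
      (ih fun l hl => hs l (Fin.castSucc_lt_succ.le.trans hl))

/-- Each line lies on one circle. -/
def Thin (s : Finset (Crossing w)) : Prop := ∀ p : Pt w, sameCircle w s p (0, p.2)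

theorem thin_empty : Thin (∅ : Finset (Crossing w)) := fun p => same_zero p.1 p.2 (by simp)

/-- A single crossing cuts a line at one height only: points below it descend to the bottom, points
above it ascend and use the closing arc. -/
theorem thin_singleton (k : Crossing w) : Thin ({k} : Finset (Crossing w)) := by
  rintro ⟨h, c⟩
  by_cases hk : h ≤ k.castSucc
  · refine same_zero h c fun t ht e => ?_
    rw [Finset.mem_singleton.1 e] at ht
    exact absurd ht (not_lt.2 hk)
  · refine (sameCircle w _).trans (same_last h c fun t ht e => ?_) (Arc.close c).same
    rw [Finset.mem_singleton.1 e] at ht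
    exact hk ht

theorem Thin.same_of_col {s : Finset (Crossing w)} (hs : Thin s) {p q : Pt w} (h : p.2 = q.2) :
    sameCircle w s p q := by
  refine (sameCircle w s).trans (hs p) ?_
  rw [h]
  exact (sameCircle w s).symm (hs q)

theorem Thin.same_of_letter {s : Finset (Crossing w)} (hs : Thin s) {k : Crossing w} (hk : k ∈ s)
    {p q : Pt w} (hp : p.2 = (w.get k).castSucc) (hq : q.2 = (w.get k).succ) :
    sameCircle w s p q :=
  (sameCircle w s).trans (hs.same_of_col (q := botL k) hp)
    ((sameCircle w s).trans (Arc.bot k hk).same (hs.same_of_col (p := botR k) hq.symm))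

/-! ### Passage of the operators to the rings of smoothings -/

theorem X_sq_mem (s : Finset (Crossing w)) (p : Pt w) : (X p : Poly w) ^ 2 ∈ circleIdeal w s :=
  Ideal.subset_span (Or.inl ⟨p, rfl⟩)

theorem X_sub_X_mem {s : Finset (Crossing w)} {p q : Pt w} (h : sameCircle w s p q) :
    (X p - X q : Poly w) ∈ circleIdeal w s :=
  Ideal.Quotient.eq.1 (cls_X_eq h)

/-- No arc leaves `S`. A generator of the ideal in variables of `S` has constant and linear part
zero, and any other one is constant with respect to `S` and lies in the ideal of `t`. Both parts are
needed at once for the product rule. -/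
theorem lin_mem_circleIdeal {S : Set (Pt w)} {s t : Finset (Crossing w)}
    (h : ∀ p q, Arc w s p q → (p ∈ S ∧ q ∈ S) ∨ (p ∉ S ∧ q ∉ S ∧ sameCircle w t p q)) {f : Poly w}
    (hf : f ∈ circleIdeal w s) : lin S f ∈ circleIdeal w t := by
  suffices const S f ∈ circleIdeal w t ∧ lin S f ∈ circleIdeal w t from this.2
  refine Submodule.span_induction ?_ ?_ ?_ ?_ hf
  · rintro _ (⟨p, rfl⟩ | ⟨p, q, hpq, rfl⟩)
    · rw [pow_two, const_mul, lin_mul]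
      by_cases e : p ∈ S
      · rw [const_X_of_mem e]; simp
      · rw [const_X_of_notMem e, lin_X_of_notMem e, ← pow_two]
        exact ⟨X_sq_mem t p, by simp⟩
    · rw [map_sub, map_sub]
      rcases h p q hpq with ⟨e1, e2⟩ | ⟨e1, e2, e3⟩
      · rw [const_X_of_mem e1, const_X_of_mem e2, lin_X_of_mem e1, lin_X_of_mem e2]; simp
      · rw [const_X_of_notMem e1, const_X_of_notMem e2, lin_X_of_notMem e1, lin_X_of_notMem e2]
        exact ⟨X_sub_X_mem e3, by simp⟩
  · simp
  · intro a b _ _ ha hb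
    rw [map_add, map_add]
    exact ⟨Ideal.add_mem _ ha.1 hb.1, Ideal.add_mem _ ha.2 hb.2⟩
  · intro a b _ hb
    rw [smul_eq_mul, const_mul, lin_mul]
    exact ⟨Ideal.mul_mem_left _ _ hb.1,
      Ideal.add_mem _ (Ideal.mul_mem_left _ _ hb.2) (Ideal.mul_mem_left _ _ hb.1)⟩

/-- The lines `0, …, i - 1` are not joined to any other line, so each of them is closed under arcs.
-/
theorem top_mem_circleIdeal {i : ℕ} {s : Finset (Crossing w)} (h : ∀ k ∈ s, i ≤ (w.get k : ℕ))
    {f : Poly w} (hf : f ∈ circleIdeal w s) : top w i f ∈ circleIdeal w s := by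
  induction i generalizing f with
  | zero => exact hf
  | succ i ih =>
    refine ih (fun k hk => (Nat.le_succ i).trans (h k hk)) (lin_mem_circleIdeal (fun p q hpq => ?_) hf)
    have e : p ∈ line w i ↔ q ∈ line w i := by
      change (p.2 : ℕ) = i ↔ (q.2 : ℕ) = i
      rcases arc_col hpq with e | ⟨k, hk, e1, e2⟩
      · rw [e]
      · have := h k hk
        rw [e1, e2, Fin.val_castSucc, Fin.val_succ]
        omega
    have := hpq.same
    tauto

/-- The relation `x_i = x_{i+1}` of a crossing with letter `i` becomes trivial under the
substitution, so such crossings may be dropped. Larger letters do not involve the line `i`. Since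
all variables are moved to the bottom, `t` has to be thin. -/
theorem subst_mem_circleIdeal {i : ℕ} {s t : Finset (Crossing w)} (ht : Thin t)
    (h : ∀ k ∈ s, (w.get k : ℕ) = i ∨ (i < (w.get k : ℕ) ∧ k ∈ t)) {f : Poly w}
    (hf : f ∈ circleIdeal w s) : subst w i f ∈ circleIdeal w t := by
  have hle : circleIdeal w s ≤ (circleIdeal w t).comap (subst w i) := by
    refine Ideal.span_le.2 ?_
    rintro _ (⟨p, rfl⟩ | ⟨p, q, hpq, rfl⟩)
    · change subst w i (X p ^ 2) ∈ circleIdeal w t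
      rw [map_pow]
      by_cases e : (p.2 : ℕ) = i
      · rw [subst_X_of_eq e]; exact X_sq_mem t _
      · rw [subst_X_of_ne e]; exact X_sq_mem t _
    · change subst w i (X p - X q) ∈ circleIdeal w t
      rw [map_sub]
      rcases arc_col hpq with e | ⟨k, hk, e1, e2⟩
      · by_cases e' : (p.2 : ℕ) = i
        · rw [subst_X_of_eq e', subst_X_of_eq (e ▸ e'), sub_self]; exact Ideal.zero_mem _
        · rw [subst_X_of_ne e', subst_X_of_ne (e ▸ e'), e, sub_self]; exact Ideal.zero_mem _
      · have h1 : (p.2 : ℕ) = w.get k := by rw [e1, Fin.val_castSucc]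
        have h2 : (q.2 : ℕ) = w.get k + 1 := by rw [e2, Fin.val_succ]
        rcases h k hk with h' | ⟨h', h''⟩
        · rw [subst_X_of_eq (h1.trans h'), subst_X_of_ne (by omega), ← y_val, h2, h', sub_self]
          exact Ideal.zero_mem _
        · rw [subst_X_of_ne (by omega), subst_X_of_ne (by omega)]
          exact X_sub_X_mem (ht.same_of_letter h'' e1 e2)
  exact hle hf

/-- The operator that eliminates the line `i` by means of a crossing with the letter `i`. -/
def elim (w : List (Fin m)) (i : ℕ) : Poly w →+ Poly w :=
  ((AddMonoidHom.mulLeft (prodDiff w i)).comp (top w i)).comp (subst w i).toRingHom.toAddMonoidHom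

theorem elim_apply (i : ℕ) (f : Poly w) : elim w i f = prodDiff w i * top w i (subst w i f) := rfl

/-- Hence `elim w i` descends to a map against the direction of an edge of the cube at a crossing
with letter `i`; the homotopies are built from such maps. -/
theorem elim_mem_circleIdeal {i : ℕ} {s t : Finset (Crossing w)} (ht : Thin t)
    (h : ∀ k ∈ s, (w.get k : ℕ) = i ∨ (i < (w.get k : ℕ) ∧ k ∈ t))
    (h' : ∀ k ∈ t, i ≤ (w.get k : ℕ)) {f : Poly w}
    (hf : f ∈ circleIdeal w s) : elim w i f ∈ circleIdeal w t :=
  Ideal.mul_mem_left _ _ (top_mem_circleIdeal h' (subst_mem_circleIdeal ht h hf))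

theorem elim_mem_polyGr (i : ℕ) {q : ℤ} {f : Poly w} (hf : f ∈ polyGr w q) :
    elim w i f ∈ polyGr w q := by
  rw [elim_apply, show q = -2 * i + (q + 2 * i) by ring]
  exact mul_mem_polyGr (prodDiff_mem_polyGr i) (top_mem_polyGr i (subst_mem_polyGr i hf))

theorem elim_y_mul {c i : ℕ} (hc : c ≤ m) (h : i < c) (f : Poly w) :
    elim w i (y w c * f) = y w c * elim w i f := by
  rw [elim_apply, elim_apply, map_mul, subst_y_ne hc h.ne', top_y_mul hc h.le, mul_left_comm]

/-! ### The telescoping decomposition of the identity -/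

theorem cls_X_eq_y {t : Finset (Crossing w)} (ht : Thin t) (p : Pt w) :
    cls w t (X p) = cls w t (y w p.2) := by
  rw [y_val]
  exact cls_X_eq (ht p)

theorem cls_y_sq (t : Finset (Crossing w)) (c : ℕ) : cls w t (y w c) * cls w t (y w c) = 0 :=
  cls_X_sq t _

/-- All variables of a line have the same class, and its square is zero, so the expansion to first
order is exact. -/
theorem cls_expand {t : Finset (Crossing w)} (ht : Thin t) (i : ℕ) (f : Poly w) :
    cls w t f = cls w t (const (line w i) f) + cls w t (y w i) * cls w t (lin (line w i) f) := by
  induction f using MvPolynomial.induction_on with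
  | C a => rw [const_C, lin_C, map_zero, mul_zero, add_zero]
  | add f g hf hg =>
    rw [map_add, map_add (const _), map_add (lin _), map_add, map_add, hf, hg]
    ring
  | mul_X f p hf =>
    rw [map_mul, hf, const_mul, lin_mul]
    by_cases e : p ∈ line w i
    · rw [const_X_of_mem e, lin_X_of_mem e, cls_X_eq_y ht, show (p.2 : ℕ) = i from e]
      simp only [mul_zero, map_zero, mul_one, add_zero]
      linear_combination cls w t (lin (line w i) f) * cls_y_sq t i
    · rw [const_X_of_notMem e, lin_X_of_notMem e]
      simp only [mul_zero, zero_add, map_mul]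
      ring

/-- The same expansion, evaluated at `x_{i+1}`, whose square is zero as well. -/
theorem cls_subst {t : Finset (Crossing w)} (ht : Thin t) (i : ℕ) (f : Poly w) :
    cls w t (subst w i f) =
      cls w t (const (line w i) f) + cls w t (y w (i + 1)) * cls w t (lin (line w i) f) := by
  induction f using MvPolynomial.induction_on with
  | C a =>
    have e : subst w i (C a) = C a := (subst w i).commutes a
    rw [e, const_C, lin_C, map_zero, mul_zero, add_zero]
  | add f g hf hg =>
    rw [map_add, map_add, map_add (const _), map_add (lin _), map_add, map_add, hf, hg]
    ring
  | mul_X f p hf =>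
    rw [map_mul, map_mul, hf, const_mul, lin_mul]
    by_cases e : p ∈ line w i
    · rw [const_X_of_mem e, lin_X_of_mem e, subst_X_of_eq e]
      simp only [mul_zero, map_zero, mul_one, add_zero]
      linear_combination cls w t (lin (line w i) f) * cls_y_sq t (i + 1)
    · rw [const_X_of_notMem e, lin_X_of_notMem e, subst_X_of_ne e, ← cls_X_eq (ht p)]
      simp only [mul_zero, zero_add, map_mul]
      ring

/-- The two expansions show that `f` and its substitution differ by `x_i - x_{i+1}` times the linear
part of `f`. This factor passes through `top w i` and turns `prodDiff w i` into `prodDiff w (i +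
1)`. -/
theorem cls_telescope_step {t : Finset (Crossing w)} (ht : Thin t) {i : ℕ} (hi : i < m)
    (h : ∀ k ∈ t, i ≤ (w.get k : ℕ)) (f : Poly w) :
    cls w t (prodDiff w i * top w i f) =
      cls w t (elim w i f) + cls w t (prodDiff w (i + 1) * top w (i + 1) f) := by
  have h1 : f - (subst w i f + (y w i * lin (line w i) f - y w (i + 1) * lin (line w i) f)) ∈
      circleIdeal w t := by
    rw [← Ideal.Quotient.eq]
    simp only [map_add, map_sub, map_mul]
    rw [cls_expand ht i f, cls_subst ht i f]
    ring
  have h2 := top_mem_circleIdeal h h1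
  rw [map_sub, map_add, map_sub, top_y_mul hi.le le_rfl, top_y_mul hi (by omega),
    ← Ideal.Quotient.eq] at h2
  rw [map_mul, h2, elim_apply, prodDiff_succ, top_succ]
  simp only [map_mul, map_add, map_sub]
  ring

theorem cls_telescope {t : Finset (Crossing w)} (ht : Thin t) {j : ℕ} (hj : j ≤ m)
    (h : ∀ k ∈ t, j ≤ (w.get k : ℕ)) (f : Poly w) :
    cls w t f = (∑ i ∈ Finset.range j, cls w t (elim w i f)) +
      cls w t (prodDiff w j * top w j f) := by
  induction j with
  | zero =>
    rw [Finset.sum_range_zero, zero_add]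
    change _ = cls w t (1 * f)
    rw [one_mul]
  | succ j ih =>
    rw [ih (by omega) fun k hk => (Nat.le_succ j).trans (h k hk),
      cls_telescope_step ht (by omega) fun k hk => (Nat.le_succ j).trans (h k hk),
      Finset.sum_range_succ, add_assoc]

/-- The product of differences vanishes if two of its lines are joined. -/
theorem cls_prodDiff_eq_zero {t : Finset (Crossing w)} (ht : Thin t) {k : Crossing w} (hk : k ∈ t)
    {i : ℕ} (h : (w.get k : ℕ) < i) : cls w t (prodDiff w i) = 0 := by
  have hd : y w (w.get k) - y w (w.get k + 1) ∣ prodDiff w i :=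
    Finset.dvd_prod_of_mem (fun c => y w c - y w (c + 1)) (Finset.mem_range.2 h)
  have hz : cls w t (y w (w.get k) - y w (w.get k + 1)) = 0 := by
    rw [map_sub, sub_eq_zero]
    have e1 := y_val (w := w) (w.get k).castSucc
    have e2 := y_val (w := w) (w.get k).succ
    rw [Fin.val_castSucc] at e1
    rw [Fin.val_succ] at e2
    rw [e1, e2]
    exact cls_X_eq (ht.same_of_letter hk rfl rfl)
  have := map_dvd (cls w t) hd
  rw [hz] at this
  exact zero_dvd_iff.1 this

/-! Two crossings with the same letter. -/

/-- The points on the circle between the crossings `a` and `b`. -/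
def inner (a b : Crossing w) : Set (Pt w) :=
  {p | (p.2 = (w.get a).castSucc ∨ p.2 = (w.get a).succ) ∧ a.castSucc < p.1 ∧ p.1 ≤ b.castSucc}

/-- The horizontal arcs at `a` and `b` close off the two lines between these crossings, and every
other crossing has its vertical smoothing, so no arc leaves this region. -/
theorem inner_arc {a b : Crossing w} (hab : a < b) (hw : w.get a = w.get b) {p q : Pt w}
    (h : Arc w (insert a {b}) p q) : p ∈ inner a b ↔ q ∈ inner a b := by
  have hab' : (a : ℕ) < b := hab
  -- A vertical step on one of the two lines changes membership only at the heights of `a` and `b`.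
  have hstep : ∀ (t : Crossing w) (j : Fin (m + 1)),
      (t = a ∨ t = b → j ≠ (w.get a).castSucc ∧ j ≠ (w.get a).succ) →
      (((t.castSucc, j) : Pt w) ∈ inner a b ↔ ((t.succ, j) : Pt w) ∈ inner a b) := by
    intro t j hj
    simp only [inner, Set.mem_ofPred_eq, Fin.lt_def, Fin.le_def, Fin.val_castSucc, Fin.val_succ]
    by_cases hta : (t : ℕ) = a
    · have := hj (Or.inl (Fin.ext hta)); tauto
    by_cases htb : (t : ℕ) = b
    · have := hj (Or.inr (Fin.ext htb)); tauto
    have h1 : (a : ℕ) < t ↔ (a : ℕ) < t + 1 := by omega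
    have h2 : (t : ℕ) ≤ b ↔ (t : ℕ) + 1 ≤ b := by omega
    rw [h1, h2]
  cases h with
  | close j =>
    simp only [inner, Set.mem_ofPred_eq, Fin.lt_def, Fin.le_def, Fin.val_castSucc, Fin.val_last,
      Fin.val_zero]
    have := b.2
    constructor <;> rintro ⟨_, _, _⟩ <;> omega
  | strand t j hl hr =>
    refine hstep t j ?_
    rintro (rfl | rfl)
    · exact ⟨hl, hr⟩
    · rw [hw]; exact ⟨hl, hr⟩
  | left t ht => exact hstep t _ fun e => absurd (by simpa using e) ht
  | right t ht => exact hstep t _ fun e => absurd (by simpa using e) ht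
  | bot t ht =>
    have : w.get t = w.get a := by
      rcases Finset.mem_insert.1 ht with rfl | e
      · rfl
      · rw [Finset.mem_singleton.1 e, hw]
    simp only [inner, Set.mem_ofPred_eq, botL, botR, this, true_or, or_true]
  | top t ht =>
    have : w.get t = w.get a := by
      rcases Finset.mem_insert.1 ht with rfl | e
      · rfl
      · rw [Finset.mem_singleton.1 e, hw]
    simp only [inner, Set.mem_ofPred_eq, topL, topR, this, true_or, or_true]

theorem inner_same {a b : Crossing w} (hab : a < b) (hw : w.get a = w.get b) {p q : Pt w}
    (h : sameCircle w (insert a {b}) p q) : p ∈ inner a b ↔ q ∈ inner a b :=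
  iff_of_eq (sameCircle_le (r := Setoid.ker fun p => p ∈ inner a b)
    (fun _ _ h => propext (inner_arc hab hw h)) h)

/-- Outside the inner circle the crossing `a` adds no relation to those of `b`, because both join
the same two lines. -/
theorem lin_inner_mem {a b : Crossing w} (hab : a < b) (hw : w.get a = w.get b) {f : Poly w}
    (hf : f ∈ circleIdeal w (insert a {b})) : lin (inner a b) f ∈ circleIdeal w {b} := by
  refine lin_mem_circleIdeal (fun p q h => ?_) hf
  have h1 := inner_arc hab hw h
  have h2 : sameCircle w {b} p q := by
    rcases arc_col h with e | ⟨k, hk, e1, e2⟩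
    · exact (thin_singleton b).same_of_col e
    · have : w.get k = w.get b := by
        rcases Finset.mem_insert.1 hk with rfl | e
        · exact hw
        · rw [Finset.mem_singleton.1 e]
      rw [this] at e1 e2
      exact (thin_singleton b).same_of_letter (Finset.mem_singleton_self b) e1 e2
  tauto

/-- The operator that removes the crossing `b`, if the earlier crossing `a` has the same letter. -/
def elimSame (a b : Crossing w) : Poly w →+ Poly w :=
  ((AddMonoidHom.mulLeft (prodDiff w (w.get b))).comp (top w (w.get b))).comp (lin (inner a b))

theorem elimSame_apply (a b : Crossing w) (f : Poly w) :
    elimSame a b f = prodDiff w (w.get b) * top w (w.get b) (lin (inner a b) f) := rfl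

theorem elimSame_mem_circleIdeal {a b : Crossing w} (hab : a < b) (hw : w.get a = w.get b)
    {f : Poly w} (hf : f ∈ circleIdeal w (insert a {b})) : elimSame a b f ∈ circleIdeal w {b} :=
  Ideal.mul_mem_left _ _ (top_mem_circleIdeal
    (fun k hk => by rw [Finset.mem_singleton.1 hk]) (lin_inner_mem hab hw hf))

theorem elimSame_mem_polyGr (a b : Crossing w) {q : ℤ} {f : Poly w} (hf : f ∈ polyGr w q) :
    elimSame a b f ∈ polyGr w (q + 2) := by
  rw [elimSame_apply, show q + 2 = -2 * (w.get b : ℕ) + (q + 2 + 2 * (w.get b : ℕ)) by ring]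
  exact mul_mem_polyGr (prodDiff_mem_polyGr _) (top_mem_polyGr _ (lin_mem_polyGr _ hf))

theorem bottom_notMem_inner (a b : Crossing w) (c : Fin (m + 1)) : ((0, c) : Pt w) ∉ inner a b :=
  fun h => absurd h.2.1 (Fin.not_lt_zero _)

theorem lin_inner_y_mul (a b : Crossing w) (c : ℕ) (f : Poly w) :
    lin (inner a b) (y w c * f) = y w c * lin (inner a b) f := by
  rw [lin_mul, y, lin_X_of_notMem (bottom_notMem_inner a b _),
    const_X_of_notMem (bottom_notMem_inner a b _), zero_mul, add_zero]

theorem elimSame_y_mul {a b : Crossing w} {c : ℕ} (hc : c ≤ m) (h : (w.get b : ℕ) ≤ c)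
    (f : Poly w) : elimSame a b (y w c * f) = y w c * elimSame a b f := by
  rw [elimSame_apply, elimSame_apply, lin_inner_y_mul, top_y_mul hc h, mul_left_comm]

/-- Moving all variables to the bottom. -/
def collapse (w : List (Fin m)) : Poly w →ₐ[ℤ] Poly w := aeval fun p => X (0, p.2)

theorem collapse_X (p : Pt w) : collapse w (X p) = X (0, p.2) := by simp [collapse]

theorem cls_collapse {t : Finset (Crossing w)} (ht : Thin t) (f : Poly w) :
    cls w t (collapse w f) = cls w t f := by
  induction f using MvPolynomial.induction_on with
  | C a => rw [show collapse w (C a) = C a from (collapse w).commutes a]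
  | add f g hf hg => rw [map_add, map_add, map_add, hf, hg]
  | mul_X f p hf => rw [map_mul, map_mul, map_mul, hf, collapse_X, ← cls_X_eq (ht p)]

/-- No point at height `0` lies on the inner circle. -/
theorem inner_collapse (a b : Crossing w) (f : Poly w) :
    const (inner a b) (collapse w f) = collapse w f ∧ lin (inner a b) (collapse w f) = 0 := by
  induction f using MvPolynomial.induction_on with
  | C x => rw [show collapse w (C x) = C x from (collapse w).commutes x]; exact ⟨const_C _ _, lin_C _ _⟩
  | add f g hf hg => rw [map_add, map_add, map_add, hf.1, hf.2, hg.1, hg.2]; simp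
  | mul_X f p hf =>
    rw [map_mul, collapse_X, const_mul, lin_mul, hf.1, hf.2,
      lin_X_of_notMem (bottom_notMem_inner a b _), const_X_of_notMem (bottom_notMem_inner a b _)]
    simp

end StateOperators

/-! ### Circles of small smoothings and the coboundary in low degrees -/

section LowDegrees

open MvPolynomial

variable {m : ℕ} {w : List (Fin m)}

theorem in_cols (k : Crossing w) :
    (((inU k).2 : ℕ) = w.get k ∧ ((inD k).2 : ℕ) = w.get k + 1) ∨
      (((inU k).2 : ℕ) = w.get k + 1 ∧ ((inD k).2 : ℕ) = w.get k) := by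
  unfold inU inD
  split_ifs
  · exact Or.inl ⟨Fin.val_castSucc _, Fin.val_succ _⟩
  · exact Or.inr ⟨Fin.val_succ _, Fin.val_castSucc _⟩

/-- Lines are only joined by crossings with the corresponding letter. -/
theorem not_same_in {s : Finset (Crossing w)} {i : ℕ} (hs : ∀ l ∈ s, (w.get l : ℕ) = i)
    {k : Crossing w} (hk : (w.get k : ℕ) ≠ i) : ¬ sameCircle w s (inU k) (inD k) := by
  intro h
  -- The invariant is the number of the line, with `i` renamed to `i + 1`. It is constant along
  -- arcs, and it separates the lines `j` and `j + 1` for every `j ≠ i`.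
  have := sameCircle_le (r := Setoid.ker fun p : Pt w => if (p.2 : ℕ) = i then i + 1 else (p.2 : ℕ))
    (fun p q h => ?_) h
  · change (if ((inU k).2 : ℕ) = i then i + 1 else ((inU k).2 : ℕ)) =
      (if ((inD k).2 : ℕ) = i then i + 1 else ((inD k).2 : ℕ)) at this
    rcases in_cols k with ⟨h1, h2⟩ | ⟨h1, h2⟩ <;> rw [h1, h2] at this <;>
      split_ifs at this <;> omega
  · change (if (p.2 : ℕ) = i then i + 1 else (p.2 : ℕ)) = (if (q.2 : ℕ) = i then i + 1 else (q.2 : ℕ))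
    rcases arc_col h with e | ⟨l, hl, e1, e2⟩
    · rw [e]
    · have := hs l hl
      rw [e1, e2, Fin.val_castSucc, Fin.val_succ]
      split_ifs <;> omega

theorem saddle_eq_one {s t : Finset (Crossing w)} {k : Crossing w} (hk : k ∉ s)
    (ht : insert k s = t) (h : ¬ sameCircle w s (inU k) (inD k)) : saddle t k = 1 := by
  subst ht
  exact saddle_pos (Finset.mem_insert_self _ _) ((same_in_insert hk).2 h)

theorem not_same_empty (k : Crossing w) : ¬ sameCircle w ∅ (inU k) (inD k) :=
  -- As the smoothing is empty, any number different from the letter of `k` would do.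
  not_same_in (i := w.get k + 1) (by simp) (by omega)

theorem numCircles_empty : numCircles w ∅ = m + 1 := by
  have e : Quotient (sameCircle w ∅) ≃ Fin (m + 1) :=
    { toFun := Quotient.lift (fun p => p.2) fun p q h =>
        sameCircle_le (r := Setoid.ker fun p : Pt w => p.2)
          (fun p q h => (arc_col h).elim id fun ⟨k, hk, _⟩ => absurd hk (Finset.notMem_empty k)) h
      invFun := fun c => Quotient.mk _ (0, c)
      left_inv := fun x => by
        induction x using Quotient.inductionOn with | _ p
        exact Quotient.sound ((sameCircle w ∅).symm (thin_empty p))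
      right_inv := fun c => rfl }
  rw [numCircles, Nat.card_congr e, Nat.card_fin]

theorem numCircles_singleton (k : Crossing w) : numCircles w {k} + 1 = numCircles w ∅ := by
  have h := (same_in_insert (Finset.notMem_empty k)).2 (not_same_empty k)
  exact (numCircles_merge (Finset.notMem_empty k) h).symm

/-- The class of a polynomial, as an element of a vertex of the cube. -/
def vcls (u v : Fin (m + 1)) (s : Finset (Crossing w)) : Poly w →+ vertex w u v s :=
  (cls w s).toAddMonoidHom

theorem vcls_surjective (u v : Fin (m + 1)) (s : Finset (Crossing w)) :
    Function.Surjective (vcls u v s) :=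
  Ideal.Quotient.mk_surjective (I := circleIdeal w s)

theorem vcls_congr (u v : Fin (m + 1)) {s : Finset (Crossing w)} {f g : Poly w}
    (h : cls w s f = cls w s g) : vcls u v s f = vcls u v s g := h

theorem edge_vcls (u v : Fin (m + 1)) {s t : Finset (Crossing w)} {k : Crossing w} (hk : k ∉ s)
    (ht : insert k s = t) (f : Poly w) :
    GrBimod.toLin (edge u v hk ht) (vcls u v s f) = vcls u v t (saddle t k * f) := rfl

/-- The source of an edge is recovered from `t` and `k` by erasing `k`, so only one summand
survives. -/
theorem sum_edgeAt_apply (u v : Fin (m + 1)) {i : ℕ} {s t : Finset (Crossing w)} {k : Crossing w}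
    (hk : k ∉ s) (ht : insert k s = t) (hs : s.card = i)
    (x : ∀ s : {s : Finset (Crossing w) // s.card = i}, vertex w u v s.1) :
    ∑ r : {s : Finset (Crossing w) // s.card = i}, GrBimod.toLin (edgeAt u v k r.1 t) (x r) =
      edgeSign s k • GrBimod.toLin (edge u v hk ht) (x ⟨s, hs⟩) := by
  rw [Finset.sum_eq_single_of_mem (⟨s, hs⟩ : {s : Finset (Crossing w) // s.card = i})
    (Finset.mem_univ _)]
  · rw [edgeAt, dif_pos ⟨hk, ht⟩]
    rfl
  · intro r _ hr
    have : edgeAt u v k r.1 t = 0 := by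
      refine dif_neg fun h => hr (Subtype.ext ?_)
      rw [← Finset.erase_insert h.1, h.2, ← ht, Finset.erase_insert hk]
    rw [this]
    rfl

theorem edgeAt_of_notMem (u v : Fin (m + 1)) {s t : Finset (Crossing w)} {k : Crossing w}
    (hk : k ∉ t) : edgeAt u v k s t = 0 :=
  dif_neg fun h : k ∉ s ∧ insert k s = t => hk (h.2 ▸ Finset.mem_insert_self _ _)

/-- The coboundary of the Khovanov complex, component by component. -/
theorem khovanov_d_apply (u v : Fin (m + 1)) {i : ℕ}
    (x : ∀ s : {s : Finset (Crossing w) // s.card = i}, vertex w u v s.1)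
    (t : {s : Finset (Crossing w) // s.card = i + 1}) :
    (GrBimod.toLin ((khovanovComplex w u v).d i (i + 1)) x :
      ∀ s : {s : Finset (Crossing w) // s.card = i + 1}, vertex w u v s.1) t =
      ∑ k ∈ t.1, ∑ r : {s : Finset (Crossing w) // s.card = i},
        GrBimod.toLin (edgeAt u v k r.1 t.1) (x r) := by
  have e : (khovanovComplex w u v).d i (i + 1) =
      GrBimod.matrix fun s t => cubeMap u v s.1 t.1 :=
    CochainComplex.of_d
      (fun i => GrBimod.pi fun s : {s : Finset (Crossing w) // s.card = i} => vertex w u v s.1)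
      (fun _ => GrBimod.matrix fun s t => cubeMap u v s.1 t.1) i
  rw [e]
  refine (GrBimod.matrix_apply _ x t).trans ?_
  have h1 : ∀ r : {s : Finset (Crossing w) // s.card = i},
      GrBimod.toLin (cubeMap u v r.1 t.1) (x r) =
        ∑ k ∈ t.1, GrBimod.toLin (edgeAt u v k r.1 t.1) (x r) := by
    intro r
    rw [cubeMap, GrBimod.toLin_sum]
    refine (Finset.sum_subset (Finset.subset_univ _) fun k _ hk => ?_).symm
    rw [edgeAt_of_notMem u v hk]
    rfl
  rw [Finset.sum_congr rfl fun r _ => h1 r]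
  exact Finset.sum_comm

/-- The smoothing without `1`-smoothed crossings. -/
def noCrossing (w : List (Fin m)) : {s : Finset (Crossing w) // s.card = 0} := ⟨∅, rfl⟩

/-- The smoothing with one `1`-smoothed crossing. -/
def oneCrossing (k : Crossing w) : {s : Finset (Crossing w) // s.card = 1} :=
  ⟨{k}, Finset.card_singleton k⟩

theorem eq_noCrossing (s : {s : Finset (Crossing w) // s.card = 0}) : s = noCrossing w :=
  Subtype.ext (Finset.card_eq_zero.1 s.2)

theorem exists_oneCrossing (s : {s : Finset (Crossing w) // s.card = 1}) : ∃ k, s = oneCrossing k :=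
  (Finset.card_eq_one.1 s.2).imp fun _ h => Subtype.ext h

theorem edgeSign_empty (k : Crossing w) : edgeSign ∅ k = 1 := by simp [edgeSign]

/-- All edges out of the empty smoothing are merges with sign `1`, so the representing polynomial
does not change. -/
theorem khovanov_d_oneCrossing (u v : Fin (m + 1))
    (x : ∀ s : {s : Finset (Crossing w) // s.card = 0}, vertex w u v s.1) {f : Poly w}
    (hf : x (noCrossing w) = vcls u v ∅ f) (k : Crossing w) :
    (GrBimod.toLin ((khovanovComplex w u v).d 0 1) x :
      ∀ s : {s : Finset (Crossing w) // s.card = 1}, vertex w u v s.1) (oneCrossing k) =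
      vcls u v {k} f := by
  rw [khovanov_d_apply u v x (oneCrossing k)]
  have h : (insert k ∅ : Finset (Crossing w)) = (oneCrossing k).1 := rfl
  refine (Finset.sum_singleton _ _).trans ?_
  refine (sum_edgeAt_apply u v (Finset.notMem_empty k) h rfl x).trans ?_
  rw [edgeSign_empty, one_smul]
  refine (congrArg _ hf).trans ?_
  refine (edge_vcls u v _ h f).trans ?_
  rw [saddle_eq_one (Finset.notMem_empty k) h (not_same_empty k), one_mul]
  rfl

/-- The two edges from single crossings into a pair carry opposite signs, as the edges from the
empty smoothing have sign `1` and the square anticommutes. -/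
theorem khovanov_d_pair (u v : Fin (m + 1))
    (x : ∀ s : {s : Finset (Crossing w) // s.card = 1}, vertex w u v s.1) {F : Crossing w → Poly w}
    (hF : ∀ k, x (oneCrossing k) = vcls u v {k} (F k)) {a b : Crossing w} (hab : a ≠ b)
    (t : {s : Finset (Crossing w) // s.card = 2}) (ht : insert a {b} = t.1) :
    (GrBimod.toLin ((khovanovComplex w u v).d 1 2) x :
      ∀ s : {s : Finset (Crossing w) // s.card = 2}, vertex w u v s.1) t =
      edgeSign {b} a • vcls u v t.1 (saddle t.1 a * F b - saddle t.1 b * F a) := by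
  rw [khovanov_d_apply u v x t]
  have h1 : a ∉ ({b} : Finset (Crossing w)) := by simpa using hab
  have h2 : b ∉ ({a} : Finset (Crossing w)) := by simpa using hab.symm
  have ht' : insert b {a} = t.1 := by rw [← ht, Finset.pair_comm]
  have hsign : edgeSign {a} b = - edgeSign {b} a := by
    have := edgeSign_anti (Finset.notMem_empty a) (Finset.notMem_empty b) hab
    rw [edgeSign_empty, edgeSign_empty, one_mul, one_mul] at this
    exact eq_neg_of_add_eq_zero_left this
  have h3 : ∀ {A : Type} [AddCommGroup A] (g : Crossing w → A), ∑ k ∈ t.1, g k = g a + g b := by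
    intro A _ g
    rw [← ht, Finset.sum_insert h1, Finset.sum_singleton]
  rw [h3, sum_edgeAt_apply u v h1 ht (Finset.card_singleton b),
    sum_edgeAt_apply u v h2 ht' (Finset.card_singleton a), hsign, neg_smul, ← sub_eq_add_neg,
    ← smul_sub, map_sub]
  exact congrArg _ (congrArg₂ (· - ·) (congrArg _ (hF b)) (congrArg _ (hF a)))

/-! Morphisms that are induced by operators on polynomials. -/

/-- The map of state rings induced by an operator on polynomials. -/
def stateMap {s t : Finset (Crossing w)} (g : Poly w →+ Poly w)
    (hg : ∀ f ∈ circleIdeal w s, g f ∈ circleIdeal w t) : StateRing w s →+ StateRing w t :=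
  QuotientAddGroup.map (circleIdeal w s).toAddSubgroup (circleIdeal w t).toAddSubgroup g hg

theorem XL_smul_vcls (u v : Fin (m + 1)) (s : Finset (Crossing w)) (f : Poly w) :
    XL • vcls u v s f = vcls u v s (y w u * f) := by
  change actHom w u v s XL * cls w s f = cls w s (y w u * f)
  rw [actHom_XL, y_val, map_mul]

theorem XR_smul_vcls (u v : Fin (m + 1)) (s : Finset (Crossing w)) (f : Poly w) :
    XR • vcls u v s f = vcls u v s (y w v * f) := by
  change actHom w u v s XR * cls w s f = cls w s (y w v * f)
  rw [actHom_XR, y_val, map_mul]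

/-- The morphism of vertices induced by an operator on polynomials. -/
def vertexMap (u v : Fin (m + 1)) {s t : Finset (Crossing w)} (g : Poly w →+ Poly w)
    (hg : ∀ f ∈ circleIdeal w s, g f ∈ circleIdeal w t) (hu : ∀ f, g (y w u * f) = y w u * g f)
    (hv : ∀ f, g (y w v * f) = y w v * g f) (d : ℤ)
    (hd : ∀ q f, f ∈ polyGr w q → g f ∈ polyGr w (q + d))
    (hst : (numCircles w s + s.card : ℤ) = numCircles w t + t.card + d) :
    vertex w u v s ⟶ vertex w u v t :=
  GrBimod.ofAdd (M := vertex w u v s) (N := vertex w u v t) (stateMap g hg)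
    (fun x => by
      obtain ⟨f, rfl⟩ := vcls_surjective u v s x
      refine (congrArg _ (XL_smul_vcls u v s f)).trans
        (Eq.trans ?_ (XL_smul_vcls u v t (g f)).symm)
      rw [← hu]
      rfl)
    (fun x => by
      obtain ⟨f, rfl⟩ := vcls_surjective u v s x
      refine (congrArg _ (XR_smul_vcls u v s f)).trans
        (Eq.trans ?_ (XR_smul_vcls u v t (g f)).symm)
      rw [← hv]
      rfl)
    (by
      rintro q _ ⟨f, hf, rfl⟩
      refine ⟨g f, ?_, rfl⟩
      have h := hd _ f hf
      rwa [show q - (numCircles w s + s.card + w.length : ℤ) + d =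
        q - (numCircles w t + t.card + w.length) by linarith] at h)

/-- The ring of a smoothing is finitely generated as an abelian group. -/
theorem finite_vertex (u v : Fin (m + 1)) (s : Finset (Crossing w)) :
    Module.Finite RR (vertex w u v s) := by
  -- The ring is generated by finitely many elements of square zero, hence integral and of finite
  -- type over `ℤ`.
  have h1 : Algebra.IsIntegral ℤ (StateRing w s) := by
    have hX : ∀ p : Pt w, IsIntegral ℤ (cls w s (X p)) := fun p =>
      IsIntegral.of_pow (n := 2) (by norm_num) (by
        rw [pow_two, cls_X_sq]; exact isIntegral_zero)
    refine ⟨fun x => ?_⟩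
    obtain ⟨f, rfl⟩ := Ideal.Quotient.mk_surjective (I := circleIdeal w s) x
    induction f using MvPolynomial.induction_on with
    | C a => exact isIntegral_algebraMap (R := ℤ) (x := a)
    | add f g hf hg => rw [map_add]; exact hf.add hg
    | mul_X f p hf => rw [map_mul]; exact hf.mul (hX p)
  have h2 : Algebra.FiniteType ℤ (StateRing w s) := inferInstance
  have h3 : Module.Finite ℤ (StateRing w s) := Algebra.IsIntegral.finite
  have h4 : Module.Finite ℤ (vertex w u v s) := h3
  exact Module.Finite.of_restrictScalars_finite ℤ RR _

end LowDegrees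

/-! ### Maps between `E` and graded bimodules -/

theorem XL_mul_XL : XL * XL = 0 := by
  simp [XL]

theorem XR_mul_XR : XR * XR = 0 := by
  simp [XR]

theorem mulLin_XL_mul (c : RR) : mulLin (XL * c) = DualNumber.eps * mulLin c := by
  simp [mulLin, XL]

theorem mulLin_XR_mul (c : RR) : mulLin (XR * c) = DualNumber.eps * mulLin c := by
  simp [mulLin, XR]

theorem XL_smul_R (c : R) : (XL • c : R) = DualNumber.eps * c := by
  simp [smul_R_def, XL]

theorem XR_smul_R (c : R) : (XR • c : R) = DualNumber.eps * c := by
  simp [smul_R_def, XR]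

theorem mulLin_tmul_one (r : R) : mulLin (r ⊗ₜ[ℤ] (1 : R)) = r := by
  simp [mulLin]

theorem mulLin_eq_smul (c : RR) : mulLin c = (c • (1 : R) : R) := by
  rw [smul_R_def, mul_one]; rfl

theorem tmul_one_mem_grRR (i : Fin 2) :
    (basisR i ⊗ₜ[ℤ] (1 : R) : RR) ∈ grRR.gr (degR i + 1) := by
  change _ ∈ Submodule.span ℤ
    ((basisR.tensorProduct basisR) '' {j | degR j.1 + degR j.2 = degR i + 1})
  refine Submodule.subset_span ⟨(i, 0), ?_, ?_⟩
  · simp [degR]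
  · simp [basisR_zero]

theorem one_mem_grRR : (1 : RR) ∈ grRR.gr 2 := by
  have h := tmul_one_mem_grRR 0
  rwa [basisR_zero, ← Algebra.TensorProduct.one_def] at h

namespace GrBimod

variable {M : GrBimod}

/-- It suffices to check the basis `1`, `XL`, `XR`, `XL * XR` of `R ⊗ R`. The `2` is the degree of
`1 ⊗ 1`. -/
theorem smul_mem_gr {z : M} {q₀ : ℤ} (hz : z ∈ M.gr (q₀ + 2)) {q : ℤ} {b : RR}
    (hb : b ∈ grRR.gr q) : b • z ∈ M.gr (q + q₀) := by
  have hL := M.left_mem _ _ hz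
  have hR := M.right_mem _ _ hz
  have hLR := M.left_mem _ _ hR
  refine map_mem_of_mem_span (LinearMap.toSpanSingleton RR M z).toAddMonoidHom (fun x h => ?_) hb
  obtain ⟨⟨i, j⟩, hi, rfl⟩ := h
  change (basisR.tensorProduct basisR (i, j)) • z ∈ M.gr (q + q₀)
  change degR i + degR j = q at hi
  subst hi
  rw [Module.Basis.tensorProduct_apply]
  fin_cases i <;> fin_cases j
  · convert hz using 1
    · simp [degR]; congr 1; ring
    · simp [basisR_zero, ← Algebra.TensorProduct.one_def]
  · convert hR using 1
    · simp [degR]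
    · simp [basisR_zero, basisR_one, XR]
  · convert hL using 1
    · simp [degR]
    · simp [basisR_zero, basisR_one, XL]
  · convert hLR using 1
    · simp [degR]; congr 1; ring
    · rw [← mul_smul]; simp [basisR_one, XL, XR]

/-- The morphism from a shift of `R ⊗ R` given by the image of `1`. -/
def fromRR (z : M) (K : ℤ) (hz : z ∈ M.gr (K + 2)) : twist K grRR ⟶ M :=
  ofLin (M := twist K grRR) (N := M) (LinearMap.toSpanSingleton RR M z) fun q x hx => by
    have := smul_mem_gr hz hx
    rwa [sub_add_cancel] at this

/-- The map from `R` given by the image of `1`. -/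
def fromRAdd (z : M) : R →+ M where
  toFun r := (r ⊗ₜ[ℤ] (1 : R) : RR) • z
  map_zero' := by rw [TensorProduct.zero_tmul]; exact zero_smul RR z
  map_add' a b := by rw [TensorProduct.add_tmul]; exact add_smul _ _ z

theorem fromRAdd_apply (z : M) (r : R) : fromRAdd z r = (r ⊗ₜ[ℤ] (1 : R) : RR) • z := rfl

theorem fromRAdd_XL (z : M) (r : R) : fromRAdd z (XL • r) = XL • fromRAdd z r := by
  rw [fromRAdd_apply, fromRAdd_apply, ← mul_smul, XL_smul_R]
  simp [XL]

/-- Both actions of `X` on `R` agree, so the image of `1` has to satisfy the same relation. -/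
theorem fromRAdd_XR (z : M) (h : XL • z = XR • z) (r : R) :
    fromRAdd z (XR • r) = XR • fromRAdd z r := by
  have e : (XR • r : R) = XL • r := by rw [XL_smul_R, XR_smul_R]
  rw [e, fromRAdd_XL, fromRAdd_apply, ← mul_smul, mul_comm, mul_smul, h, ← mul_smul, mul_comm,
    mul_smul]

theorem fromRAdd_mulLin (z : M) (h : XL • z = XR • z) (c : RR) :
    fromRAdd z (mulLin c) = c • z := by
  rw [mulLin_eq_smul, map_smul_of_X (fromRAdd z) (fromRAdd_XL z) (fromRAdd_XR z h), fromRAdd_apply,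
    ← Algebra.TensorProduct.one_def, one_smul]

/-- The morphism from a shift of `R` given by the image of `1`. -/
def fromR (z : M) (h : XL • z = XR • z) (K : ℤ) (hz : z ∈ M.gr (K + 2)) :
    twist K (twist 1 grR) ⟶ M :=
  ofAdd (M := twist K (twist 1 grR)) (N := M) (fromRAdd z) (fromRAdd_XL z) (fromRAdd_XR z h) (by
    intro q x hx
    change x ∈ Submodule.span ℤ (basisR '' {i | degR i = q - K - 1}) at hx
    refine map_mem_of_mem_span (fromRAdd z) (fun x h => ?_) hx
    obtain ⟨i, hi, rfl⟩ := h
    change degR i = q - K - 1 at hi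
    have hb : (basisR i ⊗ₜ[ℤ] (1 : R) : RR) ∈ grRR.gr (q - K) := by
      have := tmul_one_mem_grRR i
      rwa [hi, sub_add_cancel] at this
    have := smul_mem_gr hz hb
    rwa [sub_add_cancel] at this)

end GrBimod

section E

theorem isZero_grZero : IsZero grZero :=
  have : Subsingleton grZero := inferInstanceAs (Subsingleton (∀ _ : Empty, _))
  GrBimod.isZero_of_subsingleton _

theorem shift_E_isZero (K : ℤ) (i : ℕ) : IsZero ((shift K E).X (i + 2)) :=
  (GrBimod.twistFunctor K).map_isZero isZero_grZero

theorem shift_E_d (K : ℤ) : (shift K E).d 0 1 = (GrBimod.twistFunctor K).map mu :=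
  congrArg (fun f : grRR ⟶ GrBimod.twist 1 grR => (GrBimod.twistFunctor K).map f)
    (CochainComplex.of_d EX Ed 0)

theorem shift_E_d_apply (K : ℤ) (b : RR) : GrBimod.toLin ((shift K E).d 0 1) b = mulLin b := by
  rw [shift_E_d]; rfl

/-- Multiplication is surjective, since `r` is the image of `r ⊗ 1`. -/
theorem shift_E_epi (K : ℤ) : Epi ((shift K E).d 0 1) where
  left_cancellation {N} f g h := by
    refine GrBimod.hom_ext fun (r : R) => ?_
    have h1 : GrBimod.toLin ((shift K E).d 0 1) (r ⊗ₜ[ℤ] (1 : R) : RR) = r :=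
      (shift_E_d_apply K _).trans (mulLin_tmul_one r)
    have h2 := congrArg (fun f => GrBimod.toLin f (r ⊗ₜ[ℤ] (1 : R) : RR)) h
    exact (congrArg (GrBimod.toLin f) h1).symm.trans (h2.trans (congrArg (GrBimod.toLin g) h1))

end E

/-! ### The projection to `E` -/

section Projection

open MvPolynomial

variable {m : ℕ} {w : List (Fin m)}

/-- The ring map to `R ⊗ R` that sends the variables of the lines up to `e` to `± X ⊗ 1`, and
those of the last line to `1 ⊗ X`. -/
def kappa (w : List (Fin m)) (e : ℕ) : Poly w →ₐ[ℤ] RR :=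
  aeval fun p => if (p.2 : ℕ) ≤ e then (-1 : ℤ) ^ (e + p.2) • XL else XR

theorem kappa_X_of_le {e : ℕ} {p : Pt w} (h : (p.2 : ℕ) ≤ e) :
    kappa w e (X p) = (-1 : ℤ) ^ (e + p.2) • XL := by
  simp [kappa, h]

theorem kappa_X_of_gt {e : ℕ} {p : Pt w} (h : ¬ (p.2 : ℕ) ≤ e) : kappa w e (X p) = XR := by
  simp [kappa, h]

theorem kappa_y_self {e : ℕ} (h : e < m) : kappa w e (y w e) = XL := by
  rw [y, kappa_X_of_le (by rw [ofNat_val h.le]), ofNat_val h.le, ← two_mul, pow_mul]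
  simp

theorem kappa_y_succ {e : ℕ} (h : e < m) : kappa w e (y w (e + 1)) = XR :=
  kappa_X_of_gt (by rw [ofNat_val h]; omega)

/-- Arcs of the empty smoothing stay on one line, `kappa` sees only the line of a variable, and `XL`
and `XR` have square zero. -/
theorem kappa_eq_zero (e : ℕ) {f : Poly w} (hf : f ∈ circleIdeal w ∅) : kappa w e f = 0 := by
  have hle : circleIdeal w ∅ ≤ RingHom.ker (kappa w e) := by
    refine Ideal.span_le.2 ?_
    rintro _ (⟨p, rfl⟩ | ⟨p, q, hpq, rfl⟩)
    · change kappa w e (X p ^ 2) = 0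
      rw [map_pow, pow_two]
      by_cases h : (p.2 : ℕ) ≤ e
      · rw [kappa_X_of_le h, smul_mul_smul_comm, XL_mul_XL, smul_zero]
      · rw [kappa_X_of_gt h, XR_mul_XR]
    · change kappa w e (X p - X q) = 0
      have hc : p.2 = q.2 :=
        (arc_col hpq).elim id fun ⟨k, hk, _⟩ => absurd hk (Finset.notMem_empty k)
      rw [map_sub, sub_eq_zero]
      by_cases h : (p.2 : ℕ) ≤ e
      · rw [kappa_X_of_le h, kappa_X_of_le (hc ▸ h), hc]
      · rw [kappa_X_of_gt h, kappa_X_of_gt (hc ▸ h)]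
  exact hle hf

theorem kappa_mem_gr (e : ℕ) {q : ℤ} {f : Poly w} (hf : f ∈ polyGr w q) :
    kappa w e f ∈ grRR.gr (q + 2) := by
  refine mem_of_mem_polyGr (N := RR) (kappa w e).toRingHom.toAddMonoidHom
    (fun q => grRR.gr (q + 2)) ?_ ?_ hf
  · change kappa w e 1 ∈ grRR.gr (0 + 2)
    rw [map_one]
    exact one_mem_grRR
  · intro q f p h
    change kappa w e f ∈ grRR.gr (q + 2) at h
    change kappa w e (f * X p) ∈ grRR.gr (q - 2 + 2)
    rw [map_mul, mul_comm, sub_add_eq_add_sub]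
    by_cases hp : (p.2 : ℕ) ≤ e
    · rw [kappa_X_of_le hp, smul_mul_assoc]
      exact Submodule.smul_mem _ _ (grRR.left_mem _ _ h)
    · rw [kappa_X_of_gt hp]
      exact grRR.right_mem _ _ h

/-- From `(x_c + x_{c+1})(x_c - x_{c+1}) = 0` it follows that `x_c` acts on `prodDiff w e` as
`-x_{c+1}` for `c < e`. Moving from `c` to `e` produces the sign. -/
theorem cls_y_mul_prodDiff (t : Finset (Crossing w)) {c e : ℕ} (h : c ≤ e) :
    cls w t (y w c * prodDiff w e) = (-1 : ℤ) ^ (e + c) • cls w t (y w e * prodDiff w e) := by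
  induction h using Nat.decreasingInduction with
  | self => rw [← two_mul, pow_mul]; simp
  | of_succ c hc ih =>
    obtain ⟨r, hr⟩ := Finset.dvd_prod_of_mem (fun c => y w c - y w (c + 1)) (Finset.mem_range.2 hc)
    have e1 : cls w t (y w c * prodDiff w e) = - cls w t (y w (c + 1) * prodDiff w e) := by
      change prodDiff w e = _ at hr
      rw [hr]
      simp only [map_mul, map_sub]
      linear_combination cls w t r * cls_y_sq t c - cls w t r * cls_y_sq t (c + 1)
    rw [e1, ih, ← add_assoc, pow_succ, mul_neg_one, neg_smul, neg_neg]

/-- Multiplication by the product of differences factors through `R ⊗ R`. -/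
theorem vcls_mul_prodDiff {t : Finset (Crossing w)} (ht : Thin t) {e : Fin m} (he : (e : ℕ) + 1 = m)
    (f : Poly w) :
    vcls e.castSucc e.succ t (f * prodDiff w e) =
      kappa w e f • vcls e.castSucc e.succ t (prodDiff w e) := by
  induction f using MvPolynomial.induction_on with
  | C a =>
    have h1 : kappa w e (C a) = a • (1 : RR) := by
      rw [show kappa w e (C a) = algebraMap ℤ RR a from (kappa w e).commutes a,
        Algebra.algebraMap_eq_smul_one]
    have h2 : (C a * prodDiff w e : Poly w) = a • prodDiff w e := by
      rw [← MvPolynomial.smul_eq_C_mul]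
    rw [h1, h2, map_zsmul, smul_assoc, one_smul]
  | add f g hf hg => rw [add_mul, map_add, hf, hg, map_add, add_smul]
  | mul_X f p hf =>
    rw [map_mul (kappa w e), mul_comm (kappa w e f), mul_smul, ← hf]
    have h0 : cls w t (f * X p * prodDiff w e) = cls w t f * cls w t (y w p.2 * prodDiff w e) := by
      rw [map_mul, map_mul, map_mul, cls_X_eq_y ht]
      ring
    by_cases hp : (p.2 : ℕ) ≤ e
    · rw [kappa_X_of_le hp, smul_assoc, XL_smul_vcls, ← map_zsmul]
      refine vcls_congr _ _ ?_
      rw [h0, cls_y_mul_prodDiff t hp, map_zsmul, Fin.val_castSucc, mul_smul_comm, ← map_mul]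
      congr 2
      ring
    · rw [kappa_X_of_gt hp, XR_smul_vcls]
      refine vcls_congr _ _ ?_
      -- Since `e + 1 = m`, the line `e + 1` is the only one beyond `e`.
      have : (p.2 : ℕ) = e.succ := by rw [Fin.val_succ]; omega
      rw [h0, this, ← map_mul]
      congr 1
      ring

/-- The morphism from a vertex that is given by an operator on polynomials. -/
def fromVertex (u v : Fin (m + 1)) (s : Finset (Crossing w)) {N : GrBimod} (g : Poly w →+ N)
    (hg : ∀ f ∈ circleIdeal w s, g f = 0) (hL : ∀ f, g (y w u * f) = XL • g f)
    (hR : ∀ f, g (y w v * f) = XR • g f)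
    (hd : ∀ q f, f ∈ polyGr w q → g f ∈ N.gr (q + (numCircles w s + s.card + w.length))) :
    vertex w u v s ⟶ N :=
  GrBimod.ofAdd (M := vertex w u v s) (N := N)
    (QuotientAddGroup.lift (circleIdeal w s).toAddSubgroup g hg)
    (fun x => by
      obtain ⟨f, rfl⟩ := vcls_surjective u v s x
      exact (congrArg _ (XL_smul_vcls u v s f)).trans (hL f))
    (fun x => by
      obtain ⟨f, rfl⟩ := vcls_surjective u v s x
      exact (congrArg _ (XR_smul_vcls u v s f)).trans (hR f))
    (by
      rintro q _ ⟨f, hf, rfl⟩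
      have h := hd _ f hf
      rwa [sub_add_cancel] at h)

end Projection

/-! ### The low degree part of the Khovanov complex -/

section Reduction

open MvPolynomial

variable {m : ℕ} {w : List (Fin m)}

/-- A choice of the first crossing of each letter, and of the last letter. -/
structure Firsts (w : List (Fin m)) where
  last : Fin m
  last_eq : (last : ℕ) + 1 = m
  first : Fin m → Crossing w
  get_first : ∀ i, w.get (first i) = i
  first_le : ∀ l, first (w.get l) ≤ l

/-- Crossings with larger letters do not touch the line numbered by the letter of `k`, so lying on
this line is constant along circles. -/
theorem not_same_of_lt {t : Finset (Crossing w)} {k : Crossing w}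
    (h : ∀ l ∈ t, (w.get k : ℕ) < w.get l) : ¬ sameCircle w t (inU k) (inD k) := by
  intro h'
  have := sameCircle_le (r := Setoid.ker fun p : Pt w => (p.2 : ℕ) = w.get k) (fun p q hpq => ?_) h'
  · have this : ((inU k).2 : ℕ) = w.get k ↔ ((inD k).2 : ℕ) = w.get k := iff_of_eq this
    rcases in_cols k with ⟨h1, h2⟩ | ⟨h1, h2⟩ <;> rw [h1, h2] at this <;> omega
  · refine propext ?_
    change (p.2 : ℕ) = w.get k ↔ (q.2 : ℕ) = w.get k
    rcases arc_col hpq with e | ⟨l, hl, e1, e2⟩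
    · rw [e]
    · have := h l hl
      rw [e1, e2, Fin.val_castSucc, Fin.val_succ]
      omega

theorem cls_telescope_fin {t : Finset (Crossing w)} (ht : Thin t) {j : ℕ} (hj : j ≤ m)
    (h : ∀ k ∈ t, j ≤ (w.get k : ℕ)) (f : Poly w) :
    cls w t f = cls w t ((∑ i : Fin m, if (i : ℕ) < j then elim w i f else 0) +
      prodDiff w j * top w j f) := by
  rw [cls_telescope ht hj h f, map_add]
  congr 1
  rw [Fin.sum_univ_eq_sum_range (fun i => if i < j then elim w i f else 0), map_sum,
    ← Finset.sum_filter_add_sum_filter_not (Finset.range m) (· < j)]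
  have h1 : (Finset.range m).filter (· < j) = Finset.range j := by
    ext i
    simp only [Finset.mem_filter, Finset.mem_range]
    omega
  rw [h1, Finset.sum_eq_zero (s := (Finset.range m).filter fun i => ¬ i < j), add_zero]
  · refine Finset.sum_congr rfl fun i hi => ?_
    rw [if_pos (Finset.mem_range.1 hi)]
  · intro i hi
    rw [if_neg (Finset.mem_filter.1 hi).2, map_zero]

/-- The operators for a crossing with the letter of the line agree with those without. -/
theorem cls_elim_letter (k : Crossing w) (f : Poly w) :
    cls w {k} (elim w (w.get k) f) = cls w {k} (prodDiff w (w.get k) * top w (w.get k) f) := by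
  rw [cls_telescope_step (thin_singleton k) (w.get k).2
    (fun l hl => by rw [Finset.mem_singleton.1 hl]), map_mul _ (prodDiff w _),
    cls_prodDiff_eq_zero (thin_singleton k) (Finset.mem_singleton_self k) (Nat.lt_succ_self _),
    zero_mul, add_zero]

theorem cls_elim_of_gt {k : Crossing w} {i : ℕ} (h : (w.get k : ℕ) < i) (f : Poly w) :
    cls w {k} (elim w i f) = 0 := by
  rw [elim_apply, map_mul, cls_prodDiff_eq_zero (thin_singleton k) (Finset.mem_singleton_self k) h,
    zero_mul]

/-- Both edges into the pair are splits, that is, multiplication by the sum of the variables below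
and above `k`. Exactly one of these lies on the inner circle: the upper one at `a`, the lower one at
`b`. Taking the linear part therefore undoes the multiplication. -/
theorem elimSame_saddle {a b : Crossing w} (hab : a < b) (hw : w.get a = w.get b) {k : Crossing w}
    (hk : k = a ∨ k = b) (f : Poly w) :
    elimSame a b (saddle (insert a {b}) k * collapse w f) =
      prodDiff w (w.get b) * top w (w.get b) (collapse w f) := by
  have hab' : (a : ℕ) < b := hab
  have hwk : w.get k = w.get a := by
    rcases hk with rfl | rfl
    · rfl
    · exact hw.symm
  have h1 : botL k ∈ inner a b ↔ k = b := by
    simp only [inner, botL, Set.mem_ofPred_eq, hwk, true_or, true_and, Fin.lt_def, Fin.le_def,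
      Fin.val_castSucc]
    rcases hk with rfl | rfl
    · exact ⟨fun h => absurd h.1 (lt_irrefl _), fun h => absurd h hab.ne⟩
    · exact ⟨fun _ => rfl, fun _ => ⟨hab', le_rfl⟩⟩
  have h2 : topL k ∈ inner a b ↔ k = a := by
    simp only [inner, topL, Set.mem_ofPred_eq, hwk, true_or, true_and, Fin.lt_def, Fin.le_def,
      Fin.val_castSucc, Fin.val_succ]
    rcases hk with rfl | rfl
    · exact ⟨fun _ => rfl, fun _ => ⟨Nat.lt_succ_self _, hab'⟩⟩
    · exact ⟨fun h => absurd h.2 (by omega), fun h => absurd h hab.ne'⟩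
  have hs : saddle (insert a {b}) k = X (botL k) + X (topL k) := by
    refine if_neg fun h => ?_
    have := inner_same hab hw h
    rw [h1, h2] at this
    rcases hk with rfl | rfl
    · exact hab.ne (this.2 rfl)
    · exact hab.ne' (this.1 rfl)
  have hl : lin (inner a b) (X (botL k) + X (topL k)) = 1 := by
    rw [map_add]
    rcases hk with rfl | rfl
    · rw [lin_X_of_notMem fun h => hab.ne (h1.1 h), lin_X_of_mem (h2.2 rfl), zero_add]
    · rw [lin_X_of_mem (h1.2 rfl), lin_X_of_notMem fun h => hab.ne' (h2.1 h), add_zero]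
  obtain ⟨c1, c2⟩ := inner_collapse a b f
  rw [elimSame_apply, hs, lin_mul, hl, c1, c2, mul_zero, zero_add, one_mul]

namespace Firsts

variable (B : Firsts w)

theorem le_last (i : Fin m) : (i : ℕ) ≤ B.last := by
  have := B.last_eq
  omega

/-- The line with the left basepoint. -/
abbrev u : Fin (m + 1) := B.last.castSucc

/-- The line with the right basepoint. -/
abbrev v : Fin (m + 1) := B.last.succ

/-- The Khovanov complex with basepoints on the last two lines. -/
abbrev complex : CochainComplex GrBimod ℕ := khovanovComplex w B.u B.v

/-- The cochain groups. -/
abbrev cochains (c : ℕ) : GrBimod :=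
  GrBimod.pi fun s : {s : Finset (Crossing w) // s.card = c} => vertex w B.u B.v s.1

/-- The coboundary in degree `0`. -/
def d0 : B.cochains 0 ⟶ B.cochains 1 := B.complex.d 0 1

/-- The coboundary in degree `1`. -/
def d1 : B.cochains 1 ⟶ B.cochains 2 := B.complex.d 1 2

/-! ### The homotopies in degrees one and two -/

/-- The condition under which the first crossing of a letter eliminates the line `i`. -/
def Elim (i : Fin m) (t : Finset (Crossing w)) : Prop :=
  Thin t ∧ (∀ k ∈ t, (i : ℕ) < w.get k) ∧ (i : ℕ) < B.last

variable {B} in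
theorem Elim.notMem {i : Fin m} {t : Finset (Crossing w)} (H : B.Elim i t) : B.first i ∉ t :=
  fun h => by
    have := H.2.1 _ h
    rw [B.get_first] at this
    exact lt_irrefl _ this

/-- The elimination of the line `i` as a morphism. -/
def elimHom {i : Fin m} {t : Finset (Crossing w)} (H : B.Elim i t) :
    vertex w B.u B.v (insert (B.first i) t) ⟶ vertex w B.u B.v t :=
  vertexMap B.u B.v (elim w i)
    (fun f hf => elim_mem_circleIdeal H.1 (fun k hk => by
      rcases Finset.mem_insert.1 hk with rfl | hk
      · exact Or.inl (by rw [B.get_first])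
      · exact Or.inr ⟨H.2.1 k hk, hk⟩) (fun k hk => (H.2.1 k hk).le) hf)
    (fun f => elim_y_mul (by omega) H.2.2 f)
    (fun f => elim_y_mul (by omega) (H.2.2.trans (Fin.castSucc_lt_succ (i := B.last))) f)
    -- The edge is a merge: the loss of a circle balances the additional `1`-smoothing.
    0 (fun q f hf => by rw [add_zero]; exact elim_mem_polyGr _ hf) (by
      have h := (same_in_insert H.notMem).2 (not_same_of_lt fun l hl => by
        rw [B.get_first]; exact H.2.1 l hl)
      rw [numCircles_merge H.notMem h, Finset.card_insert_of_notMem H.notMem]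
      push_cast
      ring)

open Classical in
/-- The contribution of the letter `i` to the homotopy. -/
def elimAt (c : ℕ) (i : Fin m) (t : {s : Finset (Crossing w) // s.card = c}) :
    B.cochains (c + 1) ⟶ vertex w B.u B.v t.1 :=
  if H : B.Elim i t.1 then
    -- The sign of the edge that is traversed backwards; it cancels against the same sign in the
    -- coboundary.
    edgeSign t.1 (B.first i) • (GrBimod.piProj _ ⟨insert (B.first i) t.1, by
      rw [Finset.card_insert_of_notMem H.notMem, t.2]⟩ ≫ B.elimHom H)
  else 0

/-- The crossing `b` alone already joins the two lines to one circle, so `a` splits that circle. -/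
theorem numCircles_same {a b : Crossing w} (hab : a < b) (hw : w.get a = w.get b) :
    numCircles w (insert a {b}) = numCircles w {b} + 1 := by
  have hb : a ∉ ({b} : Finset (Crossing w)) := by simpa using hab.ne
  refine numCircles_split hb fun h => ?_
  rw [same_in_insert hb] at h
  refine h ((same_of_joined (k := b) ?_ (Or.inr ⟨?_, ?_⟩)))
  all_goals
    have hn : ∀ p : Pt w, ((p.2 : ℕ) = w.get b ∨ (p.2 : ℕ) = w.get b + 1) →
        sameCircle w {b} p (botL b) := by
      rintro p (e | e)
      · exact (thin_singleton b).same_of_col (Fin.ext e)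
      · exact (sameCircle w _).symm ((thin_singleton b).same_of_letter (Finset.mem_singleton_self b)
          rfl (Fin.ext e))
  · refine (sameCircle w _).trans (hn _ ?_) ((sameCircle w _).symm (hn _ ?_)) <;>
      rcases in_cols b with h | h <;> omega
  · refine Or.inl ((sameCircle w _).trans (hn _ ?_) ((sameCircle w _).symm (hn _ ?_)))
    · have := in_cols a; rw [hw] at this; omega
    · have := in_cols b; omega
  · refine Or.inl ((sameCircle w _).trans (hn _ ?_) ((sameCircle w _).symm (hn _ ?_)))
    · have := in_cols a; rw [hw] at this; omega
    · have := in_cols b; omega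

/-- The removal of a crossing that is not the first one with its letter. -/
def sameHom {a b : Crossing w} (hab : a < b) (hw : w.get a = w.get b)
    {t : Finset (Crossing w)} (ht : t = {b}) :
    vertex w B.u B.v (insert a t) ⟶ vertex w B.u B.v t :=
  vertexMap B.u B.v (elimSame a b)
    (fun f hf => by
      subst ht
      exact elimSame_mem_circleIdeal hab hw hf)
    (fun f => elimSame_y_mul (by omega) (B.le_last _) f)
    (fun f => elimSame_y_mul (by omega)
      ((B.le_last _).trans (Fin.castSucc_lt_succ (i := B.last)).le) f)
    -- The edge is a split, which adds one circle and one `1`-smoothing.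
    2 (fun q f hf => elimSame_mem_polyGr a b hf) (by
      subst ht
      rw [numCircles_same hab hw, Finset.card_insert_of_notMem (by simpa using hab.ne)]
      push_cast
      ring)

theorem sameHom_vcls {a b : Crossing w} (hab : a < b) (hw : w.get a = w.get b)
    {t : Finset (Crossing w)} (ht : t = {b}) (f : Poly w) :
    GrBimod.toLin (B.sameHom hab hw ht) (vcls B.u B.v _ f) = vcls B.u B.v t (elimSame a b f) := rfl

/-- The contribution of the crossings with the same letter to the homotopy. -/
def sameAt (b : Crossing w) (t : {s : Finset (Crossing w) // s.card = 1}) (hb : t.1 = {b}) :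
    B.cochains 2 ⟶ vertex w B.u B.v t.1 :=
  -- By `first_le` this fails only if `b` is itself the chosen crossing of its letter. No sign is
  -- needed: adding a crossing before `b` has sign `1`.
  if H : B.first (w.get b) < b then
    GrBimod.piProj (fun s : {s : Finset (Crossing w) // s.card = 2} => vertex w B.u B.v s.1)
      ⟨insert (B.first (w.get b)) t.1, by rw [hb, Finset.card_pair H.ne]⟩ ≫
        B.sameHom H (B.get_first (w.get b)) hb
  else 0

/-- The homotopy from degree `1` to degree `0`. -/
def h1 : B.cochains 1 ⟶ B.cochains 0 :=
  GrBimod.piLift fun t => ∑ i, B.elimAt 0 i t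

/-- The homotopy from degree `2` to degree `1`. -/
def h2 : B.cochains 2 ⟶ B.cochains 1 :=
  GrBimod.piLift fun t => (∑ i, B.elimAt 1 i t) +
    -- The crossing of a one-element smoothing is recovered by choice, which is why `sameAt` takes
    -- `b` and `t` separately.
    B.sameAt (Finset.card_eq_one.1 t.2).choose t (Finset.card_eq_one.1 t.2).choose_spec

theorem h1_apply {x : B.cochains 1} {F : Crossing w → Poly w}
    (hF : ∀ k, (x : ∀ s : {s : Finset (Crossing w) // s.card = 1}, vertex w B.u B.v s.1)
      (oneCrossing k) = vcls B.u B.v {k} (F k)) :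
    (GrBimod.toLin B.h1 x : ∀ s : {s : Finset (Crossing w) // s.card = 0}, vertex w B.u B.v s.1)
      (noCrossing w) = vcls B.u B.v ∅
        (∑ i : Fin m, if (i : ℕ) < B.last then elim w i (F (B.first i)) else 0) := by
  rw [h1, GrBimod.toLin_piLift, GrBimod.toLin_sum]
  refine Eq.trans ?_ (map_sum (vcls B.u B.v ∅) _ _).symm
  refine Finset.sum_congr rfl fun i _ => ?_
  by_cases hi : (i : ℕ) < B.last
  · have H : B.Elim i (noCrossing w).1 := ⟨thin_empty, fun k hk => absurd hk (Finset.notMem_empty k), hi⟩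
    rw [elimAt, dif_pos H, if_pos hi]
    have e : edgeSign (noCrossing w).1 (B.first i) = 1 := edgeSign_empty _
    rw [e, one_smul]
    exact congrArg (GrBimod.toLin (B.elimHom H)) (hF (B.first i))
  · have H : ¬ B.Elim i (noCrossing w).1 := fun H => hi H.2.2
    rw [elimAt, dif_neg H, if_neg hi, map_zero]
    rfl

theorem edgeSign_mul_self (s : Finset (Crossing w)) (k : Crossing w) :
    edgeSign s k * edgeSign s k = 1 := by
  rw [edgeSign, ← mul_pow]
  simp

/-- For `i` below the letter of `k` both edges into the pair are merges, as the letters differ; up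
to the sign of the edge the coboundary is then the difference of the two polynomials. -/
theorem elimAt_d_apply {x : B.cochains 1} {F : Crossing w → Poly w}
    (hF : ∀ k, (x : ∀ s : {s : Finset (Crossing w) // s.card = 1}, vertex w B.u B.v s.1)
      (oneCrossing k) = vcls B.u B.v {k} (F k)) (i : Fin m) (k : Crossing w) :
    GrBimod.toLin (B.elimAt 1 i (oneCrossing k)) (GrBimod.toLin B.d1 x) =
      vcls B.u B.v {k} (if (i : ℕ) < w.get k then elim w i (F k) - elim w i (F (B.first i))
        else 0) := by
  by_cases hi : (i : ℕ) < w.get k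
  · have H : B.Elim i (oneCrossing k).1 := ⟨thin_singleton k,
      fun l hl => by rw [Finset.mem_singleton.1 hl]; exact hi, hi.trans_le (B.le_last _)⟩
    have hne : B.first i ≠ k := fun e => H.notMem (by rw [e]; exact Finset.mem_singleton_self k)
    rw [elimAt, dif_pos H, if_pos hi, GrBimod.toLin_zsmul, GrBimod.toLin_comp, GrBimod.toLin_piProj]
    have hd : (GrBimod.toLin B.d1 x : ∀ s : {s : Finset (Crossing w) // s.card = 2},
        vertex w B.u B.v s.1) ⟨insert (B.first i) {k}, Finset.card_pair hne⟩ = _ :=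
      khovanov_d_pair B.u B.v x hF hne ⟨insert (B.first i) {k}, Finset.card_pair hne⟩ rfl
    have s1 : saddle (insert (B.first i) {k}) (B.first i) = 1 :=
      saddle_eq_one (by simpa using hne) rfl (not_same_in (i := w.get k)
        (fun l hl => by rw [Finset.mem_singleton.1 hl]) (by rw [B.get_first]; omega))
    have s2 : saddle (insert (B.first i) {k}) k = 1 :=
      saddle_eq_one (s := {B.first i}) (by simpa using hne.symm) (Finset.pair_comm _ _)
        (not_same_in (i := i) (fun l hl => by rw [Finset.mem_singleton.1 hl, B.get_first])
          (by omega))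
    simp only [s1, s2, one_mul] at hd
    refine (congrArg (fun z => edgeSign _ _ • GrBimod.toLin (B.elimHom H) z) hd).trans ?_
    refine (congrArg (edgeSign {k} (B.first i) • ·) (map_zsmul (GrBimod.toLin (B.elimHom H)) _ _)).trans ?_
    rw [smul_smul, edgeSign_mul_self, one_smul, ← map_sub]
    rfl
  · have H : ¬ B.Elim i (oneCrossing k).1 := fun H => hi (H.2.1 k (Finset.mem_singleton_self k))
    rw [elimAt, dif_neg H, if_neg hi, map_zero]
    rfl

/-- By `elimSame_saddle` both edges contribute `prodDiff * top`, and `cls_elim_letter` rewrites the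
term of the chosen crossing. If `k` is the chosen crossing, both sides vanish, the right one again
by `cls_elim_letter`. -/
theorem sameAt_d_apply {x : B.cochains 1} {F : Crossing w → Poly w}
    (hF : ∀ k, (x : ∀ s : {s : Finset (Crossing w) // s.card = 1}, vertex w B.u B.v s.1)
      (oneCrossing k) = vcls B.u B.v {k} (F k)) (b k : Crossing w)
    (hb : (oneCrossing k).1 = {b}) :
    GrBimod.toLin (B.sameAt b (oneCrossing k) hb) (GrBimod.toLin B.d1 x) =
      vcls B.u B.v {k} (prodDiff w (w.get k) * top w (w.get k) (F k) -
        elim w (w.get k) (F (B.first (w.get k)))) := by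
  obtain rfl : k = b := Finset.singleton_injective hb
  by_cases H : B.first (w.get k) < k
  · have hF' : ∀ k, (x : ∀ s : {s : Finset (Crossing w) // s.card = 1}, vertex w B.u B.v s.1)
        (oneCrossing k) = vcls B.u B.v {k} (collapse w (F k)) := fun k =>
      (hF k).trans (vcls_congr _ _ (cls_collapse (thin_singleton k) _).symm)
    have hd : (GrBimod.toLin B.d1 x : ∀ s : {s : Finset (Crossing w) // s.card = 2},
        vertex w B.u B.v s.1) ⟨insert (B.first (w.get k)) {k}, Finset.card_pair H.ne⟩ = _ :=
      khovanov_d_pair B.u B.v x hF' H.ne ⟨insert (B.first (w.get k)) {k}, Finset.card_pair H.ne⟩ rfl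
    have hsign : edgeSign {k} (B.first (w.get k)) = 1 := by
      rw [edgeSign, Finset.filter_singleton, if_neg (not_lt.2 H.le)]
      rfl
    rw [hsign, one_smul] at hd
    rw [sameAt, dif_pos H, GrBimod.toLin_comp, GrBimod.toLin_piProj]
    refine (congrArg (GrBimod.toLin (B.sameHom H (B.get_first _) hb)) hd).trans ?_
    refine (B.sameHom_vcls H (B.get_first _) hb _).trans ?_
    change vcls B.u B.v {k} _ = _
    refine vcls_congr _ _ ?_
    rw [map_sub (elimSame _ _), elimSame_saddle H (B.get_first _) (Or.inl rfl),
      elimSame_saddle H (B.get_first _) (Or.inr rfl), map_sub, map_sub, cls_elim_letter]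
    have ht : ∀ f : Poly w, cls w {k} (prodDiff w (w.get k) * top w (w.get k) (collapse w f)) =
        cls w {k} (prodDiff w (w.get k) * top w (w.get k) f) := by
      intro f
      rw [map_mul, map_mul]
      congr 1
      rw [Ideal.Quotient.eq, ← map_sub]
      exact top_mem_circleIdeal (fun l hl => by rw [Finset.mem_singleton.1 hl])
        (Ideal.Quotient.eq.1 (cls_collapse (thin_singleton k) f))
    rw [ht, ht]
  · have e : B.first (w.get k) = k := le_antisymm (B.first_le k) (not_lt.1 H)
    rw [sameAt, dif_neg H]
    refine Eq.trans ?_ (map_zero (vcls B.u B.v {k})).symm |>.trans (vcls_congr _ _ ?_)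
    · rfl
    · rw [e, map_sub, cls_elim_letter, sub_self, map_zero]

/-! ### The inclusion of `E` and the projection to `E` -/

/-- The grading shift of `E`. -/
def shiftBy (_ : Firsts w) : ℤ := w.length + 1 - m

/-- The unit has degree `m + 1 + w.length`, and each of the `m - 1` factors lowers this by `2`.
Since `1 ⊗ 1` has degree `2`, this determines `shiftBy`. -/
theorem prodDiff_mem_gr {s : Finset (Crossing w)} (hs : numCircles w s + s.card = m + 1) :
    vcls B.u B.v s (prodDiff w B.last) ∈ (vertex w B.u B.v s).gr (B.shiftBy + 2) := by
  refine ⟨prodDiff w B.last, ?_, rfl⟩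
  have h := prodDiff_mem_polyGr (w := w) B.last
  have e : (B.shiftBy + 2 - (numCircles w s + s.card + w.length : ℤ)) = -2 * (B.last : ℕ) := by
    have h1 : (numCircles w s + s.card : ℤ) = m + 1 := by exact_mod_cast hs
    have h2 : ((B.last : ℕ) : ℤ) + 1 = m := by exact_mod_cast B.last_eq
    rw [h1, shiftBy]
    linarith
  change _ ∈ polyGr w (B.shiftBy + 2 - (numCircles w s + s.card + w.length : ℤ))
  rw [e]
  exact h

theorem circles_zero (s : {s : Finset (Crossing w) // s.card = 0}) :
    numCircles w s.1 + s.1.card = m + 1 := by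
  rw [eq_noCrossing s]
  change numCircles w ∅ + 0 = m + 1
  rw [numCircles_empty]

theorem circles_one (s : {s : Finset (Crossing w) // s.card = 1}) :
    numCircles w s.1 + s.1.card = m + 1 := by
  obtain ⟨k, rfl⟩ := exists_oneCrossing s
  exact (numCircles_singleton k).trans numCircles_empty

/-- A crossing with the last letter joins the lines of the two basepoints. At any other crossing one
factor of the product is zero. -/
theorem XL_smul_prodDiff (s : {s : Finset (Crossing w) // s.card = 1}) :
    XL • vcls B.u B.v s.1 (prodDiff w B.last) = XR • vcls B.u B.v s.1 (prodDiff w B.last) := by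
  obtain ⟨k, rfl⟩ := exists_oneCrossing s
  rw [XL_smul_vcls, XR_smul_vcls]
  refine vcls_congr _ _ ?_
  change cls w {k} _ = cls w {k} _
  rw [map_mul, map_mul]
  rcases (B.le_last (w.get k)).lt_or_eq with h | h
  · rw [cls_prodDiff_eq_zero (thin_singleton k) (Finset.mem_singleton_self k) h, mul_zero, mul_zero]
  · have e : w.get k = B.last := Fin.ext h
    rw [y_val, y_val, cls_X_eq ((thin_singleton k).same_of_letter (Finset.mem_singleton_self k)
      (p := (0, B.u)) (q := (0, B.v)) (by rw [e]) (by rw [e]))]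

/-- The inclusion of `E` in degree `0`. -/
def i0 : GrBimod.twist B.shiftBy grRR ⟶ B.cochains 0 :=
  GrBimod.piLift fun s => GrBimod.fromRR (vcls B.u B.v s.1 (prodDiff w B.last)) B.shiftBy
    (B.prodDiff_mem_gr (circles_zero s))

/-- The inclusion of `E` in degree `1`. -/
def i1 : GrBimod.twist B.shiftBy (GrBimod.twist 1 grR) ⟶ B.cochains 1 :=
  GrBimod.piLift fun s => GrBimod.fromR (vcls B.u B.v s.1 (prodDiff w B.last))
    (B.XL_smul_prodDiff s) B.shiftBy (B.prodDiff_mem_gr (circles_one s))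

/-- The projection to `R ⊗ R` on polynomials. -/
def p0Add : Poly w →+ RR :=
  (kappa w B.last).toRingHom.toAddMonoidHom.comp (top w B.last)

theorem p0Add_apply (f : Poly w) : B.p0Add f = kappa w B.last (top w B.last f) := rfl

theorem p0Add_eq_zero {f : Poly w} (hf : f ∈ circleIdeal w ∅) : B.p0Add f = 0 :=
  kappa_eq_zero _ (top_mem_circleIdeal (fun k hk => absurd hk (Finset.notMem_empty k)) hf)

theorem p0Add_y_last (f : Poly w) : B.p0Add (y w B.last * f) = XL * B.p0Add f := by
  rw [p0Add_apply, p0Add_apply, top_y_mul (by omega) le_rfl, map_mul, kappa_y_self (by omega)]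

theorem p0Add_y_succ (f : Poly w) : B.p0Add (y w (B.last + 1) * f) = XR * B.p0Add f := by
  rw [p0Add_apply, p0Add_apply, top_y_mul (by omega) (by omega), map_mul, kappa_y_succ (by omega)]

theorem p0Add_mem_gr {q : ℤ} {f : Poly w} (hf : f ∈ polyGr w q) :
    B.p0Add f ∈ grRR.gr (q + (m + 1 + w.length : ℤ) - B.shiftBy) := by
  have h := kappa_mem_gr B.last (top_mem_polyGr B.last hf)
  have h2 : ((B.last : ℕ) : ℤ) + 1 = m := by exact_mod_cast B.last_eq
  have e : q + (m + 1 + w.length : ℤ) - B.shiftBy = q + 2 * (B.last : ℕ) + 2 := by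
    rw [shiftBy]
    linarith
  rw [e]
  exact h

/-- The projection of a vertex to `E` in degree `0`. -/
def p0Vertex : vertex w B.u B.v ∅ ⟶ GrBimod.twist B.shiftBy grRR :=
  fromVertex B.u B.v ∅ (N := GrBimod.twist B.shiftBy grRR) B.p0Add
      (fun _ hf => B.p0Add_eq_zero hf) B.p0Add_y_last B.p0Add_y_succ (fun q f hf => by
        have h := B.p0Add_mem_gr hf
        have e : ((numCircles w ∅ : ℤ) + (∅ : Finset (Crossing w)).card) = m + 1 := by
          exact_mod_cast circles_zero (noCrossing w)
        rw [e]
        exact h)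

/-- The projection to `E` in degree `0`. -/
def p0 : B.cochains 0 ⟶ GrBimod.twist B.shiftBy grRR :=
  GrBimod.piProj _ (noCrossing w) ≫ B.p0Vertex

/-- The projection to `R` on polynomials. -/
def p1Add : Poly w →+ R :=
  (mulLin.toAddMonoidHom.comp B.p0Add).comp (subst w B.last).toRingHom.toAddMonoidHom

theorem p1Add_apply (f : Poly w) : B.p1Add f = mulLin (B.p0Add (subst w B.last f)) := rfl

/-- The substitution turns the left variable into the right one, and on `R` the two actions agree.
-/
theorem p1Add_y_last (f : Poly w) : B.p1Add (y w B.last * f) = (XL • B.p1Add f : R) := by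
  rw [p1Add_apply, p1Add_apply, map_mul, subst_y_self (by omega), p0Add_y_succ, mulLin_XR_mul,
    XL_smul_R]

theorem p1Add_y_succ (f : Poly w) : B.p1Add (y w (B.last + 1) * f) = (XR • B.p1Add f : R) := by
  rw [p1Add_apply, p1Add_apply, map_mul, subst_y_ne (by omega) (by omega), p0Add_y_succ,
    mulLin_XR_mul, XR_smul_R]

/-- The projection of a vertex to `E` in degree `1`. -/
def p1Vertex : vertex w B.u B.v {B.first B.last} ⟶
    GrBimod.twist B.shiftBy (GrBimod.twist 1 grR) :=
  fromVertex B.u B.v {B.first B.last} (N := GrBimod.twist B.shiftBy (GrBimod.twist 1 grR)) B.p1Add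
      (fun f hf => by
        have h := B.p0Add_eq_zero (subst_mem_circleIdeal (i := B.last) thin_empty (fun k hk =>
          Or.inl (by rw [Finset.mem_singleton.1 hk, B.get_first])) hf)
        exact (congrArg mulLin h).trans (map_zero mulLin))
      B.p1Add_y_last B.p1Add_y_succ (fun q f hf => by
        have h := B.p0Add_mem_gr (subst_mem_polyGr B.last hf)
        have e : ((numCircles w {B.first B.last} : ℤ) +
            ({B.first B.last} : Finset (Crossing w)).card) = m + 1 := by
          exact_mod_cast circles_one (oneCrossing (B.first B.last))
        rw [e]
        exact mu.2 _ _ h)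

/-- The projection to `E` in degree `1`. -/
def p1 : B.cochains 1 ⟶ GrBimod.twist B.shiftBy (GrBimod.twist 1 grR) :=
  GrBimod.piProj _ (oneCrossing (B.first B.last)) ≫ B.p1Vertex

end Firsts

end Reduction

/-! ### The identities of the splitting, and the result for positive braid words -/

section Splitting

open MvPolynomial

variable {m : ℕ} {w : List (Fin m)}

namespace Firsts

variable (B : Firsts w)

theorem d0_apply {x : B.cochains 0} {f : Poly w}
    (hf : (x : ∀ s : {s : Finset (Crossing w) // s.card = 0}, vertex w B.u B.v s.1)
      (noCrossing w) = vcls B.u B.v ∅ f) (k : Crossing w) :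
    (GrBimod.toLin B.d0 x : ∀ s : {s : Finset (Crossing w) // s.card = 1}, vertex w B.u B.v s.1)
      (oneCrossing k) = vcls B.u B.v {k} f :=
  khovanov_d_oneCrossing B.u B.v x hf k

theorem p0_apply {x : B.cochains 0} {f : Poly w}
    (hf : (x : ∀ s : {s : Finset (Crossing w) // s.card = 0}, vertex w B.u B.v s.1)
      (noCrossing w) = vcls B.u B.v ∅ f) : GrBimod.toLin B.p0 x = B.p0Add f :=
  congrArg (GrBimod.toLin B.p0Vertex) hf

theorem p1_apply {x : B.cochains 1} {f : Poly w}
    (hf : (x : ∀ s : {s : Finset (Crossing w) // s.card = 1}, vertex w B.u B.v s.1)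
      (oneCrossing (B.first B.last)) = vcls B.u B.v {B.first B.last} f) :
    GrBimod.toLin B.p1 x = B.p1Add f :=
  congrArg (GrBimod.toLin B.p1Vertex) hf

theorem i0_apply (b : RR) (s : {s : Finset (Crossing w) // s.card = 0}) :
    (GrBimod.toLin B.i0 b : ∀ s : {s : Finset (Crossing w) // s.card = 0}, vertex w B.u B.v s.1) s =
      b • vcls B.u B.v s.1 (prodDiff w B.last) := rfl

theorem i1_apply (c : RR) (s : {s : Finset (Crossing w) // s.card = 1}) :
    (GrBimod.toLin B.i1 (mulLin c) :
      ∀ s : {s : Finset (Crossing w) // s.card = 1}, vertex w B.u B.v s.1) s =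
      c • vcls B.u B.v s.1 (prodDiff w B.last) :=
  GrBimod.fromRAdd_mulLin _ (B.XL_smul_prodDiff s) c

theorem cochains_zero_ext {x x' : B.cochains 0}
    (h : (x : ∀ s : {s : Finset (Crossing w) // s.card = 0}, vertex w B.u B.v s.1)
      (noCrossing w) = (x' : ∀ s : {s : Finset (Crossing w) // s.card = 0}, vertex w B.u B.v s.1)
        (noCrossing w)) : x = x' :=
  funext fun s => by
    rw [eq_noCrossing s]
    exact h

theorem cochains_one_ext {x x' : B.cochains 1}
    (h : ∀ k, (x : ∀ s : {s : Finset (Crossing w) // s.card = 1}, vertex w B.u B.v s.1)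
      (oneCrossing k) = (x' : ∀ s : {s : Finset (Crossing w) // s.card = 1}, vertex w B.u B.v s.1)
        (oneCrossing k)) : x = x' :=
  funext fun s => by
    obtain ⟨k, rfl⟩ := exists_oneCrossing s
    exact h k

/-- The telescoping identity for the empty smoothing with `j = B.last`: the sum is the homotopy
term, and the remainder is the projection to `R ⊗ R`. -/
theorem homotopy_zero : B.d0 ≫ B.h1 + B.p0 ≫ B.i0 = 𝟙 (B.cochains 0) := by
  refine GrBimod.hom_ext fun x => B.cochains_zero_ext ?_
  obtain ⟨f, hf⟩ := vcls_surjective B.u B.v ∅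
    ((x : ∀ s : {s : Finset (Crossing w) // s.card = 0}, vertex w B.u B.v s.1) (noCrossing w))
  have h1 := B.h1_apply (B.d0_apply hf.symm)
  have h2 : (GrBimod.toLin (B.p0 ≫ B.i0) x :
      ∀ s : {s : Finset (Crossing w) // s.card = 0}, vertex w B.u B.v s.1) (noCrossing w) =
      vcls B.u B.v ∅ (top w B.last f * prodDiff w B.last) := by
    rw [vcls_mul_prodDiff thin_empty B.last_eq, ← p0Add_apply]
    exact congrArg (fun c : RR => c • vcls B.u B.v ∅ (prodDiff w B.last)) (B.p0_apply hf.symm)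
  refine (congrArg₂ (· + ·) h1 h2).trans (Eq.trans ?_ hf)
  refine (map_add (vcls B.u B.v ∅) _ _).symm.trans (vcls_congr _ _ ?_)
  rw [mul_comm, ← cls_telescope_fin thin_empty (by omega) fun k hk => absurd hk (Finset.notMem_empty k)]

/-- A polynomial and its substitution differ by a multiple of `x_e - x_{e+1}`. The projection maps
this to a multiple of `XL - XR`, which multiplication kills. -/
theorem p_comm : B.p0 ≫ (shift B.shiftBy E).d 0 1 = B.d0 ≫ B.p1 := by
  refine GrBimod.hom_ext fun x => ?_
  obtain ⟨f, hf⟩ := vcls_surjective B.u B.v ∅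
    ((x : ∀ s : {s : Finset (Crossing w) // s.card = 0}, vertex w B.u B.v s.1) (noCrossing w))
  have h1 : GrBimod.toLin ((shift B.shiftBy E).d 0 1) (GrBimod.toLin B.p0 x) =
      mulLin (B.p0Add f) :=
    (congrArg _ (B.p0_apply hf.symm)).trans (shift_E_d_apply _ _)
  have h2 := B.p1_apply (B.d0_apply hf.symm (B.first B.last))
  refine h1.trans (Eq.trans ?_ h2.symm)
  have h3 : f - (subst w B.last f + (y w B.last * lin (line w B.last) f -
      y w (B.last + 1) * lin (line w B.last) f)) ∈ circleIdeal w ∅ := by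
    rw [← Ideal.Quotient.eq]
    simp only [map_add, map_sub, map_mul]
    rw [cls_expand thin_empty B.last f, cls_subst thin_empty B.last f]
    ring
  have h4 := B.p0Add_eq_zero h3
  rw [map_sub, map_add, map_sub, sub_eq_zero, p0Add_y_last, p0Add_y_succ] at h4
  rw [h4, p1Add_apply, map_add, map_sub, mulLin_XL_mul, mulLin_XR_mul, sub_self, add_zero]

/-- By linearity it is enough to look at `1 ⊗ 1`, which either way goes to the product of
differences in every component. -/
theorem i_comm : B.i0 ≫ B.d0 = (shift B.shiftBy E).d 0 1 ≫ B.i1 := by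
  refine GrBimod.hom_ext fun (b : RR) => B.cochains_one_ext fun k => ?_
  have h1 : (GrBimod.toLin B.d0 (GrBimod.toLin B.i0 (1 : RR)) :
      ∀ s : {s : Finset (Crossing w) // s.card = 1}, vertex w B.u B.v s.1) (oneCrossing k) =
        vcls B.u B.v {k} (prodDiff w B.last) :=
    B.d0_apply ((B.i0_apply 1 (noCrossing w)).trans (one_smul RR _)) k
  have h2 : GrBimod.toLin (B.i0 ≫ B.d0) b = b • GrBimod.toLin (B.i0 ≫ B.d0) (1 : RR) := by
    refine Eq.trans ?_ (map_smul (GrBimod.toLin (B.i0 ≫ B.d0)) b (1 : RR))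
    exact congrArg _ (mul_one b).symm
  have h3 : GrBimod.toLin ((shift B.shiftBy E).d 0 1 ≫ B.i1) b = GrBimod.toLin B.i1 (mulLin b) :=
    congrArg (GrBimod.toLin B.i1) (shift_E_d_apply _ b)
  refine (congrFun h2 (oneCrossing k)).trans (Eq.trans ?_ (congrFun h3 (oneCrossing k)).symm)
  refine Eq.trans ?_ (B.i1_apply b (oneCrossing k)).symm
  exact congrArg (fun z : vertex w B.u B.v {k} => b • z) h1

/-- By linearity this is the statement at `1 ⊗ 1`, which is `top_prodDiff`. -/
theorem i0_p0 : B.i0 ≫ B.p0 = 𝟙 _ := by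
  refine GrBimod.hom_ext fun (b : RR) => ?_
  have h1 : GrBimod.toLin (B.i0 ≫ B.p0) (1 : RR) = (1 : RR) := by
    refine (B.p0_apply ((B.i0_apply 1 (noCrossing w)).trans (one_smul RR _))).trans ?_
    rw [p0Add_apply, top_prodDiff (by omega), map_one]
  have h2 : GrBimod.toLin (B.i0 ≫ B.p0) b = b • GrBimod.toLin (B.i0 ≫ B.p0) (1 : RR) := by
    refine Eq.trans ?_ (map_smul (GrBimod.toLin (B.i0 ≫ B.p0)) b (1 : RR))
    exact congrArg _ (mul_one b).symm
  exact h2.trans ((congrArg (fun z : RR => b • z) h1).trans (mul_one b))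

/-- The projection to `E` acts as the elimination for the last letter, and so supplies the term that
is absent from `h1`. -/
theorem p1_i1_apply {x : B.cochains 1} {f : Poly w}
    (hf : (x : ∀ s : {s : Finset (Crossing w) // s.card = 1}, vertex w B.u B.v s.1)
      (oneCrossing (B.first B.last)) = vcls B.u B.v {B.first B.last} f) (k : Crossing w) :
    (GrBimod.toLin (B.p1 ≫ B.i1) x :
      ∀ s : {s : Finset (Crossing w) // s.card = 1}, vertex w B.u B.v s.1) (oneCrossing k) =
      vcls B.u B.v {k} (elim w B.last f) := by
  have h1 : GrBimod.toLin (B.p1 ≫ B.i1) x =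
      GrBimod.toLin B.i1 (mulLin (B.p0Add (subst w B.last f))) :=
    congrArg (GrBimod.toLin B.i1) (B.p1_apply hf)
  refine (congrFun h1 (oneCrossing k)).trans ((B.i1_apply _ _).trans ?_)
  rw [elim_apply, mul_comm, vcls_mul_prodDiff (thin_singleton k) B.last_eq]
  rfl

theorem sum_lt_add {A : Type} [AddCommGroup A] (j : Fin m) (G : Fin m → A) :
    (∑ i : Fin m, if (i : ℕ) < j then G i else 0) + G j =
      ∑ i : Fin m, if (i : ℕ) ≤ j then G i else 0 := by
  have h : G j = ∑ i : Fin m, if i = j then G i else 0 := by simp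
  rw [h, ← Finset.sum_add_distrib]
  refine Finset.sum_congr rfl fun i _ => ?_
  rcases lt_trichotomy i j with a | a | a
  · rw [if_pos (show (i : ℕ) < j from a), if_neg a.ne, if_pos (show (i : ℕ) ≤ j from a.le), add_zero]
  · rw [if_neg (fun b : (i : ℕ) < j => (show i < j from b).ne a), if_pos a,
      if_pos (show (i : ℕ) ≤ j from a.le), zero_add]
  · rw [if_neg (fun b : (i : ℕ) < j => a.asymm b), if_neg a.ne',
      if_neg (fun b : (i : ℕ) ≤ j => a.not_ge b), zero_add]

theorem sum_lt_last {A : Type} [AddCommGroup A] (j : Fin m) (G : Fin m → A)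
    (hG : ∀ i : Fin m, (j : ℕ) < i → G i = 0) :
    (∑ i : Fin m, if (i : ℕ) < B.last then G i else 0) + G B.last =
      (∑ i : Fin m, if (i : ℕ) < j then G i else 0) + G j := by
  rw [sum_lt_add, sum_lt_add]
  refine Finset.sum_congr rfl fun i _ => ?_
  rw [if_pos (B.le_last i)]
  split_ifs with h
  · rfl
  · exact hG i (not_le.1 h)

/-- Let `k` have letter `j`. The last two summands give `∑_{i ≤ e} elim_i F(first i)`, of which only
`i ≤ j` survives at `k`. The first summand contains the negative of exactly these terms; what is
left of it is `∑_{i < j} elim_i F(k) + P_j top_j F(k)`, which is `F(k)` by telescoping. -/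
theorem homotopy_one : B.d1 ≫ B.h2 + B.h1 ≫ B.d0 + B.p1 ≫ B.i1 = 𝟙 (B.cochains 1) := by
  refine GrBimod.hom_ext fun x => B.cochains_one_ext fun k => ?_
  choose F hF using fun k => vcls_surjective B.u B.v {k}
    ((x : ∀ s : {s : Finset (Crossing w) // s.card = 1}, vertex w B.u B.v s.1) (oneCrossing k))
  have hF' := fun k => (hF k).symm
  have h1 : (GrBimod.toLin (B.d1 ≫ B.h2) x :
      ∀ s : {s : Finset (Crossing w) // s.card = 1}, vertex w B.u B.v s.1) (oneCrossing k) =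
      vcls B.u B.v {k} ((∑ i : Fin m, if (i : ℕ) < w.get k then
        elim w i (F k) - elim w i (F (B.first i)) else 0) +
        (prodDiff w (w.get k) * top w (w.get k) (F k) -
          elim w (w.get k) (F (B.first (w.get k))))) := by
    have e : (GrBimod.toLin (B.d1 ≫ B.h2) x :
      ∀ s : {s : Finset (Crossing w) // s.card = 1}, vertex w B.u B.v s.1) (oneCrossing k) =
        GrBimod.toLin ((∑ i, B.elimAt 1 i (oneCrossing k)) + B.sameAt _ (oneCrossing k)
          (Finset.card_eq_one.1 (oneCrossing k).2).choose_spec) (GrBimod.toLin B.d1 x) := rfl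
    rw [e, GrBimod.toLin_add, GrBimod.toLin_sum, map_add, map_sum]
    exact congrArg₂ (· + ·) (Finset.sum_congr rfl fun i _ => B.elimAt_d_apply hF' i k)
      (B.sameAt_d_apply hF' _ k _)
  have h2 := B.d0_apply (B.h1_apply hF') k
  have h3 := B.p1_i1_apply (hF' (B.first B.last)) k
  refine (congrArg₂ (· + ·) (congrArg₂ (· + ·) h1 h2) h3).trans (Eq.trans ?_ (hF k))
  change vcls B.u B.v {k} _ + vcls B.u B.v {k} _ + vcls B.u B.v {k} _ = _
  rw [← map_add, ← map_add]
  refine vcls_congr _ _ ?_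
  rw [cls_telescope_fin (thin_singleton k) (j := w.get k) (by omega)
    (fun l hl => by rw [Finset.mem_singleton.1 hl]) (F k)]
  simp only [map_add, map_sub, map_sum, apply_ite (cls w {k}), map_zero]
  have e2 := B.sum_lt_last (w.get k) (fun i => cls w {k} (elim w i (F (B.first i))))
    fun i hi => cls_elim_of_gt hi _
  have e3 : (∑ i : Fin m, if (i : ℕ) < w.get k then
      cls w {k} (elim w i (F k)) - cls w {k} (elim w i (F (B.first i))) else 0) =
      (∑ i : Fin m, if (i : ℕ) < w.get k then cls w {k} (elim w i (F k)) else 0) -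
        ∑ i : Fin m, if (i : ℕ) < w.get k then cls w {k} (elim w i (F (B.first i))) else 0 := by
    rw [← Finset.sum_sub_distrib]
    refine Finset.sum_congr rfl fun i _ => ?_
    split_ifs
    · rfl
    · rw [sub_zero]
  rw [e3]
  linear_combination e2

/-- Composing `homotopy_one` with `d1` kills the other two terms. This is what makes `idem` an
idempotent. -/
theorem d1_h2_d1 : B.d1 ≫ B.h2 ≫ B.d1 = B.d1 := by
  have hd : B.d0 ≫ B.d1 = 0 := B.complex.d_comp_d 0 1 2
  have hi : B.i1 ≫ B.d1 = 0 := by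
    have := shift_E_epi B.shiftBy
    refine (cancel_epi ((shift B.shiftBy E).d 0 1)).1 ?_
    refine (Category.assoc _ _ _).symm.trans ?_
    refine (congrArg (· ≫ B.d1) B.i_comm.symm).trans ?_
    refine (Category.assoc B.i0 B.d0 B.d1).trans ?_
    rw [hd]
    exact comp_zero.trans comp_zero.symm
  have h := congrArg (· ≫ B.d1) B.homotopy_one
  simpa only [Preadditive.add_comp, Category.assoc, hd, hi, comp_zero, add_zero, Category.id_comp]
    using h

/-- The idempotent that projects to the complement in degree `2`. -/
def idem : B.cochains 2 ⟶ B.cochains 2 := 𝟙 _ - B.h2 ≫ B.d1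

theorem idem_idem : B.idem ≫ B.idem = B.idem := by
  simp only [idem, Preadditive.comp_sub, Preadditive.sub_comp, Category.id_comp, Category.comp_id,
    Category.assoc, B.d1_h2_d1]
  abel

/-- The splitting of `E` off the Khovanov complex. -/
def splitting : LowSplitting B.complex (shift B.shiftBy E) grZero
    (GrBimod.image B.idem B.idem_idem) where
  isZero := isZero_grZero
  isZero_E := shift_E_isZero _
  epi := shift_E_epi _
  p0 := B.p0
  p1 := B.p1
  i0 := B.i0
  i1 := B.i1
  h1 := B.h1
  h2 := B.h2
  q := GrBimod.toImage _ _
  s := GrBimod.ofImage _ _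
  p_comm := B.p_comm
  i_comm := B.i_comm
  i0_p0 := B.i0_p0
  homotopy0 := B.homotopy_zero
  homotopy1 := B.homotopy_one
  s_q := GrBimod.ofImage_toImage _ _
  q_s := by
    change B.h2 ≫ B.d1 + B.idem = 𝟙 _
    rw [idem, add_sub_cancel]

theorem finite_cochains (c : ℕ) : Module.Finite RR (B.cochains c) := by
  have := fun s : {s : Finset (Crossing w) // s.card = c} => finite_vertex B.u B.v s.1
  exact inferInstanceAs (Module.Finite RR
    (∀ s : {s : Finset (Crossing w) // s.card = c}, vertex w B.u B.v s.1))

theorem isZero_cochains {c : ℕ} (h : w.length < c) : IsZero (B.cochains c) := by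
  have h0 : IsEmpty {s : Finset (Crossing w) // s.card = c} := ⟨fun s => by
    have := Finset.card_le_univ s.1
    rw [s.2, Fintype.card_fin] at this
    omega⟩
  have : Subsingleton (B.cochains c) := inferInstanceAs (Subsingleton
    (∀ s : {s : Finset (Crossing w) // s.card = c}, vertex w B.u B.v s.1))
  exact GrBimod.isZero_of_subsingleton _

/-- The complex `E` splits off the Khovanov complex of a positive braid word in which all letters
occur, and the complement starts in degree `2`. -/
theorem exists_homotopyEquiv (hw : 2 ≤ w.length) :
    ∃ G : CochainComplex GrBimod ℕ, (∀ i, Module.Finite RR (G.X i)) ∧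
      (∀ i, i < 2 ∨ w.length < i → IsZero (G.X i)) ∧
      Nonempty (HomotopyEquiv B.complex (shift B.shiftBy E ⊞ G)) := by
  have hz : Module.Finite RR grZero :=
    inferInstanceAs (Module.Finite RR (∀ i : Empty, (i.elim : GrBimod)))
  refine ⟨B.splitting.rest, ?_, ?_, ⟨B.splitting.homotopyEquiv⟩⟩
  · rintro (_ | _ | _ | i)
    · exact hz
    · exact hz
    · have := B.finite_cochains 2
      exact Module.Finite.range (GrBimod.toLin B.idem)
    · exact B.finite_cochains (i + 3)
  · rintro (_ | _ | _ | i) hi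
    · exact isZero_grZero
    · exact isZero_grZero
    · omega
    · exact B.isZero_cochains (by omega)

end Firsts

end Splitting

/-! ### The links `L_n` -/

theorem length_wordL {n : ℕ} (hn : 1 ≤ n) : (wordL n).length = n * (n + 2) - 1 := by
  obtain ⟨n, rfl⟩ := Nat.exists_eq_add_of_le' hn
  simp only [wordL, List.length_append, List.length_flatten, List.map_replicate, List.length_finRange,
    List.sum_replicate, List.length_take, smul_eq_mul]
  rw [min_eq_left (by omega), show (n + 1) * (n + 1 + 2) = (n + 1 + 1) * (n + 1) + (n + 1) by ring]
  omega

theorem mem_wordL {n : ℕ} (i : Fin n) : i ∈ wordL n := by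
  refine List.mem_append_left _ (List.mem_flatten.2 ⟨List.finRange n, ?_, List.mem_finRange i⟩)
  exact List.mem_replicate.2 ⟨by omega, rfl⟩

theorem exists_firsts {m : ℕ} {w : List (Fin m)} (hw : ∀ i, i ∈ w) (e : Fin m)
    (he : (e : ℕ) + 1 = m) : ∃ B : Firsts w, B.last = e := by
  have h : ∀ i : Fin m, ∃ k : Crossing w, w.get k = i ∧ ∀ l, w.get l = i → k ≤ l := by
    intro i
    obtain ⟨k, hk⟩ := List.mem_iff_get.1 (hw i)
    obtain ⟨k, hk, hmin⟩ := Finset.exists_min_image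
      (Finset.univ.filter fun k : Crossing w => w.get k = i) id ⟨k, by simpa using hk⟩
    exact ⟨k, (Finset.mem_filter.1 hk).2, fun l hl =>
      hmin l (Finset.mem_filter.2 ⟨Finset.mem_univ _, hl⟩)⟩
  choose first h1 h2 using h
  exact ⟨⟨e, he, first, h1, fun l => h2 _ l rfl⟩, rfl⟩

end Khovanov

end

/-! ### The theorem for the links `L_n` -/

theorem mainTheorem3 (n : ℕ) (hn : 2 ≤ n) :
    ∃ G : CochainComplex Khovanov.GrBimod ℕ,
      (∀ i, Module.Finite Khovanov.RR (G.X i)) ∧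
      (∀ i, i < 2 ∨ n * (n + 2) - 1 < i → CategoryTheory.Limits.IsZero (G.X i)) ∧
      Nonempty (HomotopyEquiv (Khovanov.khovanovL n)
        (Khovanov.shift ((n : ℤ) * (n + 1)) Khovanov.E ⊞ G)) := by
  obtain ⟨B, hB⟩ := Khovanov.exists_firsts (w := Khovanov.wordL n) Khovanov.mem_wordL
    ⟨n - 1, by omega⟩ (Nat.sub_add_cancel (by omega))
  have hl := Khovanov.length_wordL (n := n) (by omega)
  -- Guarantees that the word has at least two letters, so that degree `2` is within the range
  -- allowed for `G`.
  have hpos : 2 * 4 ≤ n * (n + 2) := Nat.mul_le_mul hn (by omega)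
  obtain ⟨G, h1, h2, h3⟩ := B.exists_homotopyEquiv (by omega)
  -- With `m = n` the shift is `(n(n+2) - 1) + 1 - n`.
  have hK : B.shiftBy = (n : ℤ) * (n + 1) := by
    rw [Khovanov.Firsts.shiftBy, hl, Nat.cast_sub (by omega)]
    push_cast
    ring
  have hC : B.complex = Khovanov.khovanovL n := by
    have hu : B.u = ⟨n - 1, by omega⟩ := by
      rw [Khovanov.Firsts.u, hB]
      rfl
    have hv : B.v = Fin.last n := by
      rw [Khovanov.Firsts.v, hB]
      exact Fin.ext (Nat.sub_add_cancel (by omega))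
    rw [Khovanov.Firsts.complex, hu, hv]
    rfl
  rw [hK, hC] at h3
  rw [hl] at h2
  exact ⟨G, h1, h2, h3⟩
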